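/- Let $n\ge 1$ and $0<s<1$. For Lebesgue measurable sets $A,B\subset\mathbb R^n$ let $$L(A,B)=\int_A\int_B\frac{dy\,dx}{|x-y|^{n+s}}\in[0,\infty],$$ and for a bounded open set $\Omega$ and a measurable set $E$ let $$\mathcal J_\Omega(E)=L(E\cap\Omega,E^c)+L(E\setminus\Omega,E^c\cap\Omega).$$ A measurable set $E$ is a minimizer in $\Omega$ if $\mathcal J_\Omega(E)\le\mathcal J_\Omega(F)$ for every measurable $F$ with $F\setminus\Omega=E\setminus\Omega$. Sets are considered up to null sets, and interior and boundary are understood in the measure sense: $x$ is an interior point of $E$ if $|B_r(x)\setminus E|=0$ for some $r>0$, and $x\in\partial E$ if $|B_r(x)\cap E|>0$ and $|B_r(x)\setminus E|>0$ for all $r>0$. **Theorem (blow-up limit).** Let $E\subset\mathbb R^n$ be a minimizer in $B_1$ with $0\in\partial E$. Let $\lambda_k\to\infty$ be a sequence of real numbers and $C\subset\mathbb R^n$ a measurable set such that $\lambda_kE\to C$ in $L^1_{loc}(\mathbb R^n)$, that is, $|(\lambda_kE\,\triangle\,C)\cap K|\to0$ for every compact $K$. Then $C$ is a minimal cone: $C$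 is a minimizer in $B_R$ for every $R>0$, and for every $t>0$ one has $tC=C$ up to a null set, while the interior of $C$, the interior of $C^c$ and the boundary $\partial C$ (all in the measure sense) are exactly invariant under $x\mapsto tx$. -/

import Mathlib

open MeasureTheory Filter Topology Metric
open scoped ENNReal Pointwise

namespace NonlocalMinimal

/-- The interaction `L(A, B) = ∫_A ∫_B |x - y|^{-(n+s)} dy dx`, with values in `[0, ∞]`. -/
noncomputable def interaction {n : ℕ} (s : ℝ) (A B : Set (EuclideanSpace ℝ (Fin n))) : ℝ≥0∞ :=
  ∫⁻ x in A, ∫⁻ y in B, ENNReal.ofReal (1 / ‖x - y‖ ^ ((n : ℝ) + s))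

/-- The local energy `J_Ω(E) = L(E ∩ Ω, Eᶜ) + L(E \ Ω, Eᶜ ∩ Ω)`. -/
noncomputable def energy {n : ℕ} (s : ℝ) (Ω E : Set (EuclideanSpace ℝ (Fin n))) : ℝ≥0∞ :=
  interaction s (E ∩ Ω) Eᶜ + interaction s (E \ Ω) (Eᶜ ∩ Ω)

/-- `E` is a minimizer for `J` in `Ω`: its energy is at most that of every (Lebesgue measurable)
set `F` that coincides with `E` outside `Ω`. -/
structure IsMinimizer {n : ℕ} (s : ℝ) (Ω E : Set (EuclideanSpace ℝ (Fin n))) : Prop where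
  nullMeasurableSet : NullMeasurableSet E volume
  energy_le : ∀ F : Set (EuclideanSpace ℝ (Fin n)), NullMeasurableSet F volume →
    F ∩ Ωᶜ = E ∩ Ωᶜ → energy s Ω E ≤ energy s Ω F

/-- The interior of `E` in the measure sense. -/
def measureInterior {n : ℕ} (E : Set (EuclideanSpace ℝ (Fin n))) :
    Set (EuclideanSpace ℝ (Fin n)) :=
  {x | ∃ r > 0, volume (ball x r \ E) = 0}

/-- The boundary of `E` in the measure sense. It is the topological boundary of `E` when `E`
contains its interior in the measure sense and does not meet that of its complement. -/
def measureBoundary {n : ℕ} (E : Set (EuclideanSpace ℝ (Fin n))) :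
    Set (EuclideanSpace ℝ (Fin n)) :=
  {x | ∀ r > 0, 0 < volume (ball x r ∩ E) ∧ 0 < volume (ball x r ∩ Eᶜ)}

/-- `E k → C` in `L¹_loc`: `χ_{E k} → χ_C` in `L¹(K)` for every compact `K`. -/
def TendstoL1Loc {n : ℕ} (E : ℕ → Set (EuclideanSpace ℝ (Fin n)))
    (C : Set (EuclideanSpace ℝ (Fin n))) : Prop :=
  ∀ K : Set (EuclideanSpace ℝ (Fin n)), IsCompact K →
    Tendsto (fun k => volume (symmDiff (E k) C ∩ K)) atTop (𝓝 0)

end NonlocalMinimal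

/-! The nonlocal energy is made local by the Caffarelli–Silvestre extension. Let P(x, z) = z^s /
|(x, z)|^(n+s) and let u = P * χ_E on the half-space z > 0. Then div(z^(1-s) ∇u) = 0, the trace of u
on z = 0 is κ χ_E, where κ is the mass of P, and z^(1-s) ∂_z u tends to s times the fractional
Laplacian of χ_E. Because |χ(x) - χ(y)| = (χ(x) - χ(y))², the energy J is a quadratic form in χ_E
and can be compared with the weighted Dirichlet energy ∫ z^(1-s) |∇u|².

The comparison is `integral_perturbation_nonneg`: if J(E) ≤ J(F) and φ has trace κ(χ_F - χ_E), then
passing from u to u + φ does not lower the Dirichlet energy. Only this inequality is needed.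
Expanding |∇φ - ∇h|² ≥ 0, with h the extension of χ_F - χ_E, replaces ∇φ by quantities whose
integrals are boundary terms, and their limit as z → 0 is a multiple of J(F) - J(E).

It is applied to φ = u ∘ Ψ_t - u, where Ψ_t(X) = (1 + t cut(X)) X is a radial deformation of the
half-space. It preserves z = 0, and the competitor is the preimage of E under its trace. Both signs
of t are allowed, so u is stationary under Ψ_t (`IsMinimizer.stationary`). Stationarity yields the
monotonicity formula: Φ(r) = r^(s-n) ∫ cut_r z^(1-s) |∇u|² is nondecreasing, and its derivative
controls the radial energy ∫ z^(1-s) (X·∇u)² (`IsMinimizer.hasDerivAt_profile`). Since Φ is bounded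
below it has a limit at 0, so the scale invariant radial energy in small half balls tends to 0
(`IsMinimizer.tendsto_rdens`).

Rescaling by λ_k turns small half balls into a fixed one. L¹_loc convergence gives pointwise
convergence of the gradients of the extensions, and Fatou's lemma gives X·∇u_C = 0 for the extension
u_C of χ_C (`extD_apply_self_eq_zero`). Thus u_C is constant along rays, and its boundary values
show that χ_C(tx) = χ_C(x) almost everywhere (`chi_smul_ae_eq`). Neither density estimates nor
convergence of energies are used.

Minimality of C follows from lower semicontinuity of J and from gluing a competitor of C inside the
ball to λ_kE outside it (`isMinimizer_of_tendsto`). The interior in the measure sense depends only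
on the class of a set modulo null sets, so invariance up to null sets becomes exact invariance of
interiors and boundary. -/

namespace NonlocalMinimal

/-- Euclidean space of dimension `n`. -/
abbrev Space (n : ℕ) := EuclideanSpace ℝ (Fin n)

variable {n : ℕ} {s : ℝ}

/-! ### The Poisson kernel on the half-space -/

/-- The squared Euclidean norm on `ℝⁿ × ℝ`. -/
noncomputable def rsq (p : Space n × ℝ) : ℝ := ‖p.1‖ ^ 2 + p.2 ^ 2

/-- The Euclidean inner product with `p` on `ℝⁿ × ℝ`. -/
noncomputable def rdot (p : Space n × ℝ) : Space n × ℝ →L[ℝ] ℝ :=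
  (innerSL ℝ p.1).comp (ContinuousLinearMap.fst ℝ (Space n) ℝ) +
    p.2 • ContinuousLinearMap.snd ℝ (Space n) ℝ

lemma rdot_apply (p h : Space n × ℝ) : rdot p h = inner ℝ p.1 h.1 + p.2 * h.2 := by
  simp [rdot]

lemma rdot_self (p : Space n × ℝ) : rdot p p = rsq p := by
  rw [rdot_apply, rsq, real_inner_self_eq_norm_sq]; ring

lemma rsq_nonneg (p : Space n × ℝ) : 0 ≤ rsq p := by unfold rsq; positivity

lemma rsq_pos {p : Space n × ℝ} (hp : 0 < p.2) : 0 < rsq p := by unfold rsq; positivity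

lemma sq_le_rsq (p : Space n × ℝ) : p.2 ^ 2 ≤ rsq p := by
  unfold rsq; nlinarith [sq_nonneg ‖p.1‖]

lemma norm_sq_le_rsq (p : Space n × ℝ) : ‖p.1‖ ^ 2 ≤ rsq p := by
  unfold rsq; nlinarith [sq_nonneg p.2]

lemma hasFDerivAt_rsq (p : Space n × ℝ) : HasFDerivAt rsq ((2 : ℝ) • rdot p) p := by
  have h1 : HasFDerivAt (fun p : Space n × ℝ => ‖p.1‖ ^ 2 + p.2 ^ 2) _ p :=
    (hasFDerivAt_fst.norm_sq).add (hasFDerivAt_snd.pow 2)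
  refine h1.congr_fderiv ?_
  ext h <;> simp [rdot_apply]

lemma continuous_rsq : Continuous (rsq : Space n × ℝ → ℝ) := by unfold rsq; fun_prop

lemma continuous_rdot : Continuous (rdot : Space n × ℝ → Space n × ℝ →L[ℝ] ℝ) := by
  unfold rdot
  fun_prop

/-- The product `Space n × ℝ` carries the sup norm, so Cauchy–Schwarz is applied to each component
separately; this is the source of the factor 2. -/
lemma abs_rdot_le (p h : Space n × ℝ) : |rdot p h| ≤ 2 * √(rsq p) * ‖h‖ := by
  rw [rdot_apply]
  have h1 : |inner ℝ p.1 h.1| ≤ √(rsq p) * ‖h‖ := by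
    refine (abs_real_inner_le_norm _ _).trans ?_
    gcongr
    · exact Real.le_sqrt_of_sq_le (norm_sq_le_rsq p)
    · exact norm_fst_le h
  have h2 : |p.2 * h.2| ≤ √(rsq p) * ‖h‖ := by
    rw [abs_mul]
    gcongr
    · exact Real.abs_le_sqrt (sq_le_rsq p)
    · exact norm_snd_le h
  exact (abs_add_le _ _).trans (by linarith)

/-- The radial factor `|X|^{-(n+s)}`. -/
noncomputable def rker (s : ℝ) (p : Space n × ℝ) : ℝ := rsq p ^ (-((n : ℝ) + s) / 2)

/-- The (unnormalised) Poisson kernel of the operator `div (z^{1-s} ∇ ·)` on the half-space. -/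
noncomputable def pker (s : ℝ) (p : Space n × ℝ) : ℝ := p.2 ^ s * rker s p

/-- The derivative of the Poisson kernel. -/
noncomputable def pkerD (s : ℝ) (p : Space n × ℝ) : Space n × ℝ →L[ℝ] ℝ :=
  (s * p.2 ^ (s - 1) * rker s p) • ContinuousLinearMap.snd ℝ (Space n) ℝ -
    (((n : ℝ) + s) * p.2 ^ s * rsq p ^ (-((n : ℝ) + s) / 2 - 1)) • rdot p

lemma rker_nonneg (p : Space n × ℝ) : 0 ≤ rker s p := Real.rpow_nonneg (rsq_nonneg p) _

lemma pker_nonneg {p : Space n × ℝ} (hp : 0 ≤ p.2) : 0 ≤ pker s p :=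
  mul_nonneg (Real.rpow_nonneg hp _) (rker_nonneg p)

lemma hasFDerivAt_pker {p : Space n × ℝ} (hp : 0 < p.2) :
    HasFDerivAt (pker s) (pkerD s p) p := by
  have h1 : HasFDerivAt (fun p : Space n × ℝ => p.2 ^ s) _ p :=
    hasFDerivAt_snd.rpow_const (p := s) (Or.inl hp.ne')
  have h2 : HasFDerivAt (rker s) _ p :=
    (hasFDerivAt_rsq p).rpow_const (p := -((n : ℝ) + s) / 2) (Or.inl (rsq_pos hp).ne')
  refine (h1.mul h2).congr_fderiv ?_
  refine ContinuousLinearMap.ext fun h => ?_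
  simp [pkerD, rker]
  ring

/-- The two terms of the derivative have the same size: z^s |X|^(-(n+s)-2) |X| ≤ z^(s-1)
|X|^(-(n+s)) because z ≤ |X|. -/
lemma norm_pkerD_le (hs : 0 < s) {p : Space n × ℝ} (hp : 0 < p.2) :
    ‖pkerD s p‖ ≤ (s + 2 * (n + s)) * (p.2 ^ (s - 1) * rker s p) := by
  have hq := rsq_pos hp
  refine ContinuousLinearMap.opNorm_le_bound _
    (mul_nonneg (by positivity) (mul_nonneg (by positivity) (rker_nonneg p))) fun h => ?_
  have e : p.2 ^ s * rsq p ^ (-((n : ℝ) + s) / 2 - 1) * √(rsq p) ≤ p.2 ^ (s - 1) * rker s p := by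
    have h1 : rsq p ^ (-((n : ℝ) + s) / 2 - 1) = rker s p * (rsq p)⁻¹ := by
      rw [Real.rpow_sub_one hq.ne', rker]; rfl
    have h2 : p.2 ^ s = p.2 ^ (s - 1) * p.2 := by
      rw [Real.rpow_sub_one hp.ne']; field_simp
    have h3 : p.2 * ((rsq p)⁻¹ * √(rsq p)) ≤ 1 := by
      have : p.2 ≤ √(rsq p) := Real.le_sqrt_of_sq_le (sq_le_rsq p)
      have h4 : 0 < √(rsq p) := Real.sqrt_pos.2 hq
      have h5 : (rsq p)⁻¹ * √(rsq p) = (√(rsq p))⁻¹ := by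
        rw [inv_mul_eq_div, Real.sqrt_div_self']; simp
      rw [h5, ← div_eq_mul_inv, div_le_one h4]; exact this
    rw [h1, h2]
    calc _ = p.2 ^ (s - 1) * rker s p * (p.2 * ((rsq p)⁻¹ * √(rsq p))) := by ring
      _ ≤ p.2 ^ (s - 1) * rker s p * 1 := by
        gcongr
        exact mul_nonneg (by positivity) (rker_nonneg p)
      _ = _ := by ring
  have hr := rker_nonneg (s := s) p
  simp only [pkerD, sub_apply, smul_apply, smul_eq_mul, ContinuousLinearMap.coe_snd']
  rw [Real.norm_eq_abs]
  refine (abs_sub _ _).trans ?_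
  rw [abs_mul _ h.2, abs_mul _ (rdot p h),
    abs_of_nonneg (by positivity : 0 ≤ s * p.2 ^ (s - 1) * rker s p),
    abs_of_nonneg (by positivity : 0 ≤ ((n : ℝ) + s) * p.2 ^ s * rsq p ^ (-((n : ℝ) + s) / 2 - 1))]
  have h1 : |h.2| ≤ ‖h‖ := norm_snd_le h
  calc _ ≤ s * p.2 ^ (s - 1) * rker s p * ‖h‖ +
      ((n : ℝ) + s) * p.2 ^ s * rsq p ^ (-((n : ℝ) + s) / 2 - 1) * (2 * √(rsq p) * ‖h‖) := by
        gcongr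
        exact abs_rdot_le p h
    _ = s * p.2 ^ (s - 1) * rker s p * ‖h‖ + 2 * ((n : ℝ) + s) *
      (p.2 ^ s * rsq p ^ (-((n : ℝ) + s) / 2 - 1) * √(rsq p)) * ‖h‖ := by ring
    _ ≤ s * p.2 ^ (s - 1) * rker s p * ‖h‖ + 2 * ((n : ℝ) + s) *
      (p.2 ^ (s - 1) * rker s p) * ‖h‖ := by gcongr
    _ = _ := by ring

/-- Horizontal translation of the half-space. -/
def shift (y : Space n) (p : Space n × ℝ) : Space n × ℝ := (p.1 - y, p.2)

@[simp] lemma shift_snd (y : Space n) (p : Space n × ℝ) : (shift y p).2 = p.2 := rfl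

@[simp] lemma shift_fst (y : Space n) (p : Space n × ℝ) : (shift y p).1 = p.1 - y := rfl

lemma continuous_shift : Continuous fun x : Space n × (Space n × ℝ) => shift x.1 x.2 := by
  unfold shift; fun_prop

lemma measurable_rker : Measurable (rker s : Space n × ℝ → ℝ) :=
  continuous_rsq.measurable.pow_const _

lemma measurable_pker : Measurable (pker s : Space n × ℝ → ℝ) :=
  (measurable_snd.pow_const _).mul measurable_rker

lemma measurable_pkerD : Measurable (pkerD s : Space n × ℝ → Space n × ℝ →L[ℝ] ℝ) := by
  unfold pkerD
  refine Measurable.sub ?_ ?_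
  · exact Measurable.smul_const ((measurable_const.mul (measurable_snd.pow_const _)).mul
      measurable_rker) _
  · exact Measurable.smul ((measurable_const.mul (measurable_snd.pow_const _)).mul
      (continuous_rsq.measurable.pow_const _)) continuous_rdot.measurable

lemma measurable_shift (p : Space n × ℝ) : Measurable fun y : Space n => shift y p :=
  (continuous_shift.comp (continuous_id.prodMk continuous_const)).measurable

lemma rker_eq_scaled {z : ℝ} (hz : 0 < z) (x : Space n) :
    rker s (x, z) = z ^ (-((n : ℝ) + s)) * (1 + ‖z⁻¹ • x‖ ^ 2) ^ (-((n : ℝ) + s) / 2) := by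
  have h1 : rsq (x, z) = z ^ 2 * (1 + ‖z⁻¹ • x‖ ^ 2) := by
    simp only [rsq, norm_smul, norm_inv, Real.norm_eq_abs, abs_of_pos hz]
    field_simp
    ring
  rw [rker, h1, Real.mul_rpow (by positivity) (by positivity), ← Real.rpow_natCast,
    ← Real.rpow_mul hz.le]
  congr 2
  push_cast
  ring

lemma integrable_bracket (hs : 0 < s) :
    Integrable fun x : Space n => (1 + ‖x‖ ^ 2) ^ (-((n : ℝ) + s) / 2) :=
  integrable_rpow_neg_one_add_norm_sq (by simp [hs])

/-- The integral of `(1 + |x|²)^{-(n+s)/2}`. -/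
noncomputable def kappa (n : ℕ) (s : ℝ) : ℝ :=
  ∫ x : Space n, (1 + ‖x‖ ^ 2) ^ (-((n : ℝ) + s) / 2)

lemma kappa_pos (hs : 0 < s) : 0 < kappa n s := by
  unfold kappa
  rw [integral_pos_iff_support_of_nonneg (fun x => by positivity) (integrable_bracket hs)]
  have : (Function.support fun x : Space n => (1 + ‖x‖ ^ 2) ^ (-((n : ℝ) + s) / 2)) = Set.univ := by
    ext x
    simp only [Function.mem_support, Set.mem_univ, iff_true]
    positivity
  rw [this, Measure.measure_univ_pos]
  exact NeZero.ne _

lemma integrable_rker (hs : 0 < s) {z : ℝ} (hz : 0 < z) :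
    Integrable fun x : Space n => rker s (x, z) := by
  simp_rw [rker_eq_scaled hz]
  exact ((integrable_bracket hs).comp_smul (inv_ne_zero hz.ne')).const_mul _

lemma integral_rker {z : ℝ} (hz : 0 < z) :
    ∫ x : Space n, rker s (x, z) = z ^ (-s) * kappa n s := by
  simp_rw [rker_eq_scaled hz]
  rw [integral_const_mul, Measure.integral_comp_smul volume
    (fun x : Space n => (1 + ‖x‖ ^ 2) ^ (-((n : ℝ) + s) / 2)), kappa]
  simp only [finrank_euclideanSpace, Fintype.card_fin, inv_pow, inv_inv, smul_eq_mul]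
  rw [abs_of_pos (by positivity), ← mul_assoc, ← Real.rpow_natCast, ← Real.rpow_add hz]
  congr 2
  ring

lemma integrable_rker_shift (hs : 0 < s) {p : Space n × ℝ} (hp : 0 < p.2) :
    Integrable fun y : Space n => rker s (shift y p) :=
  (integrable_rker hs hp).comp_sub_left p.1

lemma integral_rker_shift {p : Space n × ℝ} (hp : 0 < p.2) :
    ∫ y : Space n, rker s (shift y p) = p.2 ^ (-s) * kappa n s := by
  rw [← integral_rker hp]
  exact integral_sub_left_eq_self (fun x => rker s (x, p.2)) volume p.1

lemma integrable_pker_shift (hs : 0 < s) {p : Space n × ℝ} (hp : 0 < p.2) :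
    Integrable fun y : Space n => pker s (shift y p) :=
  (integrable_rker_shift hs hp).const_mul (p.2 ^ s)

/-- The powers of z cancel, so the kernel has the same mass κ at every height. It is left
unnormalised, which is why κ appears in every trace below. -/
lemma integral_pker_shift {p : Space n × ℝ} (hp : 0 < p.2) :
    ∫ y : Space n, pker s (shift y p) = kappa n s := by
  simp only [pker, shift_snd]
  rw [integral_const_mul, integral_rker_shift hp, ← mul_assoc, ← Real.rpow_add hp]
  simp

lemma rker_shift_le (hs : 0 < s) {p p₀ : Space n × ℝ} (hp₀ : 0 < p₀.2)
    (hp : p ∈ ball p₀ (p₀.2 / 2)) (y : Space n) :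
    rker s (shift y p) ≤ 6 ^ (((n : ℝ) + s) / 2) * rker s (shift y p₀) := by
  rw [mem_ball, Prod.dist_eq, max_lt_iff, dist_eq_norm, Real.dist_eq, abs_lt] at hp
  have h2 : 0 < p.2 := by linarith
  have h3 : 0 < rsq (shift y p₀) := rsq_pos (by simpa using hp₀)
  -- With z₀ the height of p₀ and z that of p, |x₀ - y|² ≤ 2|x - y|² + z₀²/2. Adding z₀² and using
  -- z₀ < 2z gives at most 2|x - y|² + 6z².
  have h4 : rsq (shift y p₀) / 6 ≤ rsq (shift y p) := by
    simp only [rsq, shift_fst, shift_snd]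
    have h5 : ‖p₀.1 - y‖ ≤ ‖p.1 - y‖ + p₀.2 / 2 := by
      have := norm_sub_le_norm_sub_add_norm_sub p₀.1 p.1 y
      rw [norm_sub_rev p₀.1 p.1] at this
      linarith
    have h6 : ‖p₀.1 - y‖ ^ 2 ≤ (‖p.1 - y‖ + p₀.2 / 2) ^ 2 := by gcongr
    nlinarith [sq_nonneg (‖p.1 - y‖ - p₀.2 / 2)]
  unfold rker
  calc _ ≤ (rsq (shift y p₀) / 6) ^ (-((n : ℝ) + s) / 2) := by
        refine Real.rpow_le_rpow_of_nonpos (by positivity) h4 ?_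
        have : (0 : ℝ) ≤ n := by positivity
        linarith
    _ = _ := by
        rw [Real.div_rpow h3.le (by norm_num), div_eq_mul_inv, ← Real.rpow_neg (by norm_num),
          mul_comm]
        congr 2
        ring

/-! ### The Poisson extension and its derivative -/

/-- The extension of a bounded function on `ℝⁿ` to the half-space by the Poisson kernel. -/
noncomputable def ext (s : ℝ) (g : Space n → ℝ) (p : Space n × ℝ) : ℝ :=
  ∫ y, g y * pker s (shift y p)

/-- The derivative of the Poisson extension. -/
noncomputable def extD (s : ℝ) (g : Space n → ℝ) (p : Space n × ℝ) : Space n × ℝ →L[ℝ] ℝ :=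
  ∫ y, g y • pkerD s (shift y p)

lemma aestronglyMeasurable_pkerD_shift (p : Space n × ℝ) :
    AEStronglyMeasurable (fun y : Space n => pkerD s (shift y p)) :=
  (measurable_pkerD.comp (measurable_shift p)).aestronglyMeasurable

lemma integrable_pkerD_shift (hs : 0 < s) {p : Space n × ℝ} (hp : 0 < p.2) :
    Integrable fun y : Space n => pkerD s (shift y p) := by
  refine Integrable.mono' (((integrable_rker_shift hs hp).const_mul (p.2 ^ (s - 1))).const_mul
    (s + 2 * (n + s))) (aestronglyMeasurable_pkerD_shift p) (ae_of_all _ fun y => ?_)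
  exact norm_pkerD_le hs (by simpa using hp)

lemma integrable_smul_pkerD_shift (hs : 0 < s) {g : Space n → ℝ}
    (hg : AEStronglyMeasurable g) {M : ℝ} (hb : ∀ x, |g x| ≤ M) {p : Space n × ℝ} (hp : 0 < p.2) :
    Integrable fun y : Space n => g y • pkerD s (shift y p) :=
  (integrable_pkerD_shift hs hp).bdd_smul M hg (ae_of_all _ fun x => hb x)

lemma integrable_mul_pker_shift (hs : 0 < s) {g : Space n → ℝ}
    (hg : AEStronglyMeasurable g) {M : ℝ} (hb : ∀ x, |g x| ≤ M) {p : Space n × ℝ} (hp : 0 < p.2) :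
    Integrable fun y : Space n => g y * pker s (shift y p) :=
  (integrable_pker_shift hs hp).bdd_mul hg (c := M) (ae_of_all _ fun x => hb x)

lemma abs_ext_le (hs : 0 < s) {g : Space n → ℝ} {M : ℝ} (hb : ∀ x, |g x| ≤ M)
    {p : Space n × ℝ} (hp : 0 < p.2) : |ext s g p| ≤ M * kappa n s := by
  unfold ext
  rw [← Real.norm_eq_abs, ← integral_pker_shift (s := s) hp, ← integral_const_mul]
  refine norm_integral_le_of_norm_le ((integrable_pker_shift hs hp).const_mul M)
    (ae_of_all _ fun y => ?_)
  rw [norm_mul, Real.norm_eq_abs, Real.norm_eq_abs, abs_of_nonneg (pker_nonneg (by simpa using hp.le))]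
  exact mul_le_mul_of_nonneg_right (hb y) (pker_nonneg (by simpa using hp.le))

lemma norm_extD_le (hs : 0 < s) {g : Space n → ℝ} {M : ℝ} (hb : ∀ x, |g x| ≤ M)
    {p : Space n × ℝ} (hp : 0 < p.2) :
    ‖extD s g p‖ ≤ M * (s + 2 * (n + s)) * kappa n s / p.2 := by
  have hM : 0 ≤ M := (abs_nonneg _).trans (hb 0)
  unfold extD
  have e : M * (s + 2 * (n + s)) * kappa n s / p.2 =
      ∫ y, M * ((s + 2 * (n + s)) * (p.2 ^ (s - 1) * rker s (shift y p))) := by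
    rw [integral_const_mul, integral_const_mul, integral_const_mul, integral_rker_shift hp,
      ← mul_assoc (p.2 ^ (s - 1)), ← Real.rpow_add hp]
    rw [show s - 1 + -s = -1 by ring, Real.rpow_neg_one]
    field_simp
  rw [e]
  refine norm_integral_le_of_norm_le
    ((((integrable_rker_shift hs hp).const_mul _).const_mul _).const_mul _)
    (ae_of_all _ fun y => ?_)
  rw [norm_smul]
  exact mul_le_mul (hb y) (norm_pkerD_le hs (by simpa using hp)) (norm_nonneg _) hM

/-- The sum of the two endpoint values is a bound that serves exponents of either sign. -/
lemma rpow_le_add_of_mem_Icc {a b z t : ℝ} (ha : 0 < a) (hz : a ≤ z) (hz' : z ≤ b) :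
    z ^ t ≤ a ^ t + b ^ t := by
  have hb : 0 < b := by linarith
  rcases le_total 0 t with ht | ht
  · have := Real.rpow_le_rpow (by linarith) hz' ht
    have := Real.rpow_nonneg ha.le t
    linarith
  · have := Real.rpow_le_rpow_of_nonpos ha hz ht
    have := Real.rpow_nonneg hb.le t
    linarith

/-- A locally uniform integrable bound for the derivative of the Poisson kernel. -/
noncomputable def pkerDBound (s : ℝ) (p₀ : Space n × ℝ) (y : Space n) : ℝ :=
  (s + 2 * (n + s)) * (((p₀.2 / 2) ^ (s - 1) + (2 * p₀.2) ^ (s - 1)) *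
    (6 ^ (((n : ℝ) + s) / 2) * rker s (shift y p₀)))

lemma integrable_pkerDBound (hs : 0 < s) {p₀ : Space n × ℝ} (hp₀ : 0 < p₀.2) :
    Integrable (pkerDBound s p₀) :=
  (((integrable_rker_shift hs hp₀).const_mul _).const_mul _).const_mul _

lemma snd_pos_of_mem_ball {p p₀ : Space n × ℝ} (hp : p ∈ ball p₀ (p₀.2 / 2)) :
    p₀.2 / 2 < p.2 ∧ p.2 < 2 * p₀.2 := by
  have h0 : 0 < p₀.2 := by have := pos_of_mem_ball hp; linarith
  rw [mem_ball, Prod.dist_eq, max_lt_iff, dist_eq_norm, Real.dist_eq, abs_lt] at hp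
  constructor <;> linarith

lemma norm_pkerD_shift_le (hs : 0 < s) {p p₀ : Space n × ℝ}
    (hp : p ∈ ball p₀ (p₀.2 / 2)) (y : Space n) :
    ‖pkerD s (shift y p)‖ ≤ pkerDBound s p₀ y := by
  have h0 : 0 < p₀.2 := by have := pos_of_mem_ball hp; linarith
  obtain ⟨h1, h2⟩ := snd_pos_of_mem_ball hp
  refine (norm_pkerD_le hs (by rw [shift_snd]; linarith)).trans ?_
  unfold pkerDBound
  gcongr
  · exact rker_nonneg _
  · exact rpow_le_add_of_mem_Icc (by linarith) h1.le h2.le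
  · exact rker_shift_le hs h0 hp y

lemma hasFDerivAt_shift (y : Space n) (p : Space n × ℝ) :
    HasFDerivAt (shift y) (ContinuousLinearMap.id ℝ (Space n × ℝ)) p := by
  have : shift y = fun p => p - (y, 0) := by ext p <;> simp [shift]
  rw [this]
  exact (hasFDerivAt_id p).sub_const _

/-- Differentiation under the integral sign. On the ball of radius p.2 / 2 the height stays
comparable to that of p, so `pkerDBound` dominates the derivatives. -/
lemma hasFDerivAt_ext (hs : 0 < s) {g : Space n → ℝ}
    (hg : AEStronglyMeasurable g) {M : ℝ} (hb : ∀ x, |g x| ≤ M) {p : Space n × ℝ} (hp : 0 < p.2) :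
    HasFDerivAt (ext s g) (extD s g p) p := by
  have hM : 0 ≤ M := (abs_nonneg _).trans (hb 0)
  refine hasFDerivAt_integral_of_dominated_of_fderiv_le (F := fun p y => g y * pker s (shift y p))
    (F' := fun p y => g y • pkerD s (shift y p))
    (bound := fun y => M * pkerDBound s p y) (s := ball p (p.2 / 2))
    (ball_mem_nhds _ (by positivity)) ?_ ?_ ?_ ?_ ?_ ?_
  · exact Eventually.of_forall fun p =>
      hg.mul (measurable_pker.comp (measurable_shift p)).aestronglyMeasurable
  · exact integrable_mul_pker_shift hs hg hb hp
  · exact hg.smul (aestronglyMeasurable_pkerD_shift p)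
  · refine ae_of_all _ fun y p' hp' => ?_
    rw [norm_smul]
    exact mul_le_mul (hb y) (norm_pkerD_shift_le hs hp' y) (norm_nonneg _) hM
  · exact (integrable_pkerDBound hs hp).const_mul M
  · refine ae_of_all _ fun y p' hp' => ?_
    have h1 := (snd_pos_of_mem_ball hp').1
    have h2 : HasFDerivAt (pker s) (pkerD s (shift y p')) (shift y p') :=
      hasFDerivAt_pker (by rw [shift_snd]; linarith)
    have h3 := h2.comp p' (hasFDerivAt_shift y p')
    exact (h3.const_mul (g y)).congr_fderiv (by simp)

lemma continuousAt_pkerD {p : Space n × ℝ} (hp : 0 < p.2) : ContinuousAt (pkerD s) p := by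
  have h1 : ContinuousAt (fun p : Space n × ℝ => p.2) p := continuousAt_snd
  have h2 : ContinuousAt (rsq : Space n × ℝ → ℝ) p := continuous_rsq.continuousAt
  have hq := (rsq_pos hp).ne'
  unfold pkerD rker
  refine ContinuousAt.fun_sub (ContinuousAt.fun_smul ?_ continuousAt_const)
    (ContinuousAt.fun_smul ?_ continuous_rdot.continuousAt)
  · exact (continuousAt_const.mul (h1.rpow_const (Or.inl hp.ne'))).mul (h2.rpow_const (Or.inl hq))
  · exact (continuousAt_const.mul (h1.rpow_const (Or.inl hp.ne'))).mul (h2.rpow_const (Or.inl hq))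

lemma continuousAt_extD (hs : 0 < s) {g : Space n → ℝ}
    (hg : AEStronglyMeasurable g) {M : ℝ} (hb : ∀ x, |g x| ≤ M) {p : Space n × ℝ} (hp : 0 < p.2) :
    ContinuousAt (extD s g) p := by
  have hM : 0 ≤ M := (abs_nonneg _).trans (hb 0)
  refine continuousAt_of_dominated (bound := fun y => M * pkerDBound s p y) ?_ ?_ ?_ ?_
  · exact Eventually.of_forall fun p => hg.smul (aestronglyMeasurable_pkerD_shift p)
  · filter_upwards [ball_mem_nhds p (by positivity : 0 < p.2 / 2)] with p' hp'
    refine ae_of_all _ fun y => ?_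
    rw [norm_smul]
    exact mul_le_mul (hb y) (norm_pkerD_shift_le hs hp' y) (norm_nonneg _) hM
  · exact (integrable_pkerDBound hs hp).const_mul M
  · refine ae_of_all _ fun y => continuousAt_const.fun_smul ?_
    exact ContinuousAt.comp (f := fun p => shift y p) (g := pkerD s)
      (continuousAt_pkerD (by simpa using hp))
      (continuous_shift.comp (continuous_const.prodMk continuous_id)).continuousAt

/-! ### The Euclidean pairing of gradients -/

/-- The Euclidean inner product of two linear forms on `ℝⁿ × ℝ`. -/
noncomputable def gdot (L M : Space n × ℝ →L[ℝ] ℝ) : ℝ :=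
  ∑ i, L (EuclideanSpace.single i 1, 0) * M (EuclideanSpace.single i 1, 0) + L (0, 1) * M (0, 1)

lemma gdot_comm (L M : Space n × ℝ →L[ℝ] ℝ) : gdot L M = gdot M L := by
  simp only [gdot, mul_comm]

lemma gdot_add_left (L L' M : Space n × ℝ →L[ℝ] ℝ) :
    gdot (L + L') M = gdot L M + gdot L' M := by
  simp only [gdot, add_apply, add_mul, Finset.sum_add_distrib]; ring

lemma gdot_smul_left (c : ℝ) (L M : Space n × ℝ →L[ℝ] ℝ) : gdot (c • L) M = c * gdot L M := by
  simp only [gdot, smul_apply, smul_eq_mul, mul_add, Finset.mul_sum, mul_assoc]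

lemma gdot_sub_left (L L' M : Space n × ℝ →L[ℝ] ℝ) :
    gdot (L - L') M = gdot L M - gdot L' M := by
  simp only [gdot, sub_apply, sub_mul, Finset.sum_sub_distrib]; ring

lemma gdot_add_right (L M M' : Space n × ℝ →L[ℝ] ℝ) :
    gdot L (M + M') = gdot L M + gdot L M' := by
  rw [gdot_comm, gdot_add_left, gdot_comm M, gdot_comm M']

lemma gdot_sub_right (L M M' : Space n × ℝ →L[ℝ] ℝ) :
    gdot L (M - M') = gdot L M - gdot L M' := by
  rw [gdot_comm, gdot_sub_left, gdot_comm M, gdot_comm M']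

lemma gdot_smul_right (c : ℝ) (L M : Space n × ℝ →L[ℝ] ℝ) : gdot L (c • M) = c * gdot L M := by
  rw [gdot_comm, gdot_smul_left, gdot_comm]

lemma gdot_self_nonneg (L : Space n × ℝ →L[ℝ] ℝ) : 0 ≤ gdot L L :=
  add_nonneg (Finset.sum_nonneg fun _ _ => mul_self_nonneg _) (mul_self_nonneg _)

@[simp] lemma gdot_zero_right (L : Space n × ℝ →L[ℝ] ℝ) : gdot L 0 = 0 := by simp [gdot]

lemma two_mul_gdot_le (L M : Space n × ℝ →L[ℝ] ℝ) : 2 * gdot L M ≤ gdot L L + gdot M M := by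
  have := gdot_self_nonneg (L - M)
  rw [gdot_sub_left, gdot_sub_right, gdot_sub_right, gdot_comm M L] at this
  linarith

lemma prod_eq_sum_single (p : Space n × ℝ) :
    p = ∑ i, p.1 i • ((EuclideanSpace.single i (1 : ℝ), (0 : ℝ)) : Space n × ℝ) +
      p.2 • ((0, 1) : Space n × ℝ) := by
  refine Prod.ext ?_ ?_
  · ext j
    simp [Prod.fst_sum, Finset.sum_apply, Pi.single_apply]
  · simp [Prod.snd_sum]

lemma gdot_rdot (p : Space n × ℝ) (L : Space n × ℝ →L[ℝ] ℝ) : gdot (rdot p) L = L p := by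
  conv_rhs => rw [prod_eq_sum_single p, map_add, map_sum, map_smul]
  simp only [map_smul]
  simp [gdot, rdot_apply, EuclideanSpace.inner_single_right]

/-- Cauchy–Schwarz for `gdot`, with `rdot p` representing evaluation at p. It bounds the radial
derivative of the extension by |X| |∇u|, which the operator norm for the sup norm would not give
with constant 1. -/
lemma sq_apply_le (p : Space n × ℝ) (L : Space n × ℝ →L[ℝ] ℝ) :
    (L p) ^ 2 ≤ rsq p * gdot L L := by
  have h : ∀ t : ℝ, 0 ≤ gdot L L - 2 * t * L p + t ^ 2 * rsq p := by
    intro t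
    have := gdot_self_nonneg (L - t • rdot p)
    rw [gdot_sub_left, gdot_sub_right, gdot_sub_right, gdot_smul_left, gdot_smul_right,
      gdot_smul_left, gdot_smul_right, gdot_comm L (rdot p), gdot_rdot, gdot_rdot,
      rdot_self] at this
    linarith
  rcases (rsq_nonneg p).eq_or_lt with h0 | h0
  · have hp : L p = 0 := by
      have hp0 : p = 0 := by
        have h1 : p.2 = 0 := by have := sq_le_rsq p; rw [← h0] at this; nlinarith
        have h2 : ‖p.1‖ = 0 := by have := norm_sq_le_rsq p; rw [← h0] at this; nlinarith
        exact Prod.ext (norm_eq_zero.1 h2) h1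
      simp [hp0]
    rw [hp, ← h0]; simp
  · have := h (L p / rsq p)
    have e : gdot L L - 2 * (L p / rsq p) * L p + (L p / rsq p) ^ 2 * rsq p =
      gdot L L - (L p) ^ 2 / rsq p := by field_simp; ring
    rw [e, sub_nonneg, div_le_iff₀ h0] at this
    linarith

lemma norm_single_prod (i : Fin n) :
    ‖((EuclideanSpace.single i (1 : ℝ), (0 : ℝ)) : Space n × ℝ)‖ ≤ 1 := by
  simp [Prod.norm_def]

lemma norm_zero_prod_one : ‖((0, 1) : Space n × ℝ)‖ ≤ 1 := by simp [Prod.norm_def]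

lemma abs_gdot_le (L M : Space n × ℝ →L[ℝ] ℝ) : |gdot L M| ≤ (n + 1) * (‖L‖ * ‖M‖) := by
  have h : ∀ h : Space n × ℝ, ‖h‖ ≤ 1 → |L h * M h| ≤ ‖L‖ * ‖M‖ := by
    intro h hh
    rw [abs_mul]
    exact mul_le_mul (by simpa using L.le_opNorm_of_le hh) (by simpa using M.le_opNorm_of_le hh)
      (abs_nonneg _) (norm_nonneg _)
  unfold gdot
  refine (abs_add_le _ _).trans ?_
  rw [add_mul, one_mul]
  refine add_le_add ((Finset.abs_sum_le_sum_abs _ _).trans ?_) (h _ norm_zero_prod_one)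
  refine (Finset.sum_le_sum fun i _ => h _ (norm_single_prod i)).trans ?_
  simp

lemma continuous_gdot :
    Continuous fun x : (Space n × ℝ →L[ℝ] ℝ) × (Space n × ℝ →L[ℝ] ℝ) => gdot x.1 x.2 := by
  unfold gdot; fun_prop

lemma measurable_gdot {α : Type*} [MeasurableSpace α] {L M : α → Space n × ℝ →L[ℝ] ℝ}
    (hL : Measurable L) (hM : Measurable M) : Measurable fun x => gdot (L x) (M x) :=
  continuous_gdot.measurable.comp (hL.prodMk hM)

/-! ### Integration by parts on z > ε -/

/-- The open upper half-space. -/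
def upper (n : ℕ) : Set (Space n × ℝ) := {p | 0 < p.2}

lemma isOpen_upper : IsOpen (upper n) := isOpen_lt continuous_const continuous_snd

/-- Lebesgue measure on the half-space `z > ε`. -/
noncomputable def hvol (n : ℕ) (ε : ℝ) : Measure (Space n × ℝ) :=
  (volume : Measure (Space n × ℝ)).restrict {p | ε < p.2}

lemma hvol_eq_prod (ε : ℝ) :
    hvol n ε = (volume : Measure (Space n)).prod (volume.restrict (Set.Ioi ε)) := by
  have : {p : Space n × ℝ | ε < p.2} = Set.univ ×ˢ Set.Ioi ε := by ext; simp
  rw [hvol, this, Measure.volume_eq_prod, ← Measure.prod_restrict, Measure.restrict_univ]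

instance (ε : ℝ) : SFinite (hvol n ε) := by unfold hvol; infer_instance

lemma measurableSet_gt (ε : ℝ) : MeasurableSet {p : Space n × ℝ | ε < p.2} :=
  measurableSet_lt measurable_const measurable_snd

lemma ae_hvol {ε : ℝ} : ∀ᵐ p ∂(hvol n ε), ε < p.2 :=
  ae_restrict_mem (measurableSet_gt ε)

lemma hvol_mono {ε δ : ℝ} (h : ε ≤ δ) : hvol n δ ≤ hvol n ε :=
  Measure.restrict_mono (fun _ hp => lt_of_le_of_lt h hp) le_rfl

lemma isCompact_slab (ε R : ℝ) : IsCompact {p : Space n × ℝ | ε ≤ p.2 ∧ rsq p ≤ R} := by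
  refine Metric.isCompact_of_isClosed_isBounded ?_ ?_
  · exact (isClosed_le continuous_const continuous_snd).inter
      (isClosed_le continuous_rsq continuous_const)
  · refine (Metric.isBounded_closedBall (x := (0 : Space n × ℝ)) (r := √R)).subset ?_
    rintro p ⟨-, hp⟩
    rw [mem_closedBall_zero_iff, Prod.norm_def]
    refine max_le ?_ ?_
    · exact Real.le_sqrt_of_sq_le ((norm_sq_le_rsq p).trans hp)
    · exact Real.abs_le_sqrt ((sq_le_rsq p).trans hp)

/-- A continuous function times a bounded function of bounded support is integrable away from
the boundary of the half-space. -/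
lemma integrable_mul_of_bounded {c φ : Space n × ℝ → ℝ} {ε R M : ℝ} (hε : 0 < ε)
    (hc : ContinuousOn c (upper n)) (hφ : AEStronglyMeasurable φ (hvol n ε))
    (hM : ∀ p : Space n × ℝ, ε < p.2 → |φ p| ≤ M)
    (hR : ∀ p : Space n × ℝ, ε < p.2 → R < rsq p → φ p = 0) :
    Integrable (fun p => c p * φ p) (hvol n ε) := by
  set K := {p : Space n × ℝ | ε ≤ p.2 ∧ rsq p ≤ R}
  have hK : IsCompact K := isCompact_slab ε R
  have hKU : K ⊆ upper n := fun p hp => lt_of_lt_of_le hε hp.1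
  obtain ⟨C, hC⟩ := hK.exists_bound_of_continuousOn (hc.mono hKU)
  have hsub : {p : Space n × ℝ | ε < p.2} ⊆ upper n := fun p hp => lt_trans hε hp
  have hmeas : AEStronglyMeasurable (fun p => c p * φ p) (hvol n ε) :=
    ((hc.mono hsub).aestronglyMeasurable (measurableSet_gt ε)).mul hφ
  have hKm : MeasurableSet K := hK.measurableSet
  have hfin : hvol n ε K < ∞ := (Measure.restrict_apply_le _ _).trans_lt hK.measure_lt_top
  have h1 : IntegrableOn (fun p => c p * φ p) K (hvol n ε) := by
    refine Measure.integrableOn_of_bounded (M := C * M) hfin.ne hmeas ?_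
    filter_upwards [ae_restrict_mem hKm, ae_restrict_of_ae ae_hvol] with p hp hp'
    rw [norm_mul]
    exact mul_le_mul (hC p hp) (hM p hp') (norm_nonneg _) ((norm_nonneg _).trans (hC p hp))
  rw [← integrableOn_univ]
  refine h1.of_ae_sdiff_eq_zero MeasurableSet.univ.nullMeasurableSet ?_
  filter_upwards [ae_hvol] with p hp hpK
  rw [hR p hp, mul_zero]
  by_contra! h
  exact hpK.2 ⟨hp.le, h⟩

lemma hasFDerivAt_slice_fst {f : Space n × ℝ → ℝ} {x : Space n} {z : ℝ}
    (hf : DifferentiableAt ℝ f (x, z)) :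
    HasFDerivAt (fun x => f (x, z)) ((fderiv ℝ f (x, z)).comp (ContinuousLinearMap.inl ℝ _ _)) x :=
  hf.hasFDerivAt.comp x (hasFDerivAt_prodMk_left x z)

lemma hasDerivAt_slice_snd {f : Space n × ℝ → ℝ} {x : Space n} {z : ℝ}
    (hf : DifferentiableAt ℝ f (x, z)) :
    HasDerivAt (fun z => f (x, z)) (fderiv ℝ f (x, z) (0, 1)) z := by
  have := (hf.hasFDerivAt.comp z (hasFDerivAt_prodMk_right x z)).hasDerivAt
  exact this.congr_deriv (by simp)

/-- Fubini over horizontal slices. Each slice is all of ℝⁿ, so there is no boundary term. -/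
lemma integral_fst_by_parts {f φ : Space n × ℝ → ℝ} {ε : ℝ} (hε : 0 < ε) (e : Space n)
    (hf : ∀ p ∈ upper n, DifferentiableAt ℝ f p) (hφ : ∀ p ∈ upper n, DifferentiableAt ℝ φ p)
    (h1 : Integrable (fun p => fderiv ℝ f p (e, 0) * φ p) (hvol n ε))
    (h2 : Integrable (fun p => f p * fderiv ℝ φ p (e, 0)) (hvol n ε))
    (h3 : Integrable (fun p => f p * φ p) (hvol n ε)) :
    ∫ p, f p * fderiv ℝ φ p (e, 0) ∂(hvol n ε) = -∫ p, fderiv ℝ f p (e, 0) * φ p ∂(hvol n ε) := by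
  rw [hvol_eq_prod] at *
  rw [integral_prod_symm _ h1, integral_prod_symm _ h2, ← integral_neg]
  refine integral_congr_ae ?_
  filter_upwards [h1.prod_left_ae, h2.prod_left_ae, h3.prod_left_ae,
    ae_restrict_mem measurableSet_Ioi] with z i1 i2 i3 hz
  have hz0 : 0 < z := hε.trans hz
  have ef : ∀ x, fderiv ℝ (fun x => f (x, z)) x e = fderiv ℝ f (x, z) (e, 0) := fun x => by
    rw [(hasFDerivAt_slice_fst (hf (x, z) hz0)).fderiv]; simp
  have eφ : ∀ x, fderiv ℝ (fun x => φ (x, z)) x e = fderiv ℝ φ (x, z) (e, 0) := fun x => by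
    rw [(hasFDerivAt_slice_fst (hφ (x, z) hz0)).fderiv]; simp
  have := integral_mul_fderiv_eq_neg_fderiv_mul_of_integrable (μ := (volume : Measure (Space n)))
    (f := fun x => f (x, z)) (g := fun x => φ (x, z)) (v := e)
    (by simpa only [ef] using i1) (by simpa only [eφ] using i2) i3
    (fun x _ => (hasFDerivAt_slice_fst (hf (x, z) hz0)).differentiableAt)
    (fun x _ => (hasFDerivAt_slice_fst (hφ (x, z) hz0)).differentiableAt)
  simpa only [ef, eφ] using this

/-- Fubini over vertical half-lines. The boundary term comes from z = ε, and the end at infinity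
contributes nothing because φ has bounded support. -/
lemma integral_snd_by_parts {f φ : Space n × ℝ → ℝ} {ε R : ℝ} (hε : 0 < ε)
    (hf : ∀ p ∈ upper n, DifferentiableAt ℝ f p) (hφ : ∀ p ∈ upper n, DifferentiableAt ℝ φ p)
    (hR : ∀ p ∈ upper n, R < rsq p → φ p = 0)
    (h1 : Integrable (fun p => fderiv ℝ f p (0, 1) * φ p) (hvol n ε))
    (h2 : Integrable (fun p => f p * fderiv ℝ φ p (0, 1)) (hvol n ε)) :
    ∫ p, f p * fderiv ℝ φ p (0, 1) ∂(hvol n ε) =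
      -(∫ x, f (x, ε) * φ (x, ε)) - ∫ p, fderiv ℝ f p (0, 1) * φ p ∂(hvol n ε) := by
  rw [hvol_eq_prod] at *
  have key : ∀ᵐ x : Space n, ∫ z in Set.Ioi ε, f (x, z) * fderiv ℝ φ (x, z) (0, 1) =
      -(f (x, ε) * φ (x, ε)) - ∫ z in Set.Ioi ε, fderiv ℝ f (x, z) (0, 1) * φ (x, z) := by
    filter_upwards [h1.prod_right_ae, h2.prod_right_ae] with x i1 i2
    have hd : ∀ z, 0 < z → HasDerivAt (fun z => f (x, z)) (fderiv ℝ f (x, z) (0, 1)) z :=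
      fun z hz => hasDerivAt_slice_snd (hf (x, z) hz)
    have hd' : ∀ z, 0 < z → HasDerivAt (fun z => φ (x, z)) (fderiv ℝ φ (x, z) (0, 1)) z :=
      fun z hz => hasDerivAt_slice_snd (hφ (x, z) hz)
    have := integral_Ioi_mul_deriv_eq_deriv_mul (a := ε) (u := fun z => f (x, z))
      (v := fun z => φ (x, z)) (a' := f (x, ε) * φ (x, ε)) (b' := 0)
      (fun z hz => hd z (hε.trans hz)) (fun z hz => hd' z (hε.trans hz)) i2 i1
      (((hd ε hε).continuousAt.mul (hd' ε hε).continuousAt).tendsto.mono_left nhdsWithin_le_nhds)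
      (by
        refine tendsto_const_nhds.congr' ?_
        -- The support condition concerns the squared norm; z > 1 and z > R together give z² > R.
        filter_upwards [eventually_gt_atTop (max 1 R)] with z hz
        have hz1 : 1 < z := lt_of_le_of_lt (le_max_left _ _) hz
        have hzR : R < z := lt_of_le_of_lt (le_max_right _ _) hz
        have := sq_le_rsq (x, z)
        simp only [Pi.mul_apply]
        rw [hR (x, z) (by simp [upper]; linarith) (by simp only at this; nlinarith), mul_zero])
    rw [this]; ring
  have i2 := h2.integral_prod_left
  have i1 := h1.integral_prod_left
  rw [integral_prod _ h1, integral_prod _ h2, integral_congr_ae key, integral_sub _ i1,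
    integral_neg]
  have : Integrable fun x => -(f (x, ε) * φ (x, ε)) := by
    refine (i2.add i1).congr ?_
    filter_upwards [key] with x hx
    simp only [Pi.add_apply]
    rw [hx]; ring
  exact this

/-- Functions on the half-space, of bounded support, that may be used to test the equation on
`z > ε`. -/
structure IsTest (ε : ℝ) (φ : Space n × ℝ → ℝ) : Prop where
  diff : ∀ p ∈ upper n, DifferentiableAt ℝ φ p
  supp : ∃ R : ℝ, ∀ p ∈ upper n, R < rsq p → φ p = 0
  bound : ∃ M : ℝ, ∀ p : Space n × ℝ, ε ≤ p.2 → |φ p| ≤ M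
  bound_fderiv : ∃ M : ℝ, ∀ p : Space n × ℝ, ε ≤ p.2 → ‖fderiv ℝ φ p‖ ≤ M

lemma fderiv_eq_zero_of_supp {φ : Space n × ℝ → ℝ} {R : ℝ}
    (hR : ∀ p ∈ upper n, R < rsq p → φ p = 0) :
    ∀ p ∈ upper n, R < rsq p → fderiv ℝ φ p = 0 := by
  intro p hp hpR
  have : φ =ᶠ[𝓝 p] fun _ => 0 := by
    filter_upwards [isOpen_upper.mem_nhds hp,
      (isOpen_lt continuous_const continuous_rsq).mem_nhds hpR] with p' h1 h2
    exact hR p' h1 h2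
  rw [this.fderiv_eq]
  simp

namespace IsTest

variable {ε : ℝ} {φ : Space n × ℝ → ℝ}

lemma aestronglyMeasurable (h : IsTest ε φ) (hε : 0 < ε) :
    AEStronglyMeasurable φ (hvol n ε) :=
  ContinuousOn.aestronglyMeasurable (s := {p : Space n × ℝ | ε < p.2})
    (fun p hp => (h.diff p (hε.trans hp)).continuousAt.continuousWithinAt) (measurableSet_gt ε)

lemma integrable_mul (h : IsTest ε φ) (hε : 0 < ε) {c : Space n × ℝ → ℝ}
    (hc : ContinuousOn c (upper n)) : Integrable (fun p => c p * φ p) (hvol n ε) := by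
  obtain ⟨R, hR⟩ := h.supp
  obtain ⟨M, hM⟩ := h.bound
  exact integrable_mul_of_bounded hε hc (h.aestronglyMeasurable hε) (fun p hp => hM p hp.le)
    (fun p hp => hR p (hε.trans hp))

lemma integrable_mul_fderiv (h : IsTest ε φ) (hε : 0 < ε) {c : Space n × ℝ → ℝ}
    (hc : ContinuousOn c (upper n)) (e : Space n × ℝ) :
    Integrable (fun p => c p * fderiv ℝ φ p e) (hvol n ε) := by
  obtain ⟨R, hR⟩ := h.supp
  obtain ⟨M, hM⟩ := h.bound_fderiv
  refine integrable_mul_of_bounded (R := R) (M := M * ‖e‖) hε hc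
    (measurable_fderiv_apply_const ℝ φ e).aestronglyMeasurable ?_ ?_
  · exact fun p hp => (fderiv ℝ φ p).le_of_opNorm_le (hM p hp.le) e
  · intro p hp hpR
    rw [fderiv_eq_zero_of_supp hR p (hε.trans hp) hpR]; simp

end IsTest

lemma differentiableAt_rsq_rpow (t : ℝ) {p : Space n × ℝ} (hp : p ∈ upper n) :
    HasFDerivAt (fun p => rsq p ^ t) ((2 * t * rsq p ^ (t - 1)) • rdot p) p := by
  refine ((hasFDerivAt_rsq p).rpow_const (p := t) (Or.inl (rsq_pos hp).ne')).congr_fderiv ?_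
  rw [smul_smul]; congr 1; ring

lemma continuousOn_rsq_rpow (t : ℝ) (y : Space n) :
    ContinuousOn (fun p => rsq (shift y p) ^ t) (upper n) := by
  refine ContinuousOn.rpow_const ?_ fun p hp =>
    Or.inl (rsq_pos (by simpa [upper] using hp)).ne'
  exact (continuous_rsq.comp
    (continuous_shift.comp (continuous_const.prodMk continuous_id))).continuousOn

/-! ### The weak equation for the kernel and for the extension -/

/-- The horizontal components of the field `z^{1-s} ∇P`. -/
noncomputable def fieldX (s : ℝ) (y : Space n) (i : Fin n) (p : Space n × ℝ) : ℝ :=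
  -((n : ℝ) + s) * p.2 * (p.1 i - y i) * rsq (shift y p) ^ (-((n : ℝ) + s) / 2 - 1)

/-- The vertical component of the field `z^{1-s} ∇P`. -/
noncomputable def fieldZ (s : ℝ) (y : Space n) (p : Space n × ℝ) : ℝ :=
  s * rsq (shift y p) ^ (-((n : ℝ) + s) / 2) -
    ((n : ℝ) + s) * p.2 ^ 2 * rsq (shift y p) ^ (-((n : ℝ) + s) / 2 - 1)

/-- The weight z^(1-s) absorbs the fractional powers of z: what remains is polynomial in z times
powers of |X|², so the field can be differentiated without singular terms. -/
lemma weight_mul_pkerD_single (y : Space n) (i : Fin n) {p : Space n × ℝ} (hp : p ∈ upper n) :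
    p.2 ^ (1 - s) * pkerD s (shift y p) (EuclideanSpace.single i 1, 0) = fieldX s y i p := by
  have h : p.2 ^ (1 - s) * p.2 ^ s = p.2 := by
    rw [← Real.rpow_add hp]; simp
  simp only [pkerD, sub_apply, smul_apply, rdot_apply, fieldX, smul_eq_mul,
    ContinuousLinearMap.coe_snd', EuclideanSpace.inner_single_right, shift_fst, shift_snd]
  simp only [mul_zero, zero_sub, add_zero, one_mul, PiLp.sub_apply, conj_trivial]
  linear_combination (-((n : ℝ) + s) * rsq (shift y p) ^ (-((n : ℝ) + s) / 2 - 1) *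
    (p.1 i - y i)) * h

lemma weight_mul_pkerD_vert (y : Space n) {p : Space n × ℝ} (hp : p ∈ upper n) :
    p.2 ^ (1 - s) * pkerD s (shift y p) (0, 1) = fieldZ s y p := by
  have h : p.2 ^ (1 - s) * p.2 ^ s = p.2 := by
    rw [← Real.rpow_add hp]; simp
  have h' : p.2 ^ (1 - s) * p.2 ^ (s - 1) = 1 := by
    rw [← Real.rpow_add hp]; simp
  simp only [pkerD, sub_apply, smul_apply, rdot_apply, fieldZ, smul_eq_mul, rker,
    ContinuousLinearMap.coe_snd', shift_fst, shift_snd]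
  simp only [inner_zero_right, zero_add, mul_one]
  linear_combination (-((n : ℝ) + s) * rsq (shift y p) ^ (-((n : ℝ) + s) / 2 - 1) * p.2) * h +
    s * rsq (shift y p) ^ (-((n : ℝ) + s) / 2) * h'

lemma weight_mul_gdot_pkerD (y : Space n) {p : Space n × ℝ} (hp : p ∈ upper n)
    (L : Space n × ℝ →L[ℝ] ℝ) :
    p.2 ^ (1 - s) * gdot (pkerD s (shift y p)) L =
      ∑ i, fieldX s y i p * L (EuclideanSpace.single i 1, 0) + fieldZ s y p * L (0, 1) := by
  rw [gdot, mul_add, Finset.mul_sum, ← mul_assoc, weight_mul_pkerD_vert y hp]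
  congr 1
  refine Finset.sum_congr rfl fun i _ => ?_
  rw [← mul_assoc, weight_mul_pkerD_single y i hp]

lemma hasFDerivAt_shift_rpow (t : ℝ) (y : Space n) {p : Space n × ℝ} (hp : p ∈ upper n) :
    HasFDerivAt (fun p => rsq (shift y p) ^ t)
      ((2 * t * rsq (shift y p) ^ (t - 1)) • rdot (shift y p)) p := by
  have := (differentiableAt_rsq_rpow t (p := shift y p) (by simpa [upper] using hp)).comp p
    (hasFDerivAt_shift y p)
  exact this.congr_fderiv (by simp)

lemma hasFDerivAt_fieldX (y : Space n) (i : Fin n) {p : Space n × ℝ} (hp : p ∈ upper n) :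
    ∃ D : Space n × ℝ →L[ℝ] ℝ, HasFDerivAt (fieldX s y i) D p ∧
      D (EuclideanSpace.single i 1, 0) = -((n : ℝ) + s) * p.2 *
        (rsq (shift y p) ^ (-((n : ℝ) + s) / 2 - 1) - ((n : ℝ) + s + 2) *
          rsq (shift y p) ^ (-((n : ℝ) + s) / 2 - 2) * (p.1 i - y i) ^ 2) := by
  have h1 : HasFDerivAt (fun p : Space n × ℝ => p.1 i - y i)
      ((EuclideanSpace.proj (𝕜 := ℝ) i).comp (ContinuousLinearMap.fst ℝ _ _)) p :=
    (((EuclideanSpace.proj (𝕜 := ℝ) i).comp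
      (ContinuousLinearMap.fst ℝ (Space n) ℝ)).hasFDerivAt).sub_const _
  have h2 : HasFDerivAt (fun p : Space n × ℝ => -((n : ℝ) + s) * p.2) _ p :=
    (hasFDerivAt_snd (𝕜 := ℝ) (p := p)).const_mul _
  refine ⟨_, (h2.mul h1).mul (hasFDerivAt_shift_rpow (-((n : ℝ) + s) / 2 - 1) y hp), ?_⟩
  simp [rdot_apply, EuclideanSpace.inner_single_right]
  rw [show -s + -(n : ℝ) = -((n : ℝ) + s) by ring,
    show -((n : ℝ) + s) / 2 - 1 - 1 = -((n : ℝ) + s) / 2 - 2 by ring]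
  ring

lemma hasFDerivAt_fieldZ (y : Space n) {p : Space n × ℝ} (hp : p ∈ upper n) :
    ∃ D : Space n × ℝ →L[ℝ] ℝ, HasFDerivAt (fieldZ s y) D p ∧
      D (0, 1) = -((n : ℝ) + s) * p.2 *
        ((s + 2) * rsq (shift y p) ^ (-((n : ℝ) + s) / 2 - 1) - ((n : ℝ) + s + 2) *
          rsq (shift y p) ^ (-((n : ℝ) + s) / 2 - 2) * p.2 ^ 2) := by
  have h2 : HasFDerivAt (fun p : Space n × ℝ => ((n : ℝ) + s) * p.2 ^ 2) _ p :=
    ((hasFDerivAt_snd (𝕜 := ℝ) (p := p)).pow 2).const_mul _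
  refine ⟨_, ((hasFDerivAt_shift_rpow (-((n : ℝ) + s) / 2) y hp).const_mul s).sub
    (h2.mul (hasFDerivAt_shift_rpow (-((n : ℝ) + s) / 2 - 1) y hp)), ?_⟩
  simp [rdot_apply]
  rw [show -s + -(n : ℝ) = -((n : ℝ) + s) by ring,
    show -((n : ℝ) + s) / 2 - 1 - 1 = -((n : ℝ) + s) / 2 - 2 by ring]
  ring

/-- With q = |X|² and a = -(n+s)/2, the divergence is -(n+s) z times (n + s + 2)(q^(a-1) - q^(a-2)
q): the horizontal derivatives supply n of the factor, the vertical one supplies s + 2. -/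
lemma fderiv_field_sum_eq_zero (y : Space n) {p : Space n × ℝ} (hp : p ∈ upper n) :
    ∑ i, fderiv ℝ (fieldX s y i) p (EuclideanSpace.single i 1, 0) +
      fderiv ℝ (fieldZ s y) p (0, 1) = 0 := by
  have hX : ∀ i, fderiv ℝ (fieldX s y i) p (EuclideanSpace.single i 1, 0) =
      -((n : ℝ) + s) * p.2 *
        (rsq (shift y p) ^ (-((n : ℝ) + s) / 2 - 1) - ((n : ℝ) + s + 2) *
          rsq (shift y p) ^ (-((n : ℝ) + s) / 2 - 2) * (p.1 i - y i) ^ 2) := fun i => by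
    obtain ⟨D, hD, e⟩ := hasFDerivAt_fieldX (s := s) y i hp
    rw [hD.fderiv, e]
  obtain ⟨D, hD, e⟩ := hasFDerivAt_fieldZ (s := s) y hp
  rw [hD.fderiv, e]
  simp only [hX]
  rw [← Finset.mul_sum, Finset.sum_sub_distrib, ← Finset.mul_sum]
  simp only [Finset.sum_const, Finset.card_univ, Fintype.card_fin, nsmul_eq_mul]
  have hr : rsq (shift y p) = ∑ i, (p.1 i - y i) ^ 2 + p.2 ^ 2 := by
    rw [rsq, EuclideanSpace.norm_sq_eq]; simp
  have hpos : 0 < rsq (shift y p) := rsq_pos (by simpa [upper] using hp)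
  have h1 : rsq (shift y p) ^ (-((n : ℝ) + s) / 2 - 1) =
      rsq (shift y p) ^ (-((n : ℝ) + s) / 2 - 2) * (∑ i, (p.1 i - y i) ^ 2 + p.2 ^ 2) := by
    rw [← hr, ← Real.rpow_add_one hpos.ne']; congr 1; ring
  rw [h1]
  ring

lemma continuousOn_fieldX (y : Space n) (i : Fin n) : ContinuousOn (fieldX s y i) (upper n) :=
  fun p hp => by
    obtain ⟨D, hD, -⟩ := hasFDerivAt_fieldX (s := s) y i hp
    exact hD.continuousAt.continuousWithinAt

lemma continuousOn_fieldZ (y : Space n) : ContinuousOn (fieldZ s y) (upper n) :=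
  fun p hp => by
    obtain ⟨D, hD, -⟩ := hasFDerivAt_fieldZ (s := s) y hp
    exact hD.continuousAt.continuousWithinAt

lemma continuousOn_fderiv_fieldX (y : Space n) (i : Fin n) :
    ContinuousOn (fun p => fderiv ℝ (fieldX s y i) p (EuclideanSpace.single i 1, 0)) (upper n) := by
  have : ContinuousOn (fun p : Space n × ℝ => -((n : ℝ) + s) * p.2 *
        (rsq (shift y p) ^ (-((n : ℝ) + s) / 2 - 1) - ((n : ℝ) + s + 2) *
          rsq (shift y p) ^ (-((n : ℝ) + s) / 2 - 2) * (p.1 i - y i) ^ 2)) (upper n) := by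
    have h1 := continuousOn_rsq_rpow (-((n : ℝ) + s) / 2 - 1) y
    have h2 := continuousOn_rsq_rpow (-((n : ℝ) + s) / 2 - 2) y
    have h3 : ContinuousOn (fun p : Space n × ℝ => (p.1 i - y i) ^ 2) (upper n) := by fun_prop
    have h4 : ContinuousOn (fun p : Space n × ℝ => -((n : ℝ) + s) * p.2) (upper n) := by fun_prop
    exact h4.mul (h1.sub ((continuousOn_const.mul h2).mul h3))
  refine this.congr fun p hp => ?_
  obtain ⟨D, hD, e⟩ := hasFDerivAt_fieldX (s := s) y i hp
  simp only [hD.fderiv, e]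

lemma continuousOn_fderiv_fieldZ (y : Space n) :
    ContinuousOn (fun p => fderiv ℝ (fieldZ s y) p (0, 1)) (upper n) := by
  -- The divergence identity expresses the vertical derivative through the horizontal ones, which
  -- are already known to be continuous.
  refine ContinuousOn.congr (f := fun p =>
    -∑ i, fderiv ℝ (fieldX s y i) p (EuclideanSpace.single i 1, 0)) ?_ ?_
  · exact (continuousOn_finsetSum _ fun i _ => continuousOn_fderiv_fieldX y i).neg
  · intro p hp
    have := fderiv_field_sum_eq_zero (s := s) y hp
    simp only
    linarith

/-- The Poisson kernel solves `div (z^{1-s} ∇P) = 0` weakly on `z > ε`. -/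
lemma integral_gdot_pkerD {φ : Space n × ℝ → ℝ} {ε : ℝ} (hε : 0 < ε) (hφ : IsTest ε φ)
    (y : Space n) :
    ∫ p, p.2 ^ (1 - s) * gdot (pkerD s (shift y p)) (fderiv ℝ φ p) ∂(hvol n ε) =
      -∫ x, fieldZ s y (x, ε) * φ (x, ε) := by
  obtain ⟨R, hR⟩ := hφ.supp
  have dX : ∀ i, ∀ p ∈ upper n, DifferentiableAt ℝ (fieldX s y i) p := fun i p hp => by
    obtain ⟨D, hD, -⟩ := hasFDerivAt_fieldX (s := s) y i hp
    exact hD.differentiableAt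
  have dZ : ∀ p ∈ upper n, DifferentiableAt ℝ (fieldZ s y) p := fun p hp => by
    obtain ⟨D, hD, -⟩ := hasFDerivAt_fieldZ (s := s) y hp
    exact hD.differentiableAt
  have iX := fun i => hφ.integrable_mul_fderiv hε (continuousOn_fieldX (s := s) y i)
    (EuclideanSpace.single i 1, 0)
  have iZ := hφ.integrable_mul_fderiv hε (continuousOn_fieldZ (s := s) y) (0, 1)
  have jX := fun i => hφ.integrable_mul hε (continuousOn_fderiv_fieldX (s := s) y i)
  have jZ := hφ.integrable_mul hε (continuousOn_fderiv_fieldZ (s := s) y)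
  have e1 : ∫ p, p.2 ^ (1 - s) * gdot (pkerD s (shift y p)) (fderiv ℝ φ p) ∂(hvol n ε) =
      ∫ p, (∑ i, fieldX s y i p * fderiv ℝ φ p (EuclideanSpace.single i 1, 0) +
        fieldZ s y p * fderiv ℝ φ p (0, 1)) ∂(hvol n ε) := by
    refine integral_congr_ae ?_
    filter_upwards [ae_hvol] with p hp
    exact weight_mul_gdot_pkerD y (hε.trans hp) _
  rw [e1, integral_add (integrable_finsetSum _ fun i _ => iX i) iZ,
    integral_finsetSum _ fun i _ => iX i,
    integral_snd_by_parts hε dZ hφ.diff hR jZ iZ]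
  simp_rw [fun i => integral_fst_by_parts hε (EuclideanSpace.single i 1) (dX i) hφ.diff (jX i)
    (iX i) (hφ.integrable_mul hε (continuousOn_fieldX (s := s) y i))]
  rw [Finset.sum_neg_distrib, ← integral_finsetSum _ fun i _ => jX i]
  -- The bulk terms cancel because the field is divergence free; only the integral over z = ε
  -- survives.
  have e2 : ∫ p, fderiv ℝ (fieldZ s y) p (0, 1) * φ p ∂(hvol n ε) =
      -∫ p, ∑ i, fderiv ℝ (fieldX s y i) p (EuclideanSpace.single i 1, 0) * φ p ∂(hvol n ε) := by
    rw [← integral_neg]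
    refine integral_congr_ae ?_
    filter_upwards [ae_hvol] with p hp
    rw [← Finset.sum_mul]
    have := fderiv_field_sum_eq_zero (s := s) y (hε.trans hp)
    linear_combination φ p * this
  rw [e2]
  ring

/-- `gdot` as a continuous linear form in its first argument. -/
noncomputable def gdotL (M : Space n × ℝ →L[ℝ] ℝ) : (Space n × ℝ →L[ℝ] ℝ) →L[ℝ] ℝ :=
  LinearMap.mkContinuous
    { toFun := fun L => gdot L M
      map_add' := fun L L' => gdot_add_left L L' M
      map_smul' := fun c L => gdot_smul_left c L M } ((n + 1) * ‖M‖) fun L => by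
    have := abs_gdot_le L M
    simp only [LinearMap.coe_mk, AddHom.coe_mk, Real.norm_eq_abs]
    linarith

lemma gdotL_apply (L M : Space n × ℝ →L[ℝ] ℝ) : gdotL M L = gdot L M := rfl

/-- Tonelli's theorem in the form needed for the Fubini exchanges below: each section is dominated
by a multiple G x of a kernel whose mass c x is known. -/
lemma integrable_of_kernel_bound {X Y : Type*} [MeasurableSpace X] [MeasurableSpace Y]
    {μ : Measure X} {ν : Measure Y} [SFinite μ] [SFinite ν] {F : X × Y → ℝ} {G c : X → ℝ}
    {k : X → Y → ℝ} (hF : AEStronglyMeasurable F (μ.prod ν))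
    (hk : ∀ᵐ x ∂μ, Integrable (k x) ν ∧ ∫ y, k x y ∂ν = c x)
    (hb : ∀ᵐ x ∂μ, ∀ y, |F (x, y)| ≤ G x * k x y)
    (hGc : Integrable (fun x => G x * c x) μ) : Integrable F (μ.prod ν) := by
  rw [integrable_prod_iff hF]
  have h1 : ∀ᵐ x ∂μ, Integrable (fun y => F (x, y)) ν := by
    filter_upwards [hk, hb, hF.prodMk_left] with x hx hbx hm
    exact (hx.1.const_mul (G x)).mono' hm (ae_of_all _ hbx)
  refine ⟨h1, hGc.mono' hF.norm.integral_prod_right' ?_⟩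
  filter_upwards [hk, hb, h1] with x hx hbx hi
  rw [Real.norm_of_nonneg (integral_nonneg fun _ => norm_nonneg _), ← hx.2, ← integral_const_mul]
  exact integral_mono hi.norm (hx.1.const_mul _) hbx

lemma weight_cancel {z : ℝ} (hz : 0 < z) : z ^ (1 - s) * z ^ (s - 1) = 1 := by
  rw [← Real.rpow_add hz]; simp

lemma extD_apply (hs : 0 < s) {g : Space n → ℝ} (hg : AEStronglyMeasurable g) {M : ℝ}
    (hb : ∀ x, |g x| ≤ M) {p : Space n × ℝ} (hp : 0 < p.2) (h : Space n × ℝ) :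
    extD s g p h = ∫ y, g y * pkerD s (shift y p) h := by
  rw [extD, ContinuousLinearMap.integral_apply (integrable_smul_pkerD_shift hs hg hb hp)]
  rfl

lemma gdot_extD (hs : 0 < s) {g : Space n → ℝ} (hg : AEStronglyMeasurable g) {M : ℝ}
    (hb : ∀ x, |g x| ≤ M) {p : Space n × ℝ} (hp : 0 < p.2) (L : Space n × ℝ →L[ℝ] ℝ) :
    gdot (extD s g p) L = ∫ y, g y * gdot (pkerD s (shift y p)) L := by
  have := (gdotL L).integral_comp_comm (integrable_smul_pkerD_shift hs hg hb hp)
  simp only [gdotL_apply, gdot_smul_left] at this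
  exact this.symm

/-- The weighted vertical derivative of the extension. -/
noncomputable def flux (s : ℝ) (g : Space n → ℝ) (ε : ℝ) (x : Space n) : ℝ :=
  ε ^ (1 - s) * extD s g (x, ε) (0, 1)

lemma flux_eq (hs : 0 < s) {g : Space n → ℝ} (hg : AEStronglyMeasurable g) {M : ℝ}
    (hb : ∀ x, |g x| ≤ M) {ε : ℝ} (hε : 0 < ε) (x : Space n) :
    flux s g ε x = ∫ y, g y * fieldZ s y (x, ε) := by
  rw [flux, extD_apply hs hg hb (p := (x, ε)) hε, ← integral_const_mul]
  congr 1
  ext y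
  rw [← weight_mul_pkerD_vert y (p := (x, ε)) hε]
  ring

lemma abs_fieldZ_le (hs : 0 < s) (y : Space n) {p : Space n × ℝ} (hp : 0 < p.2) :
    |fieldZ s y p| ≤ (s + 2 * (n + s)) * rker s (shift y p) := by
  rw [← weight_mul_pkerD_vert y hp, abs_mul, abs_of_pos (Real.rpow_pos_of_pos hp _)]
  have h1 := (pkerD s (shift y p)).le_of_opNorm_le (norm_pkerD_le hs (p := shift y p) hp) (0, 1)
  have h2 : ‖((0, 1) : Space n × ℝ)‖ = 1 := by simp [Prod.norm_def]
  rw [h2, mul_one, Real.norm_eq_abs] at h1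
  rw [shift_snd] at h1
  refine (mul_le_mul_of_nonneg_left h1 (by positivity)).trans (le_of_eq ?_)
  linear_combination (s + 2 * ((n : ℝ) + s)) * rker s (shift y p) * weight_cancel (s := s) hp

lemma measurable_fieldZ (p : Space n × ℝ) : Measurable fun y => fieldZ s y p := by
  have h := continuous_rsq.measurable.comp (measurable_shift p)
  exact (measurable_const.mul (h.pow_const _)).sub (measurable_const.mul (h.pow_const _))

lemma integrable_fieldZ (hs : 0 < s) {p : Space n × ℝ} (hp : 0 < p.2) :
    Integrable fun y => fieldZ s y p :=
  ((integrable_rker_shift hs hp).const_mul _).mono' (measurable_fieldZ p).aestronglyMeasurable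
    (ae_of_all _ fun y => abs_fieldZ_le hs y hp)

lemma measurable_pkerD_shift_uncurry :
    Measurable fun w : (Space n × ℝ) × Space n => pkerD s (shift w.2 w.1) :=
  measurable_pkerD.comp (continuous_shift.comp continuous_swap).measurable

/-- The Poisson extension solves `div (z^{1-s} ∇u) = 0` weakly on `z > ε`. -/
lemma integral_gdot_extD (hs : 0 < s) {g : Space n → ℝ} (hg : AEStronglyMeasurable g) {M : ℝ}
    (hb : ∀ x, |g x| ≤ M) {φ : Space n × ℝ → ℝ} {ε : ℝ} (hε : 0 < ε) (hφ : IsTest ε φ) :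
    ∫ p, p.2 ^ (1 - s) * gdot (extD s g p) (fderiv ℝ φ p) ∂(hvol n ε) =
      -∫ x, flux s g ε x * φ (x, ε) := by
  have hM : 0 ≤ M := (abs_nonneg _).trans (hb 0)
  obtain ⟨R, hR⟩ := hφ.supp
  obtain ⟨M₁, hM₁⟩ := hφ.bound_fderiv
  obtain ⟨M₀, hM₀⟩ := hφ.bound
  set C : ℝ := (n + 1) * (s + 2 * (n + s)) * M with hC
  have hCs : 0 ≤ s + 2 * ((n : ℝ) + s) := by positivity
  -- Absolute integrability in (p, y). The weight cancels z^(s-1) in the kernel bound, and ∇φ is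
  -- bounded with bounded support.
  have i1 : Integrable (fun w : (Space n × ℝ) × Space n =>
      w.1.2 ^ (1 - s) * (g w.2 * gdot (pkerD s (shift w.2 w.1)) (fderiv ℝ φ w.1)))
      ((hvol n ε).prod volume) := by
    refine integrable_of_kernel_bound (G := fun p => C * ‖fderiv ℝ φ p‖)
      (k := fun p y => rker s (shift y p)) (c := fun p => p.2 ^ (-s) * kappa n s) ?_ ?_ ?_ ?_
    · refine AEStronglyMeasurable.mul ?_ (AEStronglyMeasurable.mul ?_ ?_)
      · exact ((measurable_snd.comp measurable_fst).pow_const _).aestronglyMeasurable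
      · exact hg.comp_snd
      · exact (measurable_gdot measurable_pkerD_shift_uncurry
          ((measurable_fderiv ℝ φ).comp measurable_fst)).aestronglyMeasurable
    · filter_upwards [ae_hvol] with p hp
      exact ⟨integrable_rker_shift hs (hε.trans hp), integral_rker_shift (hε.trans hp)⟩
    · filter_upwards [ae_hvol] with p hp y
      have hp0 : 0 < p.2 := hε.trans hp
      rw [abs_mul, abs_mul, abs_of_pos (Real.rpow_pos_of_pos hp0 _)]
      have h1 := abs_gdot_le (pkerD s (shift y p)) (fderiv ℝ φ p)
      have h2 := norm_pkerD_le hs (p := shift y p) hp0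
      calc p.2 ^ (1 - s) * (|g y| * |gdot (pkerD s (shift y p)) (fderiv ℝ φ p)|)
          ≤ p.2 ^ (1 - s) * (M * ((n + 1) * ((s + 2 * (n + s)) *
            (p.2 ^ (s - 1) * rker s (shift y p)) * ‖fderiv ℝ φ p‖))) := by
            have h3 : ((n : ℝ) + 1) * (‖pkerD s (shift y p)‖ * ‖fderiv ℝ φ p‖) ≤
              (n + 1) * ((s + 2 * (n + s)) *
                (p.2 ^ (s - 1) * rker s (shift y p)) * ‖fderiv ℝ φ p‖) := by gcongr; exact h2
            exact mul_le_mul_of_nonneg_left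
              (mul_le_mul (hb y) (h1.trans h3) (abs_nonneg _) hM) (by positivity)
        _ = _ := by
            rw [hC]
            linear_combination (M * (n + 1) * (s + 2 * (n + s)) * rker s (shift y p) *
              ‖fderiv ℝ φ p‖) * weight_cancel (s := s) hp0
    · have := integrable_mul_of_bounded (c := fun p : Space n × ℝ => C * kappa n s * p.2 ^ (-s))
        (φ := fun p => ‖fderiv ℝ φ p‖) (R := R) (M := M₁) hε ?_ ?_ ?_ ?_
      · refine this.congr (ae_of_all _ fun p => ?_)
        ring
      · exact continuousOn_const.mul
          (continuousOn_snd.rpow_const fun p hp => Or.inl (ne_of_gt hp))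
      · exact (measurable_fderiv ℝ φ).norm.aestronglyMeasurable
      · intro p hp
        rw [abs_norm]
        exact hM₁ p hp.le
      · intro p hp hpR
        rw [fderiv_eq_zero_of_supp hR p (hε.trans hp) hpR, norm_zero]
  have cφ : Continuous fun x : Space n => φ (x, ε) := continuous_iff_continuousAt.2 fun x =>
    (hasFDerivAt_slice_fst (hφ.diff (x, ε) hε)).continuousAt
  have φs : ∀ x : Space n, x ∉ closedBall (0 : Space n) √R → φ (x, ε) = 0 := by
    intro x hx
    refine hR (x, ε) hε (lt_of_lt_of_le ?_ (norm_sq_le_rsq _))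
    rw [mem_closedBall_zero_iff, not_le] at hx
    exact (Real.sqrt_lt' (lt_of_le_of_lt (Real.sqrt_nonneg _) hx)).1 hx
  have iφ : Integrable fun x : Space n => |φ (x, ε)| :=
    (cφ.integrable_of_hasCompactSupport
      (HasCompactSupport.intro (isCompact_closedBall _ _) φs)).abs
  have i2 : Integrable (fun w : Space n × Space n =>
      g w.2 * fieldZ s w.2 (w.1, ε) * φ (w.1, ε)) (volume.prod volume) := by
    refine integrable_of_kernel_bound (G := fun x => M * (s + 2 * (n + s)) * |φ (x, ε)|)
      (k := fun x y => rker s (shift y (x, ε))) (c := fun p => ε ^ (-s) * kappa n s) ?_ ?_ ?_ ?_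
    · refine AEStronglyMeasurable.mul (AEStronglyMeasurable.mul hg.comp_snd ?_) ?_
      · have : Measurable fun w : Space n × Space n => rsq (shift w.2 (w.1, ε)) :=
          (continuous_rsq.comp (continuous_shift.comp (continuous_snd.prodMk
            (continuous_fst.prodMk continuous_const)))).measurable
        have h : Measurable fun w : Space n × Space n => fieldZ s w.2 (w.1, ε) := by
          simp only [fieldZ]
          exact Measurable.sub (measurable_const.mul (this.pow_const _))
            (Measurable.mul measurable_const (this.pow_const _))
        exact h.aestronglyMeasurable
      · exact (cφ.comp continuous_fst).aestronglyMeasurable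
    · exact ae_of_all _ fun x =>
        ⟨integrable_rker_shift hs (p := (x, ε)) hε, integral_rker_shift (p := (x, ε)) hε⟩
    · refine ae_of_all _ fun (x : Space n) (y : Space n) => ?_
      rw [abs_mul, abs_mul]
      calc _ ≤ M * ((s + 2 * (n + s)) * rker s (shift y (x, ε))) * |φ (x, ε)| := by
            gcongr
            · exact hb y
            · exact abs_fieldZ_le hs y (p := (x, ε)) hε
        _ = _ := by ring
    · exact (iφ.const_mul _).mul_const _
  calc _ = ∫ p : Space n × ℝ, (∫ y : Space n, p.2 ^ (1 - s) *
        (g y * gdot (pkerD s (shift y p)) (fderiv ℝ φ p))) ∂(hvol n ε) := by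
        refine integral_congr_ae ?_
        filter_upwards [ae_hvol] with p hp
        rw [integral_const_mul, gdot_extD hs hg hb (hε.trans hp)]
    _ = ∫ y : Space n, ∫ p : Space n × ℝ, p.2 ^ (1 - s) * (g y * gdot (pkerD s (shift y p)) (fderiv ℝ φ p))
        ∂(hvol n ε) := integral_integral_swap i1
    _ = ∫ y, -∫ x, g y * fieldZ s y (x, ε) * φ (x, ε) := by
        congr 1
        ext y
        have := integral_gdot_pkerD (s := s) hε hφ y
        simp_rw [mul_assoc (g y), integral_const_mul, ← mul_neg, ← this, ← integral_const_mul]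
        congr 1
        ext p
        ring
    _ = -∫ x, ∫ y, g y * fieldZ s y (x, ε) * φ (x, ε) := by
        rw [integral_neg, integral_integral_swap (f := fun (y x : Space n) =>
          g y * fieldZ s y (x, ε) * φ (x, ε)) i2.swap]
    _ = _ := by
        congr 2
        ext x
        rw [integral_mul_const, flux_eq hs hg hb hε]

/-- The extension of the constant 1 is the constant κ, so its flux vanishes. -/
lemma integral_fieldZ (hs : 0 < s) {ε : ℝ} (hε : 0 < ε) (x : Space n) :
    ∫ y, fieldZ s y (x, ε) = 0 := by
  have h1 : ∀ x : Space n, |(fun _ : Space n => (1 : ℝ)) x| ≤ 1 := by simp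
  have hm : AEStronglyMeasurable (fun _ : Space n => (1 : ℝ)) := aestronglyMeasurable_const
  have e := flux_eq hs hm h1 hε x
  simp only [one_mul] at e
  rw [← e, flux]
  have hc : ext s (fun _ : Space n => (1 : ℝ)) =ᶠ[𝓝 (x, ε)] fun _ => kappa n s := by
    filter_upwards [isOpen_upper.mem_nhds (show (x, ε) ∈ upper n from hε)] with p hp
    simp only [ext, one_mul]
    exact integral_pker_shift hp
  have h0 : extD s (fun _ : Space n => (1 : ℝ)) (x, ε) = 0 := by
    rw [← (hasFDerivAt_ext hs hm h1 (p := (x, ε)) hε).fderiv, hc.fderiv_eq]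
    simp
  rw [h0]; simp

/-! ### The flux at the boundary and the fractional Laplacian -/

/-- The kernel of the interaction. -/
noncomputable def kern (s : ℝ) (x : Space n) : ℝ := 1 / ‖x‖ ^ ((n : ℝ) + s)

lemma kern_nonneg (x : Space n) : 0 ≤ kern s x := by unfold kern; positivity

lemma measurable_kern : Measurable (kern s : Space n → ℝ) :=
  measurable_const.div (measurable_norm.pow_const _)

lemma kern_neg (x : Space n) : kern s (-x) = kern s x := by simp [kern]

lemma kern_sub_comm (x y : Space n) : kern s (x - y) = kern s (y - x) := by
  rw [← kern_neg, neg_sub]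

lemma norm_rpow_neg (x : Space n) : (‖x‖ ^ 2) ^ (-((n : ℝ) + s) / 2) = kern s x := by
  rw [kern, ← Real.rpow_natCast, ← Real.rpow_mul (norm_nonneg x), one_div,
    ← Real.rpow_neg (norm_nonneg x)]
  congr 1
  push_cast
  ring

lemma rker_le_kern (hs : 0 < s) {x : Space n} (hx : x ≠ 0) (z : ℝ) :
    rker s (x, z) ≤ kern s x := by
  rw [← norm_rpow_neg, rker]
  refine Real.rpow_le_rpow_of_nonpos (by positivity) (norm_sq_le_rsq (x, z)) ?_
  have : (0 : ℝ) ≤ n := by positivity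
  linarith

/-- The kernel of the flux has mean zero, so g x may be subtracted. The difference compensates the
singularity on the diagonal and makes bounds uniform in ε possible. -/
lemma flux_eq_sub (hs : 0 < s) {g : Space n → ℝ} (hg : AEStronglyMeasurable g) {M : ℝ}
    (hb : ∀ x, |g x| ≤ M) {ε : ℝ} (hε : 0 < ε) (x : Space n) :
    flux s g ε x = ∫ y, (g y - g x) * fieldZ s y (x, ε) := by
  have hi := integrable_fieldZ (n := n) hs (p := (x, ε)) hε
  simp_rw [sub_mul]
  rw [integral_sub (hi.bdd_mul hg (ae_of_all _ hb)) (hi.const_mul _), integral_const_mul,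
    integral_fieldZ hs hε, flux_eq hs hg hb hε]
  simp

lemma abs_sub_mul_fieldZ_le (hs : 0 < s) (g : Space n → ℝ) {ε : ℝ} (hε : 0 < ε) (x y : Space n) :
    |(g y - g x) * fieldZ s y (x, ε)| ≤
      (s + 2 * (n + s)) * (|g x - g y| * kern s (x - y)) := by
  rcases eq_or_ne x y with rfl | hxy
  · simp
  rw [abs_mul, abs_sub_comm]
  have h1 := abs_fieldZ_le hs y (p := (x, ε)) hε
  have h2 : rker s (shift y (x, ε)) ≤ kern s (x - y) := rker_le_kern hs (sub_ne_zero.2 hxy) ε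
  calc _ ≤ |g x - g y| * ((s + 2 * (n + s)) * kern s (x - y)) := by
        gcongr
        exact h1.trans (by gcongr)
    _ = _ := by ring

/-- The nonlocal variation of `g` at `x`. -/
noncomputable def nvar (s : ℝ) (g : Space n → ℝ) (x : Space n) : ℝ :=
  ∫ y, |g x - g y| * kern s (x - y)

/-- The fractional Laplacian of `g` at `x`, up to sign and normalisation. -/
noncomputable def nlap (s : ℝ) (g : Space n → ℝ) (x : Space n) : ℝ :=
  ∫ y, (g y - g x) * kern s (x - y)

/-- The bound does not depend on ε; it is the dominating function whenever a boundary integral is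
passed to the limit. -/
lemma abs_flux_le (hs : 0 < s) {g : Space n → ℝ} (hg : AEStronglyMeasurable g) {M : ℝ}
    (hb : ∀ x, |g x| ≤ M) {ε : ℝ} (hε : 0 < ε) {x : Space n}
    (hx : Integrable fun y => |g x - g y| * kern s (x - y)) :
    |flux s g ε x| ≤ (s + 2 * (n + s)) * nvar s g x := by
  rw [flux_eq_sub hs hg hb hε, nvar, ← integral_const_mul, ← Real.norm_eq_abs]
  exact norm_integral_le_of_norm_le (hx.const_mul _)
    (ae_of_all _ fun y => abs_sub_mul_fieldZ_le hs g hε x y)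

lemma tendsto_fieldZ {x y : Space n} (hxy : x ≠ y) :
    Tendsto (fun ε => fieldZ s y (x, ε)) (𝓝[>] 0) (𝓝 (s * kern s (x - y))) := by
  have hpos : 0 < rsq ((x - y, 0) : Space n × ℝ) := by
    have : 0 < ‖x - y‖ := norm_pos_iff.2 (sub_ne_zero.2 hxy)
    unfold rsq; simp only; positivity
  have h1 : ContinuousAt (fun ε : ℝ => rsq ((x - y, ε) : Space n × ℝ)) 0 :=
    (continuous_rsq.comp (continuous_const.prodMk continuous_id)).continuousAt
  have h2 : ContinuousAt (fun ε : ℝ => fieldZ s y (x, ε)) 0 := by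
    unfold fieldZ shift
    exact (continuousAt_const.mul (h1.rpow_const (Or.inl hpos.ne'))).sub
      ((continuousAt_const.mul (continuousAt_id.pow 2)).mul (h1.rpow_const (Or.inl hpos.ne')))
  have h3 := h2.tendsto.mono_left (nhdsWithin_le_nhds (s := Set.Ioi (0 : ℝ)))
  convert h3 using 2
  rw [← norm_rpow_neg]
  simp [fieldZ, shift, rsq]

/-- Dominated convergence: the kernel of the flux tends to s |x - y|^(-(n+s)) off the diagonal,
because its second term carries the factor ε². -/
lemma tendsto_flux (hs : 0 < s) {g : Space n → ℝ} (hg : AEStronglyMeasurable g) {M : ℝ}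
    (hb : ∀ x, |g x| ≤ M) {x : Space n}
    (hx : Integrable fun y => |g x - g y| * kern s (x - y)) :
    Tendsto (fun ε => flux s g ε x) (𝓝[>] 0) (𝓝 (s * nlap s g x)) := by
  have h : Tendsto (fun ε => ∫ y, (g y - g x) * fieldZ s y (x, ε)) (𝓝[>] 0)
      (𝓝 (∫ y, (g y - g x) * (s * kern s (x - y)))) := by
    refine tendsto_integral_filter_of_dominated_convergence
      (fun y => (s + 2 * (n + s)) * (|g x - g y| * kern s (x - y))) ?_ ?_ (hx.const_mul _) ?_
    · exact Eventually.of_forall fun ε =>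
        (hg.sub aestronglyMeasurable_const).mul (measurable_fieldZ _).aestronglyMeasurable
    · filter_upwards [self_mem_nhdsWithin] with ε hε
      exact ae_of_all _ fun y => abs_sub_mul_fieldZ_le hs g hε x y
    · refine ae_of_all _ fun y => ?_
      rcases eq_or_ne x y with rfl | hxy
      · simp
      · exact (tendsto_fieldZ hxy).const_mul _
  have e : ∫ y, (g y - g x) * (s * kern s (x - y)) = s * nlap s g x := by
    rw [nlap, ← integral_const_mul]
    congr 1
    ext y
    ring
  rw [← e]
  refine h.congr' ?_
  filter_upwards [self_mem_nhdsWithin] with ε hε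
  exact (flux_eq_sub hs hg hb hε x).symm

/-! ### Nontangential boundary values of the extension -/

/-- The profile `(1 + |y|²)^{-(n+s)/2}` of the Poisson kernel. -/
noncomputable def bracket (s : ℝ) (y : Space n) : ℝ := (1 + ‖y‖ ^ 2) ^ (-((n : ℝ) + s) / 2)

lemma bracket_nonneg (y : Space n) : 0 ≤ bracket s y := by unfold bracket; positivity

lemma bracket_le_one (hs : 0 < s) (y : Space n) : bracket s y ≤ 1 := by
  have : (0 : ℝ) ≤ n := by positivity
  exact Real.rpow_le_one_of_one_le_of_nonpos (by nlinarith [sq_nonneg ‖y‖]) (by linarith)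

lemma integral_comp_sub_smul (f : Space n → ℝ) (w : Space n) {δ : ℝ} (hδ : 0 < δ) :
    ∫ y, f (w - δ • y) = (δ ^ n)⁻¹ * ∫ y, f y := by
  have h := Measure.integral_comp_smul volume (fun y => f (w - y)) δ
  simp only [finrank_euclideanSpace, Fintype.card_fin, smul_eq_mul] at h
  rw [h, integral_sub_left_eq_self f volume w, abs_of_pos (by positivity)]

lemma pker_scaled {δ : ℝ} (hδ : 0 < δ) (w y : Space n) :
    pker s (shift (w - δ • y) (w, δ)) = (δ ^ n)⁻¹ * bracket s y := by
  have : shift (w - δ • y) (w, δ) = (δ • y, δ) := by simp [shift]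
  rw [this, pker, rker_eq_scaled hδ, smul_smul, inv_mul_cancel₀ hδ.ne', one_smul, ← mul_assoc,
    ← Real.rpow_add hδ, bracket]
  congr 1
  rw [show s + -((n : ℝ) + s) = -(n : ℝ) by ring, Real.rpow_neg hδ.le, Real.rpow_natCast]

/-- In the variable (w - y)/δ the Poisson integral is an average against a fixed profile. -/
lemma ext_eq_scaled (g : Space n → ℝ) (w : Space n) {δ : ℝ} (hδ : 0 < δ) :
    ext s g (w, δ) = ∫ y, g (w - δ • y) * bracket s y := by
  have h := integral_comp_sub_smul (fun y => g y * pker s (shift y (w, δ))) w hδ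
  have hδn : (δ ^ n) ≠ 0 := by positivity
  simp only [pker_scaled hδ] at h
  rw [ext, ← mul_right_injective₀ (inv_ne_zero hδn) |>.eq_iff, ← h, ← integral_const_mul]
  congr 1
  ext y
  ring

lemma tendsto_tail_bracket (hs : 0 < s) :
    Tendsto (fun k : ℕ => ∫ y : Space n, (closedBall (0 : Space n) k)ᶜ.indicator (bracket s) y)
      atTop (𝓝 0) := by
  have : (0 : ℝ) = ∫ _ : Space n, (0 : ℝ) := by simp
  rw [this]
  refine tendsto_integral_of_dominated_convergence (bracket s) (fun k => ?_)
    (integrable_bracket hs) (fun k => ae_of_all _ fun y => ?_) (ae_of_all _ fun y => ?_)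
  · exact (integrable_bracket hs).aestronglyMeasurable.indicator measurableSet_closedBall.compl
  · rw [Real.norm_of_nonneg (Set.indicator_nonneg (fun _ _ => bracket_nonneg _) _)]
    exact Set.indicator_le_self' (fun _ _ => bracket_nonneg _) _
  · refine tendsto_const_nhds.congr' ?_
    obtain ⟨k₀, hk₀⟩ := exists_nat_ge ‖y‖
    filter_upwards [eventually_ge_atTop k₀] with k hk
    rw [Set.indicator_of_notMem]
    simp only [Set.mem_compl_iff, mem_closedBall_zero_iff, not_not]
    exact hk₀.trans (by exact_mod_cast hk)

/-- The rescaled integral is split at radius R. Inside, the profile is at most 1, and the change of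
variables leaves R^n |B_1| times an average over a ball of radius Rδ. Outside, |g(y) - g(x)| ≤ 2M is
integrated against the tail of the profile. -/
lemma abs_ext_sub_le (hs : 0 < s) {g : Space n → ℝ} (hg : AEStronglyMeasurable g) {M : ℝ}
    (hb : ∀ x, |g x| ≤ M) (x w : Space n) {δ R : ℝ} (hδ : 0 < δ) (hR : 0 < R) :
    |ext s g (w, δ) - kappa n s * g x| ≤
      R ^ n * volume.real (closedBall (0 : Space n) 1) *
        (⨍ y in closedBall w (R * δ), ‖g y - g x‖) +
      2 * M * ∫ y : Space n, (closedBall (0 : Space n) R)ᶜ.indicator (bracket s) y := by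
  have hM : 0 ≤ M := (abs_nonneg _).trans (hb 0)
  set B := closedBall w (R * δ) with hB
  have hBm : MeasurableSet B := measurableSet_closedBall
  have hBv : volume.real B = (R * δ) ^ n * volume.real (closedBall (0 : Space n) 1) := by
    rw [hB, measureReal_def, Measure.addHaar_closedBall volume w (by positivity : 0 ≤ R * δ)]
    simp only [finrank_euclideanSpace, Fintype.card_fin, ENNReal.toReal_mul, measureReal_def]
    rw [ENNReal.toReal_ofReal (by positivity), Measure.addHaar_unitClosedBall_eq_addHaar_unitBall]
  have hB0 : volume.real B ≠ 0 := by
    have : 0 < volume B := measure_closedBall_pos _ _ (by positivity)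
    rw [measureReal_def, ENNReal.toReal_ne_zero]
    exact ⟨this.ne', measure_closedBall_lt_top.ne⟩
  set f : Space n → ℝ := B.indicator fun y => ‖g y - g x‖ with hf
  have hgx : ∀ y, ‖g y - g x‖ ≤ 2 * M := fun y => by
    have := (abs_sub (g y) (g x)).trans (add_le_add (hb y) (hb x))
    rw [Real.norm_eq_abs]; linarith
  have hfi : Integrable f := by
    refine IntegrableOn.integrable_indicator ?_ hBm
    exact Measure.integrableOn_of_bounded (M := 2 * M) measure_closedBall_lt_top.ne
      (hg.sub aestronglyMeasurable_const).norm (ae_of_all _ fun y => by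
        rw [norm_norm]; exact hgx y)
  have hfi' : Integrable fun y => f (w - δ • y) :=
    (hfi.comp_sub_left w).comp_smul hδ.ne'
  have e1 : ∫ y, f (w - δ • y) = R ^ n * volume.real (closedBall (0 : Space n) 1) *
      (⨍ y in B, ‖g y - g x‖) := by
    rw [integral_comp_sub_smul f w hδ, hf, integral_indicator hBm, setAverage_eq, hBv, smul_eq_mul,
      mul_pow]
    have : volume.real (closedBall (0 : Space n) 1) ≠ 0 := by
      rw [hBv] at hB0
      exact right_ne_zero_of_mul hB0
    field_simp
  have ti : Integrable ((closedBall (0 : Space n) R)ᶜ.indicator (bracket (n := n) s)) :=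
    (integrable_bracket hs).indicator measurableSet_closedBall.compl
  rw [ext_eq_scaled g w hδ, mul_comm (kappa n s), kappa, ← integral_const_mul, ← e1,
    ← integral_const_mul (2 * M), ← integral_add hfi' (ti.const_mul _)]
  have hgi : Integrable fun y => g (w - δ • y) * bracket s y := by
    refine (integrable_bracket hs).bdd_mul (c := M) ?_ (ae_of_all _ fun y => hb _)
    -- As g is only almost everywhere strongly measurable, composition requires that preimages of
    -- null sets be null.
    have hq : Measure.QuasiMeasurePreserving (fun y : Space n => w - δ • y) volume volume := by
      refine ⟨by fun_prop, ?_⟩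
      refine Measure.AbsolutelyContinuous.mk fun A hA h0 => ?_
      rw [Measure.map_apply (by fun_prop) hA]
      have h1 := (quasiMeasurePreserving_sub_left_of_right_invariant volume w).preimage_null h0
      have h2 := Measure.addHaar_preimage_smul volume hδ.ne' ((fun y => w - y) ⁻¹' A)
      rw [h1, mul_zero] at h2
      exact h2
    exact hg.comp_quasiMeasurePreserving hq
  rw [← integral_sub hgi ((integrable_bracket hs).const_mul _), ← Real.norm_eq_abs]
  refine norm_integral_le_of_norm_le (hfi'.add (ti.const_mul _)) (ae_of_all _ fun y => ?_)
  have : (g (w - δ • y) * bracket s y - g x * (1 + ‖y‖ ^ 2) ^ (-((n : ℝ) + s) / 2)) =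
    (g (w - δ • y) - g x) * bracket s y := by unfold bracket; ring
  rw [this, norm_mul, Real.norm_of_nonneg (bracket_nonneg y)]
  by_cases hy : y ∈ closedBall (0 : Space n) R
  · have hyB : w - δ • y ∈ B := by
      rw [mem_closedBall_zero_iff] at hy
      rw [hB, mem_closedBall, dist_eq_norm]
      simp only [sub_sub_cancel_left, norm_neg, norm_smul, Real.norm_eq_abs, abs_of_pos hδ]
      nlinarith
    rw [Set.indicator_of_notMem (by simpa using hy), hf, Set.indicator_of_mem hyB]
    have := mul_le_mul_of_nonneg_left (bracket_le_one hs y) (norm_nonneg (g (w - δ • y) - g x))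
    linarith
  · rw [Set.indicator_of_mem (by simpa using hy)]
    have h1 : 0 ≤ f (w - δ • y) := Set.indicator_nonneg (fun _ _ => norm_nonneg _) _
    have := mul_le_mul_of_nonneg_right (hgx (w - δ • y)) (bracket_nonneg (s := s) y)
    linarith

/-- The extension of a bounded function has nontangential limits almost everywhere. -/
lemma ae_tendsto_ext (hs : 0 < s) {g : Space n → ℝ} (hg : AEStronglyMeasurable g) {M : ℝ}
    (hb : ∀ x, |g x| ≤ M) :
    ∀ᵐ x : Space n, ∀ (w : ℝ → Space n) (δ : ℝ → ℝ) (K : ℝ),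
      Tendsto δ (𝓝[>] 0) (𝓝[>] 0) → (∀ᶠ ε in 𝓝[>] (0 : ℝ), ‖w ε - x‖ ≤ K * δ ε) →
      Tendsto (fun ε => ext s g (w ε, δ ε)) (𝓝[>] 0) (𝓝 (kappa n s * g x)) := by
  have hloc : LocallyIntegrable g := (memLp_top_of_bound hg M (ae_of_all _ hb)).locallyIntegrable le_top
  have hM : 0 ≤ M := (abs_nonneg _).trans (hb 0)
  -- Lebesgue differentiation along balls that need not be centred at x. The ratio k between offset
  -- and radius is arbitrary but fixed; countably many k give one exceptional null set.
  have hall : ∀ k : ℕ, ∀ᵐ x : Space n, ∀ (w : ℝ → Space n) (δ : ℝ → ℝ),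
      Tendsto δ (𝓝[>] 0) (𝓝[>] 0) → (∀ᶠ ε in 𝓝[>] (0 : ℝ), x ∈ closedBall (w ε) (k * δ ε)) →
      Tendsto (fun ε => ⨍ y in closedBall (w ε) (δ ε), ‖g y - g x‖) (𝓝[>] 0) (𝓝 0) := by
    intro k
    filter_upwards [IsUnifLocDoublingMeasure.ae_tendsto_average_norm_sub volume hloc (k : ℝ)]
      with x hx w δ h1 h2 using hx w δ h1 h2
  rw [← ae_all_iff] at hall
  filter_upwards [hall] with x hx w δ K hδ hK
  have hδpos : ∀ᶠ ε in 𝓝[>] (0 : ℝ), 0 < δ ε := hδ self_mem_nhdsWithin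
  rw [Metric.tendsto_nhds]
  intro η hη
  have htail : Tendsto (fun k : ℕ =>
      2 * M * ∫ y : Space n, (closedBall (0 : Space n) k)ᶜ.indicator (bracket s) y)
      atTop (𝓝 0) := by simpa using (tendsto_tail_bracket (n := n) hs).const_mul (2 * M)
  -- First k makes the tail small; then j is chosen so that the aperture K is covered, ‖w - x‖ ≤ Kδ
  -- ≤ j (kδ).
  obtain ⟨k, hk, hk1⟩ := ((htail.eventually (gt_mem_nhds (half_pos hη))).and
    (eventually_ge_atTop 1)).exists
  have hkpos : (0 : ℝ) < k := by exact_mod_cast hk1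
  obtain ⟨j, hj⟩ := exists_nat_ge (K / k)
  have havg := hx j w (fun ε => k * δ ε) (by
    refine tendsto_nhdsWithin_iff.2 ⟨?_, ?_⟩
    · simpa using (tendsto_nhds_of_tendsto_nhdsWithin hδ).const_mul (k : ℝ)
    · filter_upwards [hδpos] with ε h using mul_pos hkpos h) (by
    filter_upwards [hK, hδpos] with ε h h'
    rw [mem_closedBall, dist_comm, dist_eq_norm]
    refine h.trans ?_
    rw [div_le_iff₀ hkpos] at hj
    nlinarith)
  have havg' : Tendsto (fun ε => (k : ℝ) ^ n * volume.real (closedBall (0 : Space n) 1) *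
        (⨍ y in closedBall (w ε) (k * δ ε), ‖g y - g x‖)) (𝓝[>] 0) (𝓝 0) := by
    simpa using havg.const_mul ((k : ℝ) ^ n * volume.real (closedBall (0 : Space n) 1))
  filter_upwards [havg'.eventually (gt_mem_nhds (half_pos hη)), hδpos] with ε h1 h2
  rw [Real.dist_eq]
  refine (abs_ext_sub_le hs hg hb x (w ε) h2 hkpos).trans_lt ?_
  linarith

/-! ### Cutoff functions -/

/-- The cutoff profile. -/
noncomputable def zeta (q : ℝ) : ℝ := (max 0 (1 - q)) ^ 2

/-- The derivative of the cutoff profile. -/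
noncomputable def zetaD (q : ℝ) : ℝ := -2 * max 0 (1 - q)

lemma hasDerivAt_zeta (q : ℝ) : HasDerivAt zeta (zetaD q) q := by
  rcases lt_trichotomy q 1 with h | h | h
  · have h1 : HasDerivAt (fun q : ℝ => (1 - q) ^ 2) (zetaD q) q := by
      have := ((hasDerivAt_id q).const_sub 1).pow 2
      refine this.congr_deriv ?_
      rw [zetaD, max_eq_right (by linarith)]
      simp
    refine h1.congr_of_eventuallyEq ?_
    filter_upwards [gt_mem_nhds h] with x hx
    rw [zeta, max_eq_right (by linarith)]
  -- At the gluing point q = 1 both branches are bounded by (x - 1)², hence are o(x - 1).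
  · subst h
    have : zetaD 1 = 0 := by simp [zetaD]
    rw [this, hasDerivAt_iff_isLittleO]
    have h2 : (fun x : ℝ => (x - 1) ^ 2) =o[𝓝 1] fun x => x - 1 := by
      have : Tendsto (fun x : ℝ => x - 1) (𝓝 1) (𝓝 0) := by
        have : ContinuousAt (fun x : ℝ => x - 1) 1 := by fun_prop
        simpa using this.tendsto
      simpa [pow_two] using (Asymptotics.isLittleO_one_iff ℝ |>.2 this).mul_isBigO
        (Asymptotics.isBigO_refl (fun x : ℝ => x - 1) (𝓝 1))
    refine (Asymptotics.IsBigO.of_bound 1 (Eventually.of_forall fun x => ?_)).trans_isLittleO h2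
    simp only [zeta, sub_self, max_self, smul_zero, sub_zero, one_mul, Real.norm_eq_abs, abs_pow,
      sq_abs]
    rw [← sq_abs (x - 1)]
    simp only [ne_eq, OfNat.ofNat_ne_zero, not_false_eq_true, zero_pow, sub_zero, abs_pow]
    refine pow_le_pow_left₀ (abs_nonneg _) ?_ 2
    rw [abs_of_nonneg (le_max_left _ _)]
    exact max_le (abs_nonneg _) (by rw [abs_sub_comm]; exact le_abs_self _)
  · have h1 : HasDerivAt (fun _ : ℝ => (0 : ℝ)) (zetaD q) q := by
      rw [zetaD, max_eq_left (by linarith), mul_zero]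
      exact hasDerivAt_const _ _
    refine h1.congr_of_eventuallyEq ?_
    filter_upwards [lt_mem_nhds h] with x hx
    rw [zeta, max_eq_left (by linarith)]
    norm_num

lemma zeta_nonneg (q : ℝ) : 0 ≤ zeta q := sq_nonneg _

lemma zeta_le_one {q : ℝ} (hq : 0 ≤ q) : zeta q ≤ 1 :=
  pow_le_one₀ (le_max_left _ _) (max_le zero_le_one (by linarith))

lemma zeta_eq_zero {q : ℝ} (hq : 1 ≤ q) : zeta q = 0 := by
  rw [zeta, max_eq_left (by linarith)]; norm_num

lemma zetaD_eq_zero {q : ℝ} (hq : 1 ≤ q) : zetaD q = 0 := by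
  rw [zetaD, max_eq_left (by linarith)]; norm_num

lemma zetaD_nonpos (q : ℝ) : zetaD q ≤ 0 := by
  have := le_max_left 0 (1 - q)
  unfold zetaD
  linarith

lemma abs_zetaD_le {q : ℝ} (hq : 0 ≤ q) : |zetaD q| ≤ 2 := by
  rw [abs_of_nonpos (zetaD_nonpos q), zetaD]
  have : max 0 (1 - q) ≤ 1 := max_le zero_le_one (by linarith)
  linarith

/-- The reason for a quadratic profile: |ζ'|² is controlled by ζ itself, so errors that contain the
gradient of the cutoff can be absorbed after division by the cutoff. -/
lemma zetaD_sq (q : ℝ) : zetaD q ^ 2 = 4 * zeta q := by unfold zetaD zeta; ring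

lemma continuous_zeta : Continuous zeta := by unfold zeta; fun_prop

lemma continuous_zetaD : Continuous zetaD := by unfold zetaD; fun_prop

/-- The cutoff function on the ball of radius `ρ`. -/
noncomputable def cut (ρ : ℝ) (p : Space n × ℝ) : ℝ := zeta (rsq p / ρ ^ 2)

/-- The derivative of the cutoff function. -/
noncomputable def cutD (ρ : ℝ) (p : Space n × ℝ) : Space n × ℝ →L[ℝ] ℝ :=
  (zetaD (rsq p / ρ ^ 2) * (2 / ρ ^ 2)) • rdot p

lemma hasFDerivAt_cut (ρ : ℝ) (p : Space n × ℝ) : HasFDerivAt (cut ρ) (cutD ρ p) p := by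
  have h1 : HasFDerivAt (fun p : Space n × ℝ => rsq p / ρ ^ 2) ((ρ ^ 2)⁻¹ • (2 : ℝ) • rdot p) p := by
    simp_rw [div_eq_inv_mul]
    exact (hasFDerivAt_rsq p).const_mul _
  refine ((hasDerivAt_zeta _).comp_hasFDerivAt p h1).congr_fderiv ?_
  rw [cutD, smul_smul, smul_smul]
  congr 1
  ring

lemma cut_nonneg (ρ : ℝ) (p : Space n × ℝ) : 0 ≤ cut ρ p := zeta_nonneg _

lemma cut_le_one (ρ : ℝ) (p : Space n × ℝ) : cut ρ p ≤ 1 :=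
  zeta_le_one (div_nonneg (rsq_nonneg p) (sq_nonneg ρ))

lemma cut_eq_zero {ρ : ℝ} (hρ : 0 < ρ) {p : Space n × ℝ} (hp : ρ ^ 2 ≤ rsq p) : cut ρ p = 0 :=
  zeta_eq_zero ((one_le_div (by positivity)).2 hp)

lemma cutD_eq_zero {ρ : ℝ} (hρ : 0 < ρ) {p : Space n × ℝ} (hp : ρ ^ 2 ≤ rsq p) : cutD ρ p = 0 := by
  rw [cutD, zetaD_eq_zero ((one_le_div (by positivity)).2 hp)]; simp

lemma continuous_cut (ρ : ℝ) : Continuous (cut ρ : Space n × ℝ → ℝ) :=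
  continuous_zeta.comp (continuous_rsq.div_const _)

lemma continuous_cutD (ρ : ℝ) : Continuous (cutD ρ : Space n × ℝ → Space n × ℝ →L[ℝ] ℝ) :=
  Continuous.smul ((continuous_zetaD.comp (continuous_rsq.div_const _)).mul continuous_const)
    continuous_rdot

lemma norm_rdot_le (p : Space n × ℝ) : ‖rdot p‖ ≤ 2 * √(rsq p) :=
  ContinuousLinearMap.opNorm_le_bound _ (by positivity) fun h => abs_rdot_le p h

lemma norm_cutD_le {ρ : ℝ} (hρ : 0 < ρ) (p : Space n × ℝ) :
    ‖cutD ρ p‖ ≤ 8 * √(rsq p) / ρ ^ 2 := by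
  rw [cutD, norm_smul, norm_mul, Real.norm_eq_abs, Real.norm_eq_abs,
    abs_of_nonneg (by positivity : 0 ≤ 2 / ρ ^ 2)]
  have h1 := abs_zetaD_le (div_nonneg (rsq_nonneg p) (sq_nonneg ρ))
  calc _ ≤ 2 * (2 / ρ ^ 2) * (2 * √(rsq p)) := by
        gcongr
        exact norm_rdot_le p
    _ = _ := by ring

lemma norm_cutD_le' {ρ : ℝ} (hρ : 0 < ρ) (p : Space n × ℝ) : ‖cutD ρ p‖ ≤ 8 / ρ := by
  rcases le_or_gt (ρ ^ 2) (rsq p) with h | h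
  · rw [cutD_eq_zero hρ h, norm_zero]; positivity
  · refine (norm_cutD_le hρ p).trans ?_
    have : √(rsq p) ≤ ρ := Real.sqrt_le_iff.2 ⟨hρ.le, h.le⟩
    rw [div_le_div_iff₀ (by positivity) hρ]
    nlinarith

lemma gdot_cutD_le {ρ : ℝ} (hρ : 0 < ρ) (p : Space n × ℝ) :
    gdot (cutD ρ p) (cutD ρ p) ≤ 16 / ρ ^ 2 * cut ρ p := by
  rcases le_or_gt (ρ ^ 2) (rsq p) with h | h
  · rw [cutD_eq_zero hρ h, cut_eq_zero hρ h]; simp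
  · rw [cutD, gdot_smul_left, gdot_smul_right, gdot_rdot, rdot_self, cut]
    have h1 := zetaD_sq (rsq p / ρ ^ 2)
    have h2 := zeta_nonneg (rsq p / ρ ^ 2)
    have h3 : rsq p / ρ ^ 2 ≤ 1 := (div_le_one (by positivity)).2 h.le
    calc _ = zetaD (rsq p / ρ ^ 2) ^ 2 * (4 / ρ ^ 2) * (rsq p / ρ ^ 2) := by
          field_simp; ring
      _ ≤ zetaD (rsq p / ρ ^ 2) ^ 2 * (4 / ρ ^ 2) * 1 := by gcongr
      _ = _ := by rw [h1]; ring

/-! ### Caccioppoli's inequality -/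

lemma continuousOn_extD (hs : 0 < s) {g : Space n → ℝ} (hg : AEStronglyMeasurable g) {M : ℝ}
    (hb : ∀ x, |g x| ≤ M) : ContinuousOn (extD s g) (upper n) :=
  fun _ hp => (continuousAt_extD hs hg hb hp).continuousWithinAt

lemma continuousOn_ext (hs : 0 < s) {g : Space n → ℝ} (hg : AEStronglyMeasurable g) {M : ℝ}
    (hb : ∀ x, |g x| ≤ M) : ContinuousOn (ext s g) (upper n) :=
  fun _ hp => (hasFDerivAt_ext hs hg hb hp).continuousAt.continuousWithinAt

lemma continuousOn_weight (t : ℝ) : ContinuousOn (fun p : Space n × ℝ => p.2 ^ t) (upper n) :=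
  continuousOn_snd.rpow_const fun _ hp => Or.inl (ne_of_gt hp)

lemma hasFDerivAt_ext_mul_cut (hs : 0 < s) {g : Space n → ℝ} (hg : AEStronglyMeasurable g) {M : ℝ}
    (hb : ∀ x, |g x| ≤ M) (ρ : ℝ) {p : Space n × ℝ} (hp : p ∈ upper n) :
    HasFDerivAt (fun p => ext s g p * cut ρ p) (ext s g p • cutD ρ p + cut ρ p • extD s g p) p :=
  (hasFDerivAt_ext hs hg hb hp).mul (hasFDerivAt_cut ρ p)

lemma isTest_ext_mul_cut (hs : 0 < s) {g : Space n → ℝ} (hg : AEStronglyMeasurable g) {M : ℝ}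
    (hb : ∀ x, |g x| ≤ M) {ρ : ℝ} (hρ : 0 < ρ) {ε : ℝ} (hε : 0 < ε) :
    IsTest ε fun p => ext s g p * cut ρ p where
  diff p hp := (hasFDerivAt_ext_mul_cut hs hg hb ρ hp).differentiableAt
  supp := ⟨ρ ^ 2, fun p _ hpR => by rw [cut_eq_zero hρ hpR.le, mul_zero]⟩
  bound := ⟨M * kappa n s * 1, fun p hp => by
    have hM : 0 ≤ M := (abs_nonneg _).trans (hb 0)
    have := (kappa_pos (n := n) hs).le
    rw [abs_mul, abs_of_nonneg (cut_nonneg ρ p)]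
    exact mul_le_mul (abs_ext_le hs hb (hε.trans_le hp)) (cut_le_one ρ p) (cut_nonneg ρ p)
      (by positivity)⟩
  bound_fderiv := ⟨M * kappa n s * (8 / ρ) + 1 * (M * (s + 2 * (n + s)) * kappa n s / ε),
    fun p hp => by
      have hM : 0 ≤ M := (abs_nonneg _).trans (hb 0)
      have hk := (kappa_pos (n := n) hs).le
      have hp0 : 0 < p.2 := hε.trans_le hp
      rw [(hasFDerivAt_ext_mul_cut hs hg hb ρ hp0).fderiv]
      refine (norm_add_le _ _).trans ?_
      rw [norm_smul, norm_smul]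
      refine add_le_add (mul_le_mul (abs_ext_le hs hb hp0) (norm_cutD_le' hρ p) (norm_nonneg _)
        (by positivity)) (mul_le_mul ?_ ((norm_extD_le hs hb hp0).trans ?_) (norm_nonneg _)
        zero_le_one)
      · rw [Real.norm_of_nonneg (cut_nonneg ρ p)]; exact cut_le_one ρ p
      · gcongr⟩

/-- Testing the equation of an extension with its own truncation. -/
lemma integral_cut_mul_energy (hs : 0 < s) {g : Space n → ℝ} (hg : AEStronglyMeasurable g) {M : ℝ}
    (hb : ∀ x, |g x| ≤ M) {ρ : ℝ} (hρ : 0 < ρ) {ε : ℝ} (hε : 0 < ε) :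
    ∫ p, p.2 ^ (1 - s) * (ext s g p * gdot (extD s g p) (cutD ρ p) +
      cut ρ p * gdot (extD s g p) (extD s g p)) ∂(hvol n ε) =
      -∫ x, flux s g ε x * (ext s g (x, ε) * cut ρ (x, ε)) := by
  rw [← integral_gdot_extD hs hg hb hε (isTest_ext_mul_cut hs hg hb hρ hε)]
  refine integral_congr_ae ?_
  filter_upwards [ae_hvol] with p hp
  rw [(hasFDerivAt_ext_mul_cut hs hg hb ρ (hε.trans hp)).fderiv, gdot_add_right, gdot_smul_right,
    gdot_smul_right]

lemma continuousOn_gdot {α : Type*} [TopologicalSpace α] {S : Set α}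
    {L M : α → Space n × ℝ →L[ℝ] ℝ} (hL : ContinuousOn L S) (hM : ContinuousOn M S) :
    ContinuousOn (fun x => gdot (L x) (M x)) S := by
  unfold gdot
  fun_prop

/-- The energy density of the extension. -/
noncomputable def dens (s : ℝ) (g : Space n → ℝ) (p : Space n × ℝ) : ℝ :=
  p.2 ^ (1 - s) * gdot (extD s g p) (extD s g p)

lemma dens_nonneg {g : Space n → ℝ} {p : Space n × ℝ} (hp : p ∈ upper n) : 0 ≤ dens s g p :=
  mul_nonneg (Real.rpow_nonneg (le_of_lt hp) _) (gdot_self_nonneg _)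

lemma continuousOn_dens (hs : 0 < s) {g : Space n → ℝ} (hg : AEStronglyMeasurable g) {M : ℝ}
    (hb : ∀ x, |g x| ≤ M) : ContinuousOn (dens s g) (upper n) :=
  (continuousOn_weight _).mul
    (continuousOn_gdot (continuousOn_extD hs hg hb) (continuousOn_extD hs hg hb))

lemma integrable_mul_cut {c : Space n × ℝ → ℝ} (hc : ContinuousOn c (upper n)) {ρ : ℝ} (hρ : 0 < ρ)
    {ε : ℝ} (hε : 0 < ε) : Integrable (fun p => c p * cut ρ p) (hvol n ε) :=
  integrable_mul_of_bounded (R := ρ ^ 2) (M := 1) hε hc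
    (continuous_cut ρ).aestronglyMeasurable
    (fun p _ => by rw [abs_of_nonneg (cut_nonneg ρ p)]; exact cut_le_one ρ p)
    (fun p _ h => cut_eq_zero hρ h.le)

lemma integrable_gdot_cutD (hs : 0 < s) {g : Space n → ℝ} (hg : AEStronglyMeasurable g) {M : ℝ}
    (hb : ∀ x, |g x| ≤ M) {ρ : ℝ} (hρ : 0 < ρ) {ε : ℝ} (hε : 0 < ε) :
    Integrable (fun p => p.2 ^ (1 - s) * (ext s g p * gdot (extD s g p) (cutD ρ p)))
      (hvol n ε) := by
  have := integrable_mul_of_bounded (R := ρ ^ 2) (M := 1) (ε := ε)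
    (c := fun p => p.2 ^ (1 - s) * (ext s g p * gdot (extD s g p) (cutD ρ p)))
    (φ := ({p : Space n × ℝ | rsq p < ρ ^ 2}).indicator fun _ => 1) hε ?_ ?_ ?_ ?_
  · refine this.congr (ae_of_all _ fun p => ?_)
    by_cases hp : rsq p < ρ ^ 2
    · simp [Set.indicator, hp]
    · simp [Set.indicator, hp, cutD_eq_zero hρ (not_lt.1 hp)]
  · exact (continuousOn_weight _).mul ((continuousOn_ext hs hg hb).mul
      (continuousOn_gdot (continuousOn_extD hs hg hb) (continuous_cutD ρ).continuousOn))
  · exact aestronglyMeasurable_const.indicator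
      (measurableSet_lt continuous_rsq.measurable measurable_const)
  · intro p _
    simp only [Set.indicator]
    split_ifs <;> simp
  · intro p _ hp
    rw [Set.indicator_of_notMem]
    simpa using hp.le

/-- `g` has finite nonlocal energy in `Ω`. -/
def FiniteOn (s : ℝ) (Ω : Set (Space n)) (g : Space n → ℝ) : Prop :=
  Integrable (fun p : Space n × Space n => |g p.1 - g p.2| * kern s (p.1 - p.2))
    ((volume.restrict Ω).prod volume)

lemma FiniteOn.ae_integrable {Ω : Set (Space n)} {g : Space n → ℝ} (h : FiniteOn s Ω g) :
    ∀ᵐ x ∂(volume.restrict Ω), Integrable fun y => |g x - g y| * kern s (x - y) :=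
  h.prod_right_ae

lemma FiniteOn.integrable_nvar {Ω : Set (Space n)} {g : Space n → ℝ} (h : FiniteOn s Ω g) :
    Integrable (nvar s g) (volume.restrict Ω) :=
  h.integral_prod_left

lemma nvar_nonneg (g : Space n → ℝ) (x : Space n) : 0 ≤ nvar s g x :=
  integral_nonneg fun _ => mul_nonneg (abs_nonneg _) (kern_nonneg _)

lemma mem_ball_of_rsq_lt {ρ : ℝ} (hρ : 0 < ρ) {p : Space n × ℝ} (hp : rsq p < ρ ^ 2) :
    p.1 ∈ ball (0 : Space n) ρ := by
  rw [mem_ball_zero_iff]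
  exact lt_of_pow_lt_pow_left₀ 2 hρ.le ((norm_sq_le_rsq p).trans_lt hp)

/-- Since s < 1 the weight z^(1-s) is continuous up to z = 0, hence integrable on bounded sets. -/
lemma integrableOn_weight (hs1 : s < 1) (ρ : ℝ) :
    Integrable (fun p : Space n × ℝ => p.2 ^ (1 - s) *
      ({p : Space n × ℝ | rsq p < ρ ^ 2}).indicator (fun _ => 1) p) (hvol n 0) := by
  have hc : Continuous fun p : Space n × ℝ => p.2 ^ (1 - s) :=
    continuous_snd.rpow_const fun _ => Or.inr (by linarith)
  have hS : MeasurableSet {p : Space n × ℝ | rsq p < ρ ^ 2} :=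
    measurableSet_lt continuous_rsq.measurable measurable_const
  have h1 : IntegrableOn (fun p : Space n × ℝ => p.2 ^ (1 - s)) {p | 0 ≤ p.2 ∧ rsq p ≤ ρ ^ 2} :=
    hc.continuousOn.integrableOn_compact (isCompact_slab 0 (ρ ^ 2))
  have h2 : IntegrableOn (fun p : Space n × ℝ => p.2 ^ (1 - s)) {p | rsq p < ρ ^ 2} (hvol n 0) := by
    rw [IntegrableOn, hvol, Measure.restrict_restrict hS]
    exact h1.mono_set fun p hp => ⟨hp.2.le, hp.1.le⟩
  refine (h2.integrable_indicator hS).congr (ae_of_all _ fun p => ?_)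
  simp [Set.indicator]

lemma hvol_restrict_gt {δ ε : ℝ} (h : δ ≤ ε) :
    (hvol n δ).restrict {p | ε < p.2} = hvol n ε := by
  rw [hvol, hvol, Measure.restrict_restrict (measurableSet_gt ε)]
  congr 1
  ext p
  simp only [Set.mem_inter_iff, Set.mem_ofPred_eq, and_iff_left_iff_imp]
  exact fun hp => lt_of_le_of_lt h hp

/-- The exhaustion of z > 0 along which estimates that are uniform in ε are passed to the limit. -/
lemma aecover_hvol :
    AECover (hvol n 0) atTop fun k : ℕ => {p : Space n × ℝ | 1 / ((k : ℝ) + 1) < p.2} where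
  ae_eventually_mem := by
    filter_upwards [ae_hvol] with p hp
    have := tendsto_one_div_add_atTop_nhds_zero_nat (𝕜 := ℝ)
    exact this.eventually (gt_mem_nhds hp)
  measurableSet k := measurableSet_gt _

/-- Young's inequality for √cut ∇u and -(u/√cut) ∇cut. The second square stays bounded because
|∇cut|² ≤ 16 cut/ρ² and |u| ≤ Mκ. -/
lemma neg_ext_mul_gdot_cutD_le (hs : 0 < s) {g : Space n → ℝ} {M : ℝ}
    (hb : ∀ x, |g x| ≤ M) {ρ : ℝ} (hρ : 0 < ρ) {p : Space n × ℝ} (hp0 : 0 < p.2)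
    (h : rsq p < ρ ^ 2) :
    -(ext s g p * gdot (extD s g p) (cutD ρ p)) ≤
      1 / 2 * (cut ρ p * gdot (extD s g p) (extD s g p)) +
        (M * kappa n s) ^ 2 * (8 / ρ ^ 2) := by
  have hc : 0 < cut ρ p := by
    have : rsq p / ρ ^ 2 < 1 := (div_lt_one (by positivity)).2 h
    have : 0 < max 0 (1 - rsq p / ρ ^ 2) := lt_max_of_lt_right (by linarith)
    unfold cut zeta
    positivity
  have hu : ext s g p ^ 2 ≤ (M * kappa n s) ^ 2 := by
    rw [← sq_abs]
    exact pow_le_pow_left₀ (abs_nonneg _) (abs_ext_le hs hb hp0) 2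
  have y1 := two_mul_gdot_le (√(cut ρ p) • extD s g p)
    ((-(ext s g p / √(cut ρ p))) • cutD ρ p)
  rw [gdot_smul_left, gdot_smul_right, gdot_smul_left, gdot_smul_right, gdot_smul_left,
    gdot_smul_right] at y1
  have hsq : √(cut ρ p) * √(cut ρ p) = cut ρ p := Real.mul_self_sqrt hc.le
  have hsp : 0 < √(cut ρ p) := Real.sqrt_pos.2 hc
  have y2 : -(ext s g p / √(cut ρ p)) * (-(ext s g p / √(cut ρ p)) *
      gdot (cutD ρ p) (cutD ρ p)) ≤ (M * kappa n s) ^ 2 * (16 / ρ ^ 2) := by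
    have : -(ext s g p / √(cut ρ p)) * (-(ext s g p / √(cut ρ p)) *
      gdot (cutD ρ p) (cutD ρ p)) = ext s g p ^ 2 * (gdot (cutD ρ p) (cutD ρ p) / cut ρ p) := by
      field_simp
      rw [Real.sq_sqrt hc.le]
      ring
    rw [this]
    refine mul_le_mul hu ?_ (div_nonneg (gdot_self_nonneg _) hc.le) (sq_nonneg _)
    rw [div_le_iff₀ hc]
    exact gdot_cutD_le hρ p
  have y3 : √(cut ρ p) * (-(ext s g p / √(cut ρ p)) * gdot (extD s g p) (cutD ρ p)) =
    -(ext s g p * gdot (extD s g p) (cutD ρ p)) := by field_simp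
  have y4 : √(cut ρ p) * (√(cut ρ p) * gdot (extD s g p) (extD s g p)) =
    cut ρ p * gdot (extD s g p) (extD s g p) := by rw [← mul_assoc, hsq]
  rw [y3, y4] at y1
  have : (M * kappa n s) ^ 2 * (16 / ρ ^ 2) = 2 * ((M * kappa n s) ^ 2 * (8 / ρ ^ 2)) := by
    ring
  linarith

/-- The boundary term is estimated independently of ε through `abs_flux_le`; the cutoff restricts it
to the ball on which the nonlocal variation is integrable. -/
lemma neg_integral_flux_mul_cut_le (hs : 0 < s) {g : Space n → ℝ}
    (hg : AEStronglyMeasurable g) {M : ℝ} (hb : ∀ x, |g x| ≤ M) {ρ : ℝ} (hρ : 0 < ρ)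
    (hfin : FiniteOn s (ball 0 ρ) g) {ε : ℝ} (hε : 0 < ε) :
    -∫ x, flux s g ε x * (ext s g (x, ε) * cut ρ (x, ε)) ≤
      ∫ x in ball (0 : Space n) ρ, (s + 2 * (n + s)) * nvar s g x * (M * kappa n s) := by
  have hM : 0 ≤ M := (abs_nonneg _).trans (hb 0)
  have hk := (kappa_pos (n := n) hs).le
  have : ∫ x, flux s g ε x * (ext s g (x, ε) * cut ρ (x, ε)) =
      ∫ x in ball (0 : Space n) ρ, flux s g ε x * (ext s g (x, ε) * cut ρ (x, ε)) := by
    refine (setIntegral_eq_integral_of_forall_compl_eq_zero fun x hx => ?_).symm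
    rw [cut_eq_zero hρ, mul_zero, mul_zero]
    by_contra! h
    exact hx (mem_ball_of_rsq_lt (p := (x, ε)) hρ h)
  rw [this]
  refine (neg_le_abs _).trans ?_
  rw [← Real.norm_eq_abs]
  refine norm_integral_le_of_norm_le ((hfin.integrable_nvar.const_mul _).mul_const _) ?_
  filter_upwards [hfin.ae_integrable] with x hx
  rw [norm_mul, norm_mul, Real.norm_eq_abs, Real.norm_eq_abs,
    Real.norm_of_nonneg (cut_nonneg ρ _)]
  refine mul_le_mul (abs_flux_le hs hg hb hε hx) ?_
    (mul_nonneg (abs_nonneg _) (cut_nonneg _ _))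
    (mul_nonneg (by positivity) (nvar_nonneg g x))
  calc _ ≤ M * kappa n s * 1 := mul_le_mul (abs_ext_le hs hb (p := (x, ε)) hε)
        (cut_le_one _ _) (cut_nonneg _ _) (by positivity)
    _ = _ := mul_one _

set_option maxHeartbeats 800000 in
/-- Caccioppoli's inequality: finite nonlocal energy of `g` gives finite local energy of its
extension. -/
lemma integrable_dens_mul_cut (hs : 0 < s) (hs1 : s < 1) {g : Space n → ℝ}
    (hg : AEStronglyMeasurable g) {M : ℝ} (hb : ∀ x, |g x| ≤ M) {ρ : ℝ} (hρ : 0 < ρ)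
    (hfin : FiniteOn s (ball 0 ρ) g) :
    Integrable (fun p => dens s g p * cut ρ p) (hvol n 0) := by
  have hM : 0 ≤ M := (abs_nonneg _).trans (hb 0)
  have hk := (kappa_pos (n := n) hs).le
  set W : Space n × ℝ → ℝ := fun p => p.2 ^ (1 - s) *
      ({p : Space n × ℝ | rsq p < ρ ^ 2}).indicator (fun _ => 1) p with hW
  have hWi := integrableOn_weight (n := n) hs1 ρ
  set A : ℝ := ∫ x in ball (0 : Space n) ρ, (s + 2 * (n + s)) * nvar s g x * (M * kappa n s)
  set B : ℝ := ∫ p, W p ∂(hvol n 0)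
  have hW0 : 0 ≤ᵐ[hvol n 0] W := by
    filter_upwards [ae_hvol] with p hp
    exact mul_nonneg (Real.rpow_nonneg (le_of_lt hp) _)
      (Set.indicator_nonneg (fun _ _ => zero_le_one) _)
  -- The bound is uniform in ε. Half of the left side arises on the right from Young's inequality
  -- and is absorbed, which doubles the other constants.
  have key : ∀ ε : ℝ, 0 < ε → ∫ p, dens s g p * cut ρ p ∂(hvol n ε) ≤
      2 * A + (M * kappa n s) ^ 2 * (16 / ρ ^ 2) * B := by
    intro ε hε
    have e := integral_cut_mul_energy hs hg hb hρ hε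
    have i1 := integrable_gdot_cutD hs hg hb hρ hε
    have i2 := integrable_mul_cut (continuousOn_dens hs hg hb) hρ hε
    have i3 : Integrable W (hvol n ε) := hWi.mono_measure (hvol_mono hε.le)
    have e2 : ∫ p, p.2 ^ (1 - s) * (ext s g p * gdot (extD s g p) (cutD ρ p) +
        cut ρ p * gdot (extD s g p) (extD s g p)) ∂(hvol n ε) =
        ∫ p, p.2 ^ (1 - s) * (ext s g p * gdot (extD s g p) (cutD ρ p)) ∂(hvol n ε) +
        ∫ p, dens s g p * cut ρ p ∂(hvol n ε) := by
      rw [← integral_add i1 i2]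
      congr 1
      ext p
      unfold dens
      ring
    have h1 : -∫ x, flux s g ε x * (ext s g (x, ε) * cut ρ (x, ε)) ≤ A :=
      neg_integral_flux_mul_cut_le hs hg hb hρ hfin hε
    have h2 : -∫ p, p.2 ^ (1 - s) * (ext s g p * gdot (extD s g p) (cutD ρ p)) ∂(hvol n ε) ≤
        1 / 2 * ∫ p, dens s g p * cut ρ p ∂(hvol n ε) +
        (M * kappa n s) ^ 2 * (8 / ρ ^ 2) * ∫ p, W p ∂(hvol n ε) := by
      rw [← integral_neg, ← integral_const_mul, ← integral_const_mul,
        ← integral_add (i2.const_mul _) (i3.const_mul _)]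
      refine integral_mono_ae i1.neg ((i2.const_mul _).add (i3.const_mul _)) ?_
      filter_upwards [ae_hvol] with p hp
      have hp0 : 0 < p.2 := hε.trans hp
      have hw : 0 ≤ p.2 ^ (1 - s) := Real.rpow_nonneg hp0.le _
      simp only [hW, dens]
      rcases le_or_gt (ρ ^ 2) (rsq p) with h | h
      · simp [cut_eq_zero hρ h, cutD_eq_zero hρ h, Set.indicator, not_lt.2 h]
      · rw [Set.indicator_of_mem (by simpa using h), mul_one]
        have y5 := neg_ext_mul_gdot_cutD_le hs hb hρ hp0 h
        have := mul_le_mul_of_nonneg_left y5 hw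
        linarith
    have h3 : ∫ p, W p ∂(hvol n ε) ≤ B :=
      integral_mono_measure (hvol_mono hε.le) hW0 hWi
    have h4 : (M * kappa n s) ^ 2 * (8 / ρ ^ 2) * ∫ p, W p ∂(hvol n ε) ≤
        (M * kappa n s) ^ 2 * (8 / ρ ^ 2) * B := by gcongr
    have h5 : (M * kappa n s) ^ 2 * (16 / ρ ^ 2) * B =
      2 * ((M * kappa n s) ^ 2 * (8 / ρ ^ 2) * B) := by ring
    linarith
  refine aecover_hvol.integrable_of_integral_bounded_of_nonneg_ae
    (2 * A + (M * kappa n s) ^ 2 * (16 / ρ ^ 2) * B) (fun k => ?_) ?_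
    (Eventually.of_forall fun k => ?_)
  · have hk : (0 : ℝ) < 1 / ((k : ℝ) + 1) := by positivity
    rw [IntegrableOn, hvol_restrict_gt hk.le]
    exact integrable_mul_cut (continuousOn_dens hs hg hb) hρ hk
  · filter_upwards [ae_hvol] with p hp
    exact mul_nonneg (dens_nonneg hp) (cut_nonneg _ _)
  · have hk : (0 : ℝ) < 1 / ((k : ℝ) + 1) := by positivity
    rw [hvol_restrict_gt hk.le]
    exact key _ hk

/-! ### Decay and energy identity for data of bounded support -/

lemma one_add_norm_le {ε R : ℝ} (hε : 0 < ε) (hR : 0 ≤ R) {y : Space n} (hy : ‖y‖ ≤ R)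
    {p : Space n × ℝ} (hp : ε ≤ p.2) :
    1 + ‖p‖ ≤ (1 / ε + 1 + R / ε) * √(rsq (shift y p)) := by
  set t := √(rsq (shift y p))
  have h1 : p.2 ≤ t := Real.le_sqrt_of_sq_le (sq_le_rsq (shift y p))
  have h2 : ‖p.1 - y‖ ≤ t := Real.le_sqrt_of_sq_le (norm_sq_le_rsq (shift y p))
  have h3 : ‖p.1‖ ≤ ‖p.1 - y‖ + ‖y‖ := norm_le_norm_sub_add _ _
  have h4 : ‖p‖ ≤ t + R := by
    rw [Prod.norm_def]
    refine max_le (by linarith) ?_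
    rw [Real.norm_eq_abs, abs_of_pos (hε.trans_le hp)]
    linarith
  -- Since t ≥ z ≥ ε, constants are at most constants times t/ε; this turns 1 + t + R into a
  -- multiple of t.
  have h5 : 1 ≤ t / ε := (one_le_div hε).2 (hp.trans h1)
  calc 1 + ‖p‖ ≤ t / ε * 1 + t + R * (t / ε) := by nlinarith
    _ = _ := by ring

lemma rker_shift_le_one_add_norm (hs : 0 < s) {ε R : ℝ} (hε : 0 < ε) (hR : 0 ≤ R) {y : Space n}
    (hy : ‖y‖ ≤ R) {p : Space n × ℝ} (hp : ε ≤ p.2) :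
    rker s (shift y p) ≤
      (1 / ε + 1 + R / ε) ^ ((n : ℝ) + s) * (1 + ‖p‖) ^ (-((n : ℝ) + s)) := by
  have hA : 0 < 1 / ε + 1 + R / ε := by positivity
  have hn : (0 : ℝ) ≤ n := by positivity
  have h1 := one_add_norm_le hε hR hy hp
  have h0 : 0 ≤ rsq (shift y p) := rsq_nonneg _
  have e : rker s (shift y p) = √(rsq (shift y p)) ^ (-((n : ℝ) + s)) := by
    rw [rker, Real.sqrt_eq_rpow, ← Real.rpow_mul h0]
    congr 1
    ring
  have h2 : (1 + ‖p‖) / (1 / ε + 1 + R / ε) ≤ √(rsq (shift y p)) := by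
    rw [div_le_iff₀ hA]; linarith
  rw [e]
  refine (Real.rpow_le_rpow_of_nonpos (by positivity) h2 (by linarith)).trans (le_of_eq ?_)
  rw [Real.div_rpow (by positivity) hA.le, Real.rpow_neg hA.le]
  field_simp

/-- Decay of the derivative of the extension of a function of bounded support. -/
lemma exists_norm_extD_le (hs : 0 < s) {h : Space n → ℝ} {M R : ℝ} (hb : ∀ x, |h x| ≤ M)
    (hR : 0 ≤ R) (hsupp : ∀ x, x ∉ closedBall (0 : Space n) R → h x = 0) {ε : ℝ} (hε : 0 < ε) :
    ∃ C : ℝ, 0 ≤ C ∧ ∀ p : Space n × ℝ, ε ≤ p.2 →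
      p.2 ^ (1 - s) * ‖extD s h p‖ ≤ C * (1 + ‖p‖) ^ (-((n : ℝ) + s)) := by
  have hM : 0 ≤ M := (abs_nonneg _).trans (hb 0)
  set A := (1 / ε + 1 + R / ε) ^ ((n : ℝ) + s)
  have hA : 0 ≤ A := by positivity
  set v := volume.real (closedBall (0 : Space n) R)
  refine ⟨v * (M * (s + 2 * (n + s)) * A), by positivity, fun p hp => ?_⟩
  have hp0 : 0 < p.2 := hε.trans_le hp
  have key : ‖extD s h p‖ ≤ ∫ y in closedBall (0 : Space n) R,
      M * ((s + 2 * (n + s)) * (p.2 ^ (s - 1) * (A * (1 + ‖p‖) ^ (-((n : ℝ) + s))))) := by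
    unfold extD
    rw [← setIntegral_eq_integral_of_forall_compl_eq_zero (s := closedBall (0 : Space n) R)
      (fun x hx => by rw [hsupp x hx, zero_smul])]
    refine norm_integral_le_of_norm_le
      (integrableOn_const measure_closedBall_lt_top.ne) ?_
    filter_upwards [ae_restrict_mem measurableSet_closedBall] with y hy
    rw [mem_closedBall_zero_iff] at hy
    rw [norm_smul]
    refine mul_le_mul (hb y) ((norm_pkerD_le hs (p := shift y p) hp0).trans ?_) (norm_nonneg _) hM
    rw [shift_snd]
    gcongr
    exact rker_shift_le_one_add_norm hs hε hR hy hp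
  rw [setIntegral_const, smul_eq_mul] at key
  refine (mul_le_mul_of_nonneg_left key (by positivity)).trans (le_of_eq ?_)
  linear_combination (v * M * (s + 2 * (n + s)) * A * (1 + ‖p‖) ^ (-((n : ℝ) + s))) *
    weight_cancel (s := s) hp0

instance : (volume : Measure (Space n × ℝ)).IsAddHaarMeasure :=
  inferInstanceAs ((volume : Measure (Space n)).prod (volume : Measure ℝ)).IsAddHaarMeasure

lemma integrable_one_add_norm_prod {r : ℝ} (hr : (n : ℝ) + 1 < r) (ε : ℝ) :
    Integrable (fun p : Space n × ℝ => (1 + ‖p‖) ^ (-r)) (hvol n ε) := by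
  have : Integrable (fun p : Space n × ℝ => (1 + ‖p‖) ^ (-r)) volume :=
    integrable_one_add_norm (by simpa using hr)
  exact this.restrict

lemma tendsto_cut (p : Space n × ℝ) :
    Tendsto (fun k : ℕ => cut ((k : ℝ) + 1) p) atTop (𝓝 1) := by
  have h1 : Tendsto (fun k : ℕ => rsq p / ((k : ℝ) + 1) ^ 2) atTop (𝓝 0) := by
    refine Tendsto.div_atTop tendsto_const_nhds ?_
    exact (tendsto_pow_atTop (by norm_num)).comp
      (tendsto_atTop_add_const_right _ _ tendsto_natCast_atTop_atTop)
  have h2 := (continuous_zeta.tendsto 0).comp h1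
  have h3 : zeta 0 = 1 := by simp [zeta]
  rw [h3] at h2
  exact h2

section BoundedSupport

variable {h : Space n → ℝ} {M R ε : ℝ}

/-- The density is at most C z^(s-1) (1 + |p|)^(-2(n+s)), and z^(s-1) ≤ ε^(s-1). Integrability on
ℝⁿ⁺¹ needs 2(n + s) > n + 1, which holds for n ≥ 1. -/
lemma integrable_dens_of_support (hn : 0 < n) (hs : 0 < s) (hs1 : s < 1)
    (hh : AEStronglyMeasurable h) (hb : ∀ x, |h x| ≤ M) (hR : 0 ≤ R)
    (hsupp : ∀ x, x ∉ closedBall (0 : Space n) R → h x = 0) (hε : 0 < ε) :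
    Integrable (dens s h) (hvol n ε) := by
  obtain ⟨C, hC, hC'⟩ := exists_norm_extD_le hs hb hR hsupp hε
  have h1n : (1 : ℝ) ≤ n := by exact_mod_cast hn
  have i := (integrable_one_add_norm_prod (n := n) (r := 2 * ((n : ℝ) + s)) (by linarith)
    ε).const_mul ((n + 1) * C ^ 2 * ε ^ (s - 1))
  refine i.mono' (((continuousOn_dens hs hh hb).mono fun p hp =>
    show 0 < p.2 from hε.trans hp).aestronglyMeasurable (measurableSet_gt ε)) ?_
  filter_upwards [ae_hvol] with p hp
  have hp0 : 0 < p.2 := hε.trans hp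
  rw [Real.norm_of_nonneg (dens_nonneg hp0)]
  have h2 := hC' p (le_of_lt hp)
  have h3 := (le_abs_self _).trans (abs_gdot_le (extD s h p) (extD s h p))
  have h4 : p.2 ^ (s - 1) ≤ ε ^ (s - 1) :=
    Real.rpow_le_rpow_of_nonpos hε (le_of_lt hp) (by linarith)
  have h5 : (1 + ‖p‖) ^ (-(2 * ((n : ℝ) + s))) =
      (1 + ‖p‖) ^ (-((n : ℝ) + s)) * (1 + ‖p‖) ^ (-((n : ℝ) + s)) := by
    rw [← Real.rpow_add (by positivity)]; congr 1; ring
  set w := p.2 ^ (1 - s)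
  have hw : 0 ≤ w := Real.rpow_nonneg hp0.le _
  have hww : w * p.2 ^ (s - 1) = 1 := weight_cancel hp0
  have hp1 : 0 ≤ p.2 ^ (s - 1) := Real.rpow_nonneg hp0.le _
  calc dens s h p ≤ w * ((n + 1) * (‖extD s h p‖ * ‖extD s h p‖)) :=
        mul_le_mul_of_nonneg_left h3 hw
    _ = (n + 1) * p.2 ^ (s - 1) * ((w * ‖extD s h p‖) * (w * ‖extD s h p‖)) := by
        linear_combination (-((n + 1) * w * ‖extD s h p‖ ^ 2)) * hww
    _ ≤ (n + 1) * ε ^ (s - 1) * ((C * (1 + ‖p‖) ^ (-((n : ℝ) + s))) *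
          (C * (1 + ‖p‖) ^ (-((n : ℝ) + s)))) := by gcongr
    _ = _ := by rw [h5]; ring

lemma integrable_flux_of_support (hs : 0 < s)
    (hh : AEStronglyMeasurable h) (hb : ∀ x, |h x| ≤ M) (hR : 0 ≤ R)
    (hsupp : ∀ x, x ∉ closedBall (0 : Space n) R → h x = 0) (hε : 0 < ε) :
    Integrable (flux s h ε) := by
  obtain ⟨C, hC, hC'⟩ := exists_norm_extD_le hs hb hR hsupp hε
  have i : Integrable (fun x : Space n => C * (1 + ‖x‖) ^ (-((n : ℝ) + s))) :=
    (integrable_one_add_norm (by simp [hs])).const_mul C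
  have hcont : Continuous (flux s h ε) := by
    refine continuous_const.mul ?_
    have : Continuous fun x : Space n => extD s h (x, ε) := continuous_iff_continuousAt.2 fun x =>
      ContinuousAt.comp (f := fun x : Space n => (x, ε)) (continuousAt_extD hs hh hb (p := (x, ε)) hε)
        (by fun_prop)
    exact this.clm_apply continuous_const
  refine i.mono' hcont.aestronglyMeasurable (ae_of_all _ fun x => ?_)
  have h1 := hC' (x, ε) le_rfl
  have h2 : ‖flux s h ε x‖ ≤ ε ^ (1 - s) * ‖extD s h (x, ε)‖ := by
    rw [flux, norm_mul, Real.norm_of_nonneg (by positivity)]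
    refine mul_le_mul_of_nonneg_left ?_ (by positivity)
    simpa using (extD s h (x, ε)).le_opNorm_of_le norm_zero_prod_one
  refine h2.trans (h1.trans (mul_le_mul_of_nonneg_left ?_ hC))
  have hn : (0 : ℝ) ≤ n := by positivity
  refine Real.rpow_le_rpow_of_nonpos (by positivity) ?_ (by linarith)
  have : ‖x‖ ≤ ‖(x, ε)‖ := norm_fst_le (x, ε)
  linarith

/-- The energy identity for the extension of a function of bounded support. -/
lemma integral_dens_of_support (hn : 0 < n) (hs : 0 < s) (hs1 : s < 1)
    (hh : AEStronglyMeasurable h) (hb : ∀ x, |h x| ≤ M) (hR : 0 ≤ R)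
    (hsupp : ∀ x, x ∉ closedBall (0 : Space n) R → h x = 0) (hε : 0 < ε) :
    ∫ p, dens s h p ∂(hvol n ε) = -∫ x, flux s h ε x * ext s h (x, ε) := by
  have hM : 0 ≤ M := (abs_nonneg _).trans (hb 0)
  have hk := (kappa_pos (n := n) hs).le
  obtain ⟨C, hC, hC'⟩ := exists_norm_extD_le hs hb hR hsupp hε
  have iD := integrable_dens_of_support hn hs hs1 hh hb hR hsupp hε
  have iF := integrable_flux_of_support hs hh hb hR hsupp hε
  have hρ : ∀ k : ℕ, (0 : ℝ) < (k : ℝ) + 1 := fun k => by positivity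
  have t1 : Tendsto (fun k : ℕ => ∫ p, dens s h p * cut ((k : ℝ) + 1) p ∂(hvol n ε)) atTop
      (𝓝 (∫ p, dens s h p ∂(hvol n ε))) := by
    refine tendsto_integral_of_dominated_convergence (dens s h)
      (fun k => (integrable_mul_cut (continuousOn_dens hs hh hb) (hρ k) hε).aestronglyMeasurable)
      iD (fun k => ?_) (ae_of_all _ fun p => ?_)
    · filter_upwards [ae_hvol] with p hp
      have := dens_nonneg (s := s) (g := h) (p := p) (hε.trans hp)
      rw [Real.norm_of_nonneg (mul_nonneg this (cut_nonneg _ _))]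
      exact mul_le_of_le_one_right this (cut_le_one _ _)
    · simpa using (tendsto_cut p).const_mul (dens s h p)
  have hext : ∀ x, |ext s h (x, ε)| ≤ M * kappa n s := fun x => abs_ext_le hs hb (p := (x, ε)) hε
  have cext : Continuous fun x : Space n => ext s h (x, ε) := continuous_iff_continuousAt.2
    fun x => (hasFDerivAt_slice_fst
      (hasFDerivAt_ext hs hh hb (p := (x, ε)) hε).differentiableAt).continuousAt
  have t2 : Tendsto (fun k : ℕ => ∫ x, flux s h ε x * (ext s h (x, ε) * cut ((k : ℝ) + 1) (x, ε)))
      atTop (𝓝 (∫ x, flux s h ε x * ext s h (x, ε))) := by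
    refine tendsto_integral_of_dominated_convergence (fun x => |flux s h ε x| * (M * kappa n s))
      (fun k => ?_) (iF.abs.mul_const _) (fun k => ae_of_all _ fun x => ?_)
      (ae_of_all _ fun x => ?_)
    · exact iF.aestronglyMeasurable.mul (cext.mul ((continuous_cut _).comp
        (continuous_id.prodMk continuous_const))).aestronglyMeasurable
    · rw [norm_mul, norm_mul, Real.norm_eq_abs, Real.norm_eq_abs,
        Real.norm_of_nonneg (cut_nonneg _ _)]
      refine mul_le_mul_of_nonneg_left ?_ (abs_nonneg _)
      exact (mul_le_of_le_one_right (abs_nonneg _) (cut_le_one _ _)).trans (hext x)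
    · simpa using ((tendsto_cut (x, ε)).const_mul (ext s h (x, ε))).const_mul (flux s h ε x)
  -- The error caused by the cutoff vanishes as its radius grows.
  have t3 : Tendsto (fun k : ℕ => ∫ p, p.2 ^ (1 - s) *
      (ext s h p * gdot (extD s h p) (cutD ((k : ℝ) + 1) p)) ∂(hvol n ε)) atTop (𝓝 0) := by
    have e0 : (0 : ℝ) = ∫ p : Space n × ℝ, (0 : ℝ) ∂(hvol n ε) := by simp
    rw [e0]
    -- The constant of `one_add_norm_le` for y = 0 and R = 0, in the shape in which that lemma
    -- states it.
    set A := 1 / ε + 1 + 0 / ε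
    have hA : 0 ≤ A := by positivity
    have bnd : ∀ (k : ℕ) (p : Space n × ℝ), ε < p.2 → ‖p.2 ^ (1 - s) *
        (ext s h p * gdot (extD s h p) (cutD ((k : ℝ) + 1) p))‖ ≤
        M * kappa n s * ((n + 1) * (C * (1 + ‖p‖) ^ (-((n : ℝ) + s)) *
          ‖cutD ((k : ℝ) + 1) p‖)) := by
      intro k p hp
      have hp0 : 0 < p.2 := hε.trans hp
      have hw : 0 ≤ p.2 ^ (1 - s) := Real.rpow_nonneg hp0.le _
      rw [norm_mul, norm_mul, Real.norm_of_nonneg hw, Real.norm_eq_abs, Real.norm_eq_abs]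
      calc _ ≤ p.2 ^ (1 - s) * (M * kappa n s *
            ((n + 1) * (‖extD s h p‖ * ‖cutD ((k : ℝ) + 1) p‖))) := by
            gcongr
            · exact abs_ext_le hs hb hp0
            · exact abs_gdot_le _ _
        _ = M * kappa n s * ((n + 1) * ((p.2 ^ (1 - s) * ‖extD s h p‖) *
              ‖cutD ((k : ℝ) + 1) p‖)) := by ring
        _ ≤ _ := by
            have := hC' p hp.le
            gcongr M * kappa n s * ((n + 1) * (?_ * _))
    refine tendsto_integral_of_dominated_convergence
      (fun p => M * kappa n s * (n + 1) * C * (8 * A) * (1 + ‖p‖) ^ (-((n : ℝ) + s + 1)))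
      (fun k => (integrable_gdot_cutD hs hh hb (hρ k) hε).aestronglyMeasurable)
      ((integrable_one_add_norm_prod (by linarith) ε).const_mul _) (fun k => ?_) ?_
    · filter_upwards [ae_hvol] with p hp
      refine (bnd k p hp).trans ?_
      -- On its support the gradient of the cutoff is at most 8|p|/ρ², hence O(1/|p|) uniformly in
      -- ρ. This supplies the extra power that makes the exponent n + s + 1 integrable on ℝⁿ⁺¹.
      have h1 : ‖cutD ((k : ℝ) + 1) p‖ ≤ 8 * A * (1 + ‖p‖)⁻¹ := by
        have hA1 : 1 + ‖p‖ ≤ A * √(rsq p) := by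
          have := one_add_norm_le (n := n) hε le_rfl (y := 0) (by simp) (p := p) (le_of_lt hp)
          have e : shift 0 p = p := by simp [shift]
          rwa [e] at this
        have hpos : 0 < 1 + ‖p‖ := by positivity
        rw [← div_eq_mul_inv, le_div_iff₀ hpos]
        rcases le_or_gt (((k : ℝ) + 1) ^ 2) (rsq p) with hk' | hk'
        · rw [cutD_eq_zero (hρ k) hk', norm_zero, zero_mul]; positivity
        · have h2 := norm_cutD_le (hρ k) p
          calc _ ≤ 8 * √(rsq p) / ((k : ℝ) + 1) ^ 2 * (A * √(rsq p)) := by gcongr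
            _ = 8 * A * (rsq p / ((k : ℝ) + 1) ^ 2) := by
                have := Real.mul_self_sqrt (rsq_nonneg p)
                rw [← mul_div_assoc, div_mul_eq_mul_div]
                congr 1
                linear_combination 8 * A * this
            _ ≤ 8 * A * 1 := by
                gcongr
                rw [div_le_one (by positivity)]
                exact hk'.le
            _ = _ := mul_one _
      have h2 : (1 + ‖p‖) ^ (-((n : ℝ) + s + 1)) =
          (1 + ‖p‖) ^ (-((n : ℝ) + s)) * (1 + ‖p‖)⁻¹ := by
        rw [← Real.rpow_neg_one, ← Real.rpow_add (by positivity)]; congr 1; ring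
      rw [h2]
      calc _ ≤ M * kappa n s * ((n + 1) * (C * (1 + ‖p‖) ^ (-((n : ℝ) + s)) *
            (8 * A * (1 + ‖p‖)⁻¹))) := by gcongr
        _ = _ := by ring
    · filter_upwards [ae_hvol] with p hp
      refine squeeze_zero_norm (fun k => bnd k p hp) ?_
      have h1 : Tendsto (fun k : ℕ => ‖cutD ((k : ℝ) + 1) p‖) atTop (𝓝 0) := by
        refine squeeze_zero (fun _ => norm_nonneg _) (fun k => norm_cutD_le (hρ k) p) ?_
        refine Tendsto.div_atTop tendsto_const_nhds ?_
        exact (tendsto_pow_atTop (by norm_num)).comp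
          (tendsto_atTop_add_const_right _ _ tendsto_natCast_atTop_atTop)
      have h2 := ((h1.const_mul (C * (1 + ‖p‖) ^ (-((n : ℝ) + s)))).const_mul
        ((n : ℝ) + 1)).const_mul (M * kappa n s)
      simpa using h2
  have e : ∀ k : ℕ, ∫ p, dens s h p * cut ((k : ℝ) + 1) p ∂(hvol n ε) =
      -(∫ x, flux s h ε x * (ext s h (x, ε) * cut ((k : ℝ) + 1) (x, ε))) -
      ∫ p, p.2 ^ (1 - s) * (ext s h p * gdot (extD s h p) (cutD ((k : ℝ) + 1) p)) ∂(hvol n ε) := by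
    intro k
    rw [← integral_cut_mul_energy hs hh hb (hρ k) hε, ← integral_sub]
    · congr 1
      ext p
      unfold dens
      ring
    · refine ((integrable_gdot_cutD hs hh hb (hρ k) hε).add
        (integrable_mul_cut (continuousOn_dens hs hh hb) (hρ k) hε)).congr (ae_of_all _ fun p => ?_)
      simp only [Pi.add_apply, dens]
      ring
    · exact integrable_gdot_cutD hs hh hb (hρ k) hε
  have t4 := (t2.neg).sub t3
  simp_rw [← e] at t4
  rw [sub_zero] at t4
  exact tendsto_nhds_unique t1 t4

end BoundedSupport

/-! ### The energy as a quadratic form in the characteristic function -/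

/-- The characteristic function of a set. -/
noncomputable def chi (E : Set (Space n)) : Space n → ℝ := E.indicator fun _ => 1

lemma chi_of_mem {E : Set (Space n)} {x : Space n} (h : x ∈ E) : chi E x = 1 :=
  Set.indicator_of_mem h _

lemma chi_of_notMem {E : Set (Space n)} {x : Space n} (h : x ∉ E) : chi E x = 0 :=
  Set.indicator_of_notMem h _

lemma abs_chi_le (E : Set (Space n)) (x : Space n) : |chi E x| ≤ 1 := by
  by_cases h : x ∈ E
  · simp [chi_of_mem h]
  · simp [chi_of_notMem h]

lemma chi_eq_zero_or_one (E : Set (Space n)) (x : Space n) : chi E x = 0 ∨ chi E x = 1 := by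
  by_cases h : x ∈ E
  · exact Or.inr (chi_of_mem h)
  · exact Or.inl (chi_of_notMem h)

lemma aestronglyMeasurable_chi {E : Set (Space n)} (hE : NullMeasurableSet E volume) :
    AEStronglyMeasurable (chi E) :=
  aestronglyMeasurable_const.indicator₀ hE

lemma measurable_kern_sub : Measurable fun p : Space n × Space n => kern s (p.1 - p.2) :=
  measurable_kern.comp (measurable_fst.sub measurable_snd)

lemma interaction_eq (A B : Set (Space n)) :
    interaction s A B = ∫⁻ x in A, ∫⁻ y in B, ENNReal.ofReal (kern s (x - y)) := rfl

lemma interaction_comm (A B : Set (Space n)) : interaction s A B = interaction s B A := by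
  rw [interaction_eq, interaction_eq, lintegral_lintegral_swap]
  · simp_rw [kern_sub_comm]
  · exact (measurable_kern_sub (s := s)).ennreal_ofReal.aemeasurable

lemma interaction_inter_add_diff_right (A B : Set (Space n)) {S : Set (Space n)}
    (hS : NullMeasurableSet S volume) :
    interaction s A (B ∩ S) + interaction s A (B \ S) = interaction s A B := by
  simp only [interaction_eq]
  rw [← lintegral_add_left]
  · refine lintegral_congr fun x => ?_
    rw [← lintegral_add_measure, Measure.restrict_inter_add_sdiff₀ B hS]
  · exact Measurable.lintegral_prod_right' (measurable_kern_sub (s := s)).ennreal_ofReal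

lemma interaction_mono {A A' B B' : Set (Space n)} (hA : A ⊆ A') (hB : B ⊆ B') :
    interaction s A B ≤ interaction s A' B' := by
  simp only [interaction_eq]
  exact lintegral_mono' (Measure.restrict_mono hA le_rfl)
    fun x => lintegral_mono' (Measure.restrict_mono hB le_rfl) le_rfl

lemma setLIntegral_congr_fun₀ {S : Set (Space n)} (hS : NullMeasurableSet S volume)
    {f g : Space n → ℝ≥0∞} (h : ∀ x ∈ S, f x = g x) : ∫⁻ x in S, f x = ∫⁻ x in S, g x :=
  lintegral_congr_ae <| by filter_upwards [ae_restrict_mem₀ hS] with x hx using h x hx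

/-- The nonlocal variation of the characteristic function of `E` over `X × Y`. -/
noncomputable def variation (s : ℝ) (E X Y : Set (Space n)) : ℝ≥0∞ :=
  ∫⁻ x in X, ∫⁻ y in Y, ENNReal.ofReal (|chi E x - chi E y| * kern s (x - y))

lemma variation_eq {E : Set (Space n)} (hE : NullMeasurableSet E volume) (X Y : Set (Space n))
    (hX : MeasurableSet X) (hY : MeasurableSet Y) :
    variation s E X Y = interaction s (X ∩ E) (Y \ E) + interaction s (X \ E) (Y ∩ E) := by
  have h1 : ∀ x, ∫⁻ y in Y, ENNReal.ofReal (|chi E x - chi E y| * kern s (x - y)) =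
      (∫⁻ y in Y ∩ E, ENNReal.ofReal (|chi E x - 1| * kern s (x - y))) +
      ∫⁻ y in Y \ E, ENNReal.ofReal (|chi E x| * kern s (x - y)) := by
    intro x
    rw [← Measure.restrict_inter_add_sdiff₀ Y hE, lintegral_add_measure]
    congr 1
    · refine setLIntegral_congr_fun₀ (hY.nullMeasurableSet.inter hE) fun y hy => ?_
      rw [chi_of_mem hy.2]
    · refine setLIntegral_congr_fun₀ (hY.nullMeasurableSet.diff hE) fun y hy => ?_
      rw [chi_of_notMem hy.2, sub_zero]
  rw [variation]
  simp_rw [h1]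
  rw [← Measure.restrict_inter_add_sdiff₀ X hE, lintegral_add_measure, interaction_eq,
    interaction_eq]
  congr 1
  · refine setLIntegral_congr_fun₀ (hX.nullMeasurableSet.inter hE) fun x hx => ?_
    simp [chi_of_mem hx.2]
  · refine setLIntegral_congr_fun₀ (hX.nullMeasurableSet.diff hE) fun x hx => ?_
    simp [chi_of_notMem hx.2]

/-- In the variation over Ω × Ω each unordered pair is counted twice, in J once; doubling J repairs
this without dividing in `ℝ≥0∞`. -/
lemma two_mul_energy {E Ω : Set (Space n)} (hE : NullMeasurableSet E volume)
    (hΩ : MeasurableSet Ω) :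
    2 * energy s Ω E = variation s E Ω Ω + 2 * variation s E Ω Ωᶜ := by
  have h1 := interaction_inter_add_diff_right (s := s) (E ∩ Ω) Eᶜ hΩ.nullMeasurableSet
  rw [energy, ← h1, variation_eq hE Ω Ω hΩ hΩ, variation_eq hE Ω Ωᶜ hΩ hΩ.compl]
  have e1 : Eᶜ ∩ Ω = Ω \ E := by rw [Set.inter_comm]; rfl
  have e2 : E ∩ Ω = Ω ∩ E := Set.inter_comm _ _
  have e3 : Eᶜ \ Ω = Ωᶜ \ E := by ext x; simp [and_comm]
  have e4 : E \ Ω = Ωᶜ ∩ E := by ext x; simp [and_comm]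
  rw [e1, e2, e3, e4, interaction_comm (Ω \ E) (Ω ∩ E), interaction_comm (Ωᶜ ∩ E)]
  ring

lemma aestronglyMeasurable_diff_kern {g : Space n → ℝ} (hg : AEStronglyMeasurable g)
    {μ ν : Measure (Space n)} [SFinite μ] [SFinite ν] (hμ : μ ≪ volume) (hν : ν ≪ volume) :
    AEStronglyMeasurable (fun p : Space n × Space n => |g p.1 - g p.2| * kern s (p.1 - p.2))
      (μ.prod ν) :=
  (((hg.mono_ac hμ).comp_fst.sub (hg.mono_ac hν).comp_snd).norm).mul
    (measurable_kern_sub (s := s)).aestronglyMeasurable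

lemma lintegral_diff_kern {E : Set (Space n)} (hE : NullMeasurableSet E volume)
    (X Y : Set (Space n)) :
    ∫⁻ p : Space n × Space n, ‖|chi E p.1 - chi E p.2| * kern s (p.1 - p.2)‖ₑ
      ∂((volume.restrict X).prod (volume.restrict Y)) = variation s E X Y := by
  rw [lintegral_prod _ (aestronglyMeasurable_diff_kern (aestronglyMeasurable_chi hE)
    Measure.restrict_le_self.absolutelyContinuous
    Measure.restrict_le_self.absolutelyContinuous).enorm]
  refine lintegral_congr fun x => lintegral_congr fun y => ?_
  rw [Real.enorm_eq_ofReal (mul_nonneg (abs_nonneg _) (kern_nonneg _))]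

lemma integrable_diff_kern_iff {E : Set (Space n)} (hE : NullMeasurableSet E volume)
    (X Y : Set (Space n)) :
    Integrable (fun p : Space n × Space n => |chi E p.1 - chi E p.2| * kern s (p.1 - p.2))
      ((volume.restrict X).prod (volume.restrict Y)) ↔ variation s E X Y ≠ ∞ := by
  rw [← lintegral_diff_kern hE, Integrable, and_iff_right, HasFiniteIntegral, lt_top_iff_ne_top]
  exact aestronglyMeasurable_diff_kern (aestronglyMeasurable_chi hE)
    Measure.restrict_le_self.absolutelyContinuous Measure.restrict_le_self.absolutelyContinuous

lemma variation_add_compl (E X : Set (Space n)) {Y : Set (Space n)} (hY : MeasurableSet Y)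
    (hE : NullMeasurableSet E volume) :
    variation s E X Set.univ = variation s E X Y + variation s E X Yᶜ := by
  rw [← lintegral_diff_kern hE, ← lintegral_diff_kern hE, ← lintegral_diff_kern hE,
    ← lintegral_add_measure, ← Measure.prod_add, Measure.restrict_add_restrict_compl hY,
    Measure.restrict_univ]

lemma finiteOn_chi_iff {E Ω : Set (Space n)} (hE : NullMeasurableSet E volume)
    (hΩ : MeasurableSet Ω) : FiniteOn s Ω (chi E) ↔ energy s Ω E ≠ ∞ := by
  have h1 := integrable_diff_kern_iff (s := s) hE Ω Set.univ
  rw [Measure.restrict_univ] at h1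
  rw [FiniteOn, h1, variation_add_compl E Ω hΩ hE]
  have h2 := two_mul_energy (s := s) hE hΩ
  constructor
  · intro h
    have h3 := ENNReal.add_ne_top.1 h
    have h4 : 2 * energy s Ω E ≠ ∞ := by
      rw [h2]; exact ENNReal.add_ne_top.2 ⟨h3.1, ENNReal.mul_ne_top (by simp) h3.2⟩
    intro h5
    rw [h5] at h4
    exact h4 (by simp)
  · intro h
    have h4 : 2 * energy s Ω E ≠ ∞ := ENNReal.mul_ne_top (by simp) h
    rw [h2, ENNReal.add_ne_top] at h4
    refine ENNReal.add_ne_top.2 ⟨h4.1, fun h5 => h4.2 ?_⟩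
    rw [h5]; simp

lemma FiniteOn.integrable_restrict {Ω : Set (Space n)} {g : Space n → ℝ} (h : FiniteOn s Ω g)
    (Y : Set (Space n)) :
    Integrable (fun p : Space n × Space n => |g p.1 - g p.2| * kern s (p.1 - p.2))
      ((volume.restrict Ω).prod (volume.restrict Y)) :=
  Integrable.mono_measure h (Measure.prod_mono le_rfl Measure.restrict_le_self)

lemma FiniteOn.sub {Ω : Set (Space n)} {f g : Space n → ℝ} (hf : FiniteOn s Ω f)
    (hg : FiniteOn s Ω g) (hfm : AEStronglyMeasurable f) (hgm : AEStronglyMeasurable g) :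
    FiniteOn s Ω fun x => f x - g x := by
  refine (Integrable.add hf hg).mono' (aestronglyMeasurable_diff_kern (hfm.sub hgm)
    Measure.restrict_le_self.absolutelyContinuous Measure.AbsolutelyContinuous.rfl)
    (ae_of_all _ fun p => ?_)
  rw [Real.norm_of_nonneg (mul_nonneg (abs_nonneg _) (kern_nonneg _)), Pi.add_apply, ← add_mul]
  refine mul_le_mul_of_nonneg_right ?_ (kern_nonneg _)
  have : f p.1 - g p.1 - (f p.2 - g p.2) = (f p.1 - f p.2) - (g p.1 - g p.2) := by ring
  rw [this]
  exact abs_sub _ _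

/-- Pairs in Ωᶜ × Ω reduce to Ω × Ωᶜ by symmetry, and pairs in Ωᶜ × Ωᶜ contribute nothing. -/
lemma FiniteOn.univ_of_support {Ω : Set (Space n)} (hΩ : MeasurableSet Ω) {h : Space n → ℝ}
    (hf : FiniteOn s Ω h) (hsupp : ∀ x, x ∉ Ω → h x = 0) : FiniteOn s Set.univ h := by
  have h1 : Integrable (fun p : Space n × Space n => |h p.1 - h p.2| * kern s (p.1 - p.2))
      ((volume.restrict Ωᶜ).prod (volume.restrict Ω)) := by
    have := (hf.integrable_restrict Ωᶜ).swap
    refine this.congr (ae_of_all _ fun p => ?_)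
    simp only [Function.comp, Prod.fst_swap, Prod.snd_swap]
    rw [abs_sub_comm, kern_sub_comm]
  have h2 : Integrable (fun p : Space n × Space n => |h p.1 - h p.2| * kern s (p.1 - p.2))
      ((volume.restrict Ωᶜ).prod (volume.restrict Ωᶜ)) := by
    refine (integrable_zero _ _ _).congr ?_
    rw [Measure.prod_restrict]
    filter_upwards [ae_restrict_mem (hΩ.compl.prod hΩ.compl)] with p hp
    rw [hsupp _ hp.1, hsupp _ hp.2]
    simp
  have h3 := h1.add_measure h2
  rw [← Measure.prod_add, Measure.restrict_add_restrict_compl hΩ] at h3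
  have h4 := Integrable.add_measure hf h3
  rw [← Measure.add_prod, Measure.restrict_add_restrict_compl hΩ] at h4
  rw [FiniteOn, Measure.restrict_univ]
  exact h4

lemma toReal_variation {E : Set (Space n)} (hE : NullMeasurableSet E volume)
    (X Y : Set (Space n)) :
    ∫ p : Space n × Space n, |chi E p.1 - chi E p.2| * kern s (p.1 - p.2)
      ∂((volume.restrict X).prod (volume.restrict Y)) = (variation s E X Y).toReal := by
  rw [← lintegral_diff_kern hE, integral_eq_lintegral_of_nonneg_ae]
  · congr 1
    refine lintegral_congr fun p => ?_
    rw [Real.enorm_eq_ofReal (mul_nonneg (abs_nonneg _) (kern_nonneg _))]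
  · exact ae_of_all _ fun p => mul_nonneg (abs_nonneg _) (kern_nonneg _)
  · exact aestronglyMeasurable_diff_kern (aestronglyMeasurable_chi hE)
      Measure.restrict_le_self.absolutelyContinuous Measure.restrict_le_self.absolutelyContinuous

/-- For functions with values 0 and 1 the L¹ and L² variations agree. This is what links the
perimeter to a Dirichlet energy. -/
lemma abs_chi_sub_eq (E : Set (Space n)) (x y : Space n) :
    |chi E x - chi E y| = (chi E x - chi E y) ^ 2 := by
  rcases chi_eq_zero_or_one E x with h | h <;> rcases chi_eq_zero_or_one E y with h' | h' <;>
    simp [h, h']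

/-- The first order form of the inequality `J(E) ≤ J(F)`. -/
lemma integral_diff_mul_kern_nonneg {E F Ω : Set (Space n)} (hE : NullMeasurableSet E volume)
    (hF : NullMeasurableSet F volume) (hΩ : MeasurableSet Ω)
    (hfE : FiniteOn s Ω (chi E)) (hfF : FiniteOn s Ω (chi F))
    (heq : ∀ x, x ∉ Ω → chi F x = chi E x) (hle : energy s Ω E ≤ energy s Ω F) :
    Integrable (fun p : Space n × Space n => (chi F p.1 - chi E p.1) *
      ((chi F p.1 - chi F p.2) + (chi E p.1 - chi E p.2)) * kern s (p.1 - p.2))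
      ((volume.restrict Ω).prod volume) ∧
    0 ≤ ∫ p : Space n × Space n, (chi F p.1 - chi E p.1) *
      ((chi F p.1 - chi F p.2) + (chi E p.1 - chi E p.2)) * kern s (p.1 - p.2)
      ∂((volume.restrict Ω).prod volume) := by
  set T : Space n × Space n → ℝ := fun p => (chi F p.1 - chi E p.1) *
      ((chi F p.1 - chi F p.2) + (chi E p.1 - chi E p.2)) * kern s (p.1 - p.2) with hT
  have mE := aestronglyMeasurable_chi hE
  have mF := aestronglyMeasurable_chi hF
  have acΩ : (volume.restrict Ω : Measure (Space n)) ≪ volume :=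
    Measure.restrict_le_self.absolutelyContinuous
  have iT : Integrable T ((volume.restrict Ω).prod volume) := by
    refine (Integrable.add hfF hfE).mono' ?_ (ae_of_all _ fun p => ?_)
    · refine AEStronglyMeasurable.mul (AEStronglyMeasurable.mul ?_ (AEStronglyMeasurable.add ?_ ?_))
        (measurable_kern_sub (s := s)).aestronglyMeasurable
      · exact ((mF.sub mE).mono_ac acΩ).comp_fst
      · exact (mF.mono_ac acΩ).comp_fst.sub mF.comp_snd
      · exact (mE.mono_ac acΩ).comp_fst.sub mE.comp_snd
    · rw [hT, norm_mul, norm_mul, Real.norm_of_nonneg (kern_nonneg _), Pi.add_apply, ← add_mul]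
      refine mul_le_mul_of_nonneg_right ?_ (kern_nonneg _)
      have h1 : ‖chi F p.1 - chi E p.1‖ ≤ 1 := by
        rcases chi_eq_zero_or_one F p.1 with h | h <;> rcases chi_eq_zero_or_one E p.1 with h' | h' <;>
          simp [h, h']
      calc _ ≤ 1 * ‖chi F p.1 - chi F p.2 + (chi E p.1 - chi E p.2)‖ := by gcongr
        _ ≤ _ := by rw [one_mul]; exact abs_add_le _ _
  refine ⟨iT, ?_⟩
  have i1 : Integrable T ((volume.restrict Ω).prod (volume.restrict Ω)) :=
    iT.mono_measure (Measure.prod_mono le_rfl Measure.restrict_le_self)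
  have i2 : Integrable T ((volume.restrict Ω).prod (volume.restrict Ωᶜ)) :=
    iT.mono_measure (Measure.prod_mono le_rfl Measure.restrict_le_self)
  have e0 : ∫ p, T p ∂((volume.restrict Ω).prod volume) =
      ∫ p, T p ∂((volume.restrict Ω).prod (volume.restrict Ω)) +
      ∫ p, T p ∂((volume.restrict Ω).prod (volume.restrict Ωᶜ)) := by
    rw [← integral_add_measure i1 i2, ← Measure.prod_add, Measure.restrict_add_restrict_compl hΩ]
  -- Off Ω the two functions have a common value c, and (f - e)(f + e - 2c) = (f - c)² - (e - c)².
  have eB : ∫ p, T p ∂((volume.restrict Ω).prod (volume.restrict Ωᶜ)) =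
      (variation s F Ω Ωᶜ).toReal - (variation s E Ω Ωᶜ).toReal := by
    rw [← toReal_variation hF, ← toReal_variation hE,
      ← integral_sub (hfF.integrable_restrict _) (hfE.integrable_restrict _)]
    refine integral_congr_ae ?_
    rw [Measure.prod_restrict]
    filter_upwards [ae_restrict_mem (hΩ.prod hΩ.compl)] with p hp
    simp only [hT]
    rw [abs_chi_sub_eq, abs_chi_sub_eq, heq _ hp.2]
    ring
  -- Adding the integrand with its variables swapped produces a difference of two squares.
  have eA : 2 * ∫ p, T p ∂((volume.restrict Ω).prod (volume.restrict Ω)) =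
      (variation s F Ω Ω).toReal - (variation s E Ω Ω).toReal := by
    have hsw := integral_prod_swap (μ := volume.restrict Ω) (ν := volume.restrict Ω) T
    rw [two_mul]
    nth_rewrite 1 [← hsw]
    have i1s : Integrable (fun p => T p.swap) ((volume.restrict Ω).prod (volume.restrict Ω)) :=
      i1.swap
    rw [← integral_add i1s i1, ← toReal_variation hF, ← toReal_variation hE,
      ← integral_sub (hfF.integrable_restrict _) (hfE.integrable_restrict _)]
    refine integral_congr_ae (ae_of_all _ fun p => ?_)
    simp only [hT, Prod.fst_swap, Prod.snd_swap]
    rw [abs_chi_sub_eq, abs_chi_sub_eq, kern_sub_comm p.2 p.1]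
    ring
  have nE : ∀ Y, variation s E Ω Y ≠ ∞ := fun Y =>
    (integrable_diff_kern_iff hE Ω Y).1 (hfE.integrable_restrict Y)
  have nF : ∀ Y, variation s F Ω Y ≠ ∞ := fun Y =>
    (integrable_diff_kern_iff hF Ω Y).1 (hfF.integrable_restrict Y)
  have h2 : variation s E Ω Ω + 2 * variation s E Ω Ωᶜ ≤
      variation s F Ω Ω + 2 * variation s F Ω Ωᶜ := by
    rw [← two_mul_energy hE hΩ, ← two_mul_energy hF hΩ]
    gcongr
  have n2 : ∀ {a : ℝ≥0∞}, a ≠ ∞ → 2 * a ≠ ∞ := fun h => ENNReal.mul_ne_top (by simp) h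
  have h3 := ENNReal.toReal_mono (ENNReal.add_ne_top.2 ⟨nF _, n2 (nF _)⟩) h2
  rw [ENNReal.toReal_add (nE _) (n2 (nE _)), ENNReal.toReal_add (nF _) (n2 (nF _)),
    ENNReal.toReal_mul, ENNReal.toReal_mul] at h3
  simp only [ENNReal.toReal_ofNat] at h3
  rw [e0, eB]
  linarith

lemma extD_sub (hs : 0 < s) {f g : Space n → ℝ} (hf : AEStronglyMeasurable f)
    (hg : AEStronglyMeasurable g) {M : ℝ} (hbf : ∀ x, |f x| ≤ M) (hbg : ∀ x, |g x| ≤ M)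
    {p : Space n × ℝ} (hp : 0 < p.2) :
    extD s (fun x => f x - g x) p = extD s f p - extD s g p := by
  unfold extD
  rw [← integral_sub (integrable_smul_pkerD_shift hs hf hbf hp)
    (integrable_smul_pkerD_shift hs hg hbg hp)]
  refine integral_congr_ae (ae_of_all _ fun y => ContinuousLinearMap.ext fun v => ?_)
  simp only [smul_apply, sub_apply, smul_eq_mul, sub_mul]

lemma IsTest.integrable_gdot {ε : ℝ} {φ : Space n × ℝ → ℝ} (h : IsTest ε φ) (hε : 0 < ε)
    {L : Space n × ℝ → Space n × ℝ →L[ℝ] ℝ} (hL : ContinuousOn L (upper n)) :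
    Integrable (fun p => p.2 ^ (1 - s) * gdot (L p) (fderiv ℝ φ p)) (hvol n ε) := by
  have hc : ∀ e : Space n × ℝ, ContinuousOn (fun p : Space n × ℝ => p.2 ^ (1 - s) * L p e)
      (upper n) := fun e => (continuousOn_weight _).mul (hL.clm_apply continuousOn_const)
  have := (integrable_finsetSum Finset.univ fun i _ =>
    h.integrable_mul_fderiv hε (hc (EuclideanSpace.single i 1, 0)) (EuclideanSpace.single i 1, 0)).add
    (h.integrable_mul_fderiv hε (hc (0, 1)) (0, 1))
  refine this.congr (ae_of_all _ fun p => ?_)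
  simp only [Pi.add_apply, gdot, mul_add, Finset.mul_sum, mul_assoc]

/-- Fubini turns the double integral into a pairing with the two fractional Laplacians. The second
alternative keeps integrability of the integrand out of the hypotheses; it is excluded where the
lemma is applied. -/
lemma integrable_mul_of_chi_sub {E F Ω : Set (Space n)}
    (hfE : FiniteOn s Ω (chi E)) (hfF : FiniteOn s Ω (chi F))
    (hE : NullMeasurableSet E volume) (hF : NullMeasurableSet F volume) :
    ∫ p : Space n × Space n, (chi F p.1 - chi E p.1) *
      ((chi F p.1 - chi F p.2) + (chi E p.1 - chi E p.2)) * kern s (p.1 - p.2)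
      ∂((volume.restrict Ω).prod volume) =
    -∫ x in Ω, (chi F x - chi E x) * (nlap s (chi F) x + nlap s (chi E) x) ∨
    ¬ Integrable (fun p : Space n × Space n => (chi F p.1 - chi E p.1) *
      ((chi F p.1 - chi F p.2) + (chi E p.1 - chi E p.2)) * kern s (p.1 - p.2))
      ((volume.restrict Ω).prod volume) := by
  by_cases hi : Integrable (fun p : Space n × Space n => (chi F p.1 - chi E p.1) *
      ((chi F p.1 - chi F p.2) + (chi E p.1 - chi E p.2)) * kern s (p.1 - p.2))
      ((volume.restrict Ω).prod volume)
  · left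
    rw [integral_prod _ hi, ← integral_neg]
    refine integral_congr_ae ?_
    have aux : ∀ {G : Set (Space n)} (x : Space n), NullMeasurableSet G volume →
        Integrable (fun y => |chi G x - chi G y| * kern s (x - y)) →
        Integrable (fun y => (chi G y - chi G x) * kern s (x - y)) := fun {G} x hG h => by
      refine h.mono' ?_ (ae_of_all _ fun y => ?_)
      · exact ((aestronglyMeasurable_chi hG).sub aestronglyMeasurable_const).mul
          (measurable_kern.comp (measurable_const.sub measurable_id)).aestronglyMeasurable
      · rw [norm_mul, Real.norm_of_nonneg (kern_nonneg _), Real.norm_eq_abs, abs_sub_comm]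
    filter_upwards [hfE.ae_integrable, hfF.ae_integrable] with x hxE hxF
    rw [nlap, nlap, ← integral_add (aux x hF hxF) (aux x hE hxE), ← mul_neg, ← integral_neg,
      ← integral_const_mul]
    congr 1
    ext y
    ring
  · exact Or.inr hi

/-! ### From minimality of the set to minimality of the extension -/

/-- The energy comparison for a competitor, transferred to the extension: if `E` has at most the
energy of `F` and `φ` is a perturbation of the extension of `E` with trace `χ_F - χ_E`, then the
local energy does not decrease under the perturbation. -/
lemma integral_perturbation_nonneg (hn : 0 < n) (hs : 0 < s) (hs1 : s < 1) {E F : Set (Space n)}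
    {ρ : ℝ} (hρ : 0 < ρ) (hE : NullMeasurableSet E volume) (hF : NullMeasurableSet F volume)
    (hfE : FiniteOn s (ball 0 ρ) (chi E)) (hfF : FiniteOn s (ball 0 ρ) (chi F))
    (heq : ∀ x, x ∉ ball (0 : Space n) ρ → chi F x = chi E x)
    (hle : energy s (ball 0 ρ) E ≤ energy s (ball 0 ρ) F)
    {φ : Space n × ℝ → ℝ} (hφ : ∀ ε, 0 < ε → IsTest ε φ)
    {M : ℝ} (hφb : ∀ p ∈ upper n, |φ p| ≤ M)
    (hφs : ∀ p ∈ upper n, p.1 ∉ ball (0 : Space n) ρ → φ p = 0)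
    (htr : ∀ᵐ x : Space n, Tendsto (fun ε => φ (x, ε)) (𝓝[>] 0)
      (𝓝 (kappa n s * (chi F x - chi E x))))
    (hint : Integrable (fun p => p.2 ^ (1 - s) * (2 * gdot (extD s (chi E) p) (fderiv ℝ φ p) +
      gdot (fderiv ℝ φ p) (fderiv ℝ φ p))) (hvol n 0)) :
    0 ≤ ∫ p, p.2 ^ (1 - s) * (2 * gdot (extD s (chi E) p) (fderiv ℝ φ p) +
      gdot (fderiv ℝ φ p) (fderiv ℝ φ p)) ∂(hvol n 0) := by
  set Ω := ball (0 : Space n) ρ with hΩ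
  have mΩ : MeasurableSet Ω := measurableSet_ball
  have mE := aestronglyMeasurable_chi hE
  have mF := aestronglyMeasurable_chi hF
  set h : Space n → ℝ := fun x => chi F x - chi E x with hh
  have mh : AEStronglyMeasurable h := mF.sub mE
  have bh : ∀ x, |h x| ≤ 1 := fun x => by
    rcases chi_eq_zero_or_one F x with h1 | h1 <;> rcases chi_eq_zero_or_one E x with h2 | h2 <;>
      simp [hh, h1, h2]
  have sh : ∀ x, x ∉ Ω → h x = 0 := fun x hx => by simp [hh, heq x hx]
  have sh' : ∀ x, x ∉ closedBall (0 : Space n) ρ → h x = 0 := fun x hx =>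
    sh x fun hx' => hx (ball_subset_closedBall hx')
  have fhΩ : FiniteOn s Ω h := hfF.sub hfE mF mE
  have fh : FiniteOn s Set.univ h := fhΩ.univ_of_support mΩ sh
  have aeh := fh.ae_integrable
  have inv := fh.integrable_nvar
  rw [Measure.restrict_univ] at aeh inv
  have hk := (kappa_pos (n := n) hs).le
  set Q : Space n × ℝ → ℝ := fun p => p.2 ^ (1 - s) * (2 * gdot (extD s (chi E) p) (fderiv ℝ φ p) +
      gdot (fderiv ℝ φ p) (fderiv ℝ φ p)) with hQ
  -- the inequality on `z > ε`
  have step1 : ∀ ε : ℝ, 0 < ε → -(2 * ∫ x in Ω, flux s (chi F) ε x * φ (x, ε)) +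
      ∫ x, flux s h ε x * ext s h (x, ε) ≤ ∫ p, Q p ∂(hvol n ε) := by
    intro ε hε
    have i1 : Integrable (fun p => p.2 ^ (1 - s) * gdot (extD s (chi F) p) (fderiv ℝ φ p))
        (hvol n ε) :=
      (hφ ε hε).integrable_gdot hε (continuousOn_extD hs mF (abs_chi_le F))
    have i2 := integrable_dens_of_support hn hs hs1 mh bh hρ.le sh' hε
    have i3 : Integrable Q (hvol n ε) := hint.mono_measure (hvol_mono hε.le)
    have e1 := integral_gdot_extD hs mF (abs_chi_le F) hε (hφ ε hε)
    have e2 := integral_dens_of_support hn hs hs1 mh bh hρ.le sh' hε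
    have e3 : ∫ x, flux s (chi F) ε x * φ (x, ε) = ∫ x in Ω, flux s (chi F) ε x * φ (x, ε) :=
      (setIntegral_eq_integral_of_forall_compl_eq_zero fun x hx => by
        rw [hφs (x, ε) hε hx, mul_zero]).symm
    have e4 : ∫ p, (2 * (p.2 ^ (1 - s) * gdot (extD s (chi F) p) (fderiv ℝ φ p)) -
        dens s h p) ∂(hvol n ε) = -(2 * ∫ x in Ω, flux s (chi F) ε x * φ (x, ε)) +
        ∫ x, flux s h ε x * ext s h (x, ε) := by
      rw [integral_sub (i1.const_mul 2) i2, integral_const_mul, e1, e2, e3]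
      ring
    rw [← e4]
    refine integral_mono_ae ((i1.const_mul 2).sub i2) i3 ?_
    filter_upwards [ae_hvol] with p hp
    have hp0 : 0 < p.2 := hε.trans hp
    -- The only loss in the argument: |∇φ|² ≥ 2∇h·∇φ - |∇h|², where h also denotes its extension.
    -- With ∇u_E + ∇h = ∇u_F, the equation for u_F and the energy identity for h reduce everything
    -- to integrals over z = ε.
    have y := two_mul_gdot_le (extD s h p) (fderiv ℝ φ p)
    have hd : extD s h p = extD s (chi F) p - extD s (chi E) p :=
      extD_sub hs mF mE (abs_chi_le F) (abs_chi_le E) hp0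
    have hw : 0 ≤ p.2 ^ (1 - s) := Real.rpow_nonneg hp0.le _
    have hg : gdot (extD s (chi F) p) (fderiv ℝ φ p) =
        gdot (extD s (chi E) p) (fderiv ℝ φ p) + gdot (extD s h p) (fderiv ℝ φ p) := by
      rw [hd, gdot_sub_left]; ring
    have := mul_le_mul_of_nonneg_left y hw
    simp only [hQ, dens]
    rw [hg]
    linarith
  -- the limits of the boundary terms
  have t1 : Tendsto (fun ε => ∫ x in Ω, flux s (chi F) ε x * φ (x, ε)) (𝓝[>] 0)
      (𝓝 (∫ x in Ω, (s * nlap s (chi F) x) * (kappa n s * h x))) := by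
    refine tendsto_integral_filter_of_dominated_convergence
      (fun x => ((s + 2 * (n + s)) * nvar s (chi F) x) * M) ?_ ?_
      ((hfF.integrable_nvar.const_mul _).mul_const _) ?_
    · filter_upwards [self_mem_nhdsWithin] with ε hε
      have c1 : Continuous fun x : Space n => φ (x, ε) := continuous_iff_continuousAt.2 fun x =>
        (hasFDerivAt_slice_fst ((hφ ε hε).diff (x, ε) hε)).continuousAt
      have c2 : Continuous fun x : Space n => flux s (chi F) ε x := by
        refine continuous_const.mul ?_
        have : Continuous fun x : Space n => extD s (chi F) (x, ε) :=
          continuous_iff_continuousAt.2 fun x =>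
            ContinuousAt.comp (f := fun x : Space n => (x, ε))
              (continuousAt_extD hs mF (abs_chi_le F) (p := (x, ε)) hε) (by fun_prop)
        exact this.clm_apply continuous_const
      exact (c2.mul c1).aestronglyMeasurable
    · filter_upwards [self_mem_nhdsWithin] with ε hε
      filter_upwards [hfF.ae_integrable] with x hx
      rw [norm_mul]
      exact mul_le_mul (abs_flux_le hs mF (abs_chi_le F) hε hx) (hφb (x, ε) hε) (norm_nonneg _)
        (mul_nonneg (by positivity) (nvar_nonneg _ x))
    · filter_upwards [hfF.ae_integrable, ae_restrict_of_ae htr] with x hx hx'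
      exact (tendsto_flux hs mF (abs_chi_le F) hx).mul hx'
  have t2 : Tendsto (fun ε => ∫ x, flux s h ε x * ext s h (x, ε)) (𝓝[>] 0)
      (𝓝 (∫ x, (s * nlap s h x) * (kappa n s * h x))) := by
    refine tendsto_integral_filter_of_dominated_convergence
      (fun x => ((s + 2 * (n + s)) * nvar s h x) * (1 * kappa n s)) ?_ ?_
      ((inv.const_mul _).mul_const _) ?_
    · filter_upwards [self_mem_nhdsWithin] with ε hε
      have c1 : Continuous fun x : Space n => ext s h (x, ε) := continuous_iff_continuousAt.2
        fun x => (hasFDerivAt_slice_fst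
          (hasFDerivAt_ext hs mh bh (p := (x, ε)) hε).differentiableAt).continuousAt
      exact (integrable_flux_of_support hs mh bh hρ.le sh' hε).aestronglyMeasurable.mul
        c1.aestronglyMeasurable
    · filter_upwards [self_mem_nhdsWithin] with ε hε
      filter_upwards [aeh] with x hx
      rw [norm_mul]
      exact mul_le_mul (abs_flux_le hs mh bh hε hx) (abs_ext_le hs bh (p := (x, ε)) hε)
        (norm_nonneg _) (mul_nonneg (by positivity) (nvar_nonneg _ x))
    · filter_upwards [aeh, ae_tendsto_ext hs mh bh] with x hx hx'
      refine (tendsto_flux hs mh bh hx).mul (hx' (fun _ => x) (fun ε => ε) 0 tendsto_id ?_)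
      exact Eventually.of_forall fun ε => by simp
  have t3 := (t1.const_mul 2).neg.add t2
  -- the limit is nonnegative
  have hlim : 0 ≤ -(2 * ∫ x in Ω, (s * nlap s (chi F) x) * (kappa n s * h x)) +
      ∫ x, (s * nlap s h x) * (kappa n s * h x) := by
    have e1 : ∫ x, (s * nlap s h x) * (kappa n s * h x) =
        ∫ x in Ω, (s * nlap s h x) * (kappa n s * h x) :=
      (setIntegral_eq_integral_of_forall_compl_eq_zero fun x hx => by
        rw [sh x hx, mul_zero, mul_zero]).symm
    have aux : ∀ {g : Space n → ℝ} (x : Space n), AEStronglyMeasurable g →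
        Integrable (fun y => |g x - g y| * kern s (x - y)) →
        Integrable (fun y => (g y - g x) * kern s (x - y)) := fun {g} x hG h => by
      refine h.mono' ?_ (ae_of_all _ fun y => ?_)
      · exact (hG.sub aestronglyMeasurable_const).mul
          (measurable_kern.comp (measurable_const.sub measurable_id)).aestronglyMeasurable
      · rw [norm_mul, Real.norm_of_nonneg (kern_nonneg _), Real.norm_eq_abs, abs_sub_comm]
    have e2 : ∀ᵐ x ∂(volume.restrict Ω), nlap s h x = nlap s (chi F) x - nlap s (chi E) x := by
      filter_upwards [hfE.ae_integrable, hfF.ae_integrable] with x hxE hxF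
      rw [nlap, nlap, nlap, ← integral_sub (aux x mF hxF) (aux x mE hxE)]
      congr 1
      ext y
      simp only [hh]
      ring
    have bnd : ∀ {g : Space n → ℝ} (x : Space n), |nlap s g x| ≤ nvar s g x := fun {g} x => by
      have := norm_integral_le_integral_norm (μ := volume) fun y => (g y - g x) * kern s (x - y)
      rw [Real.norm_eq_abs] at this
      refine this.trans (le_of_eq ?_)
      rw [nvar]
      congr 1
      ext y
      rw [norm_mul, Real.norm_of_nonneg (kern_nonneg _), Real.norm_eq_abs, abs_sub_comm]
    have il : ∀ {g : Space n → ℝ}, AEStronglyMeasurable g → FiniteOn s Ω g →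
        Integrable (fun x => (s * nlap s g x) * (kappa n s * h x)) (volume.restrict Ω) := by
      intro g mg hg
      refine ((hg.integrable_nvar.const_mul s).mul_const (kappa n s)).mono' ?_
        (ae_of_all _ fun x => ?_)
      · refine AEStronglyMeasurable.mul (AEStronglyMeasurable.const_mul ?_ _)
          ((mh.mono_measure Measure.restrict_le_self).const_mul _)
        refine AEStronglyMeasurable.integral_prod_right'
          (f := fun p : Space n × Space n => (g p.2 - g p.1) * kern s (p.1 - p.2)) ?_
        exact (mg.comp_snd.sub
          (mg.mono_ac Measure.restrict_le_self.absolutelyContinuous).comp_fst).mul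
          (measurable_kern_sub (s := s)).aestronglyMeasurable
      · rw [norm_mul, norm_mul, norm_mul, Real.norm_of_nonneg hs.le, Real.norm_of_nonneg hk]
        have := bnd (g := g) x
        have h0 := nvar_nonneg (s := s) g x
        calc _ ≤ s * nvar s g x * (kappa n s * 1) := by
              gcongr
              · exact this
              · exact bh x
          _ = _ := by ring
    obtain ⟨iT, hT⟩ := integral_diff_mul_kern_nonneg hE hF mΩ hfE hfF heq hle
    have e3 := (integrable_mul_of_chi_sub hfE hfF hE hF).resolve_right (not_not.2 iT)
    rw [e3] at hT
    -- By linearity of the fractional Laplacian, -2Lχ_F + L(χ_F - χ_E) = -(Lχ_F + Lχ_E), which is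
    -- the first order form of J(F) - J(E).
    have e4 : -(2 * ∫ x in Ω, (s * nlap s (chi F) x) * (kappa n s * h x)) +
        ∫ x in Ω, (s * nlap s h x) * (kappa n s * h x) =
        s * kappa n s * -∫ x in Ω, (chi F x - chi E x) * (nlap s (chi F) x + nlap s (chi E) x) := by
      have i2 : Integrable (fun x => -(2 * (s * nlap s (chi F) x * (kappa n s * h x))))
        (volume.restrict Ω) := ((il mF hfF).const_mul 2).neg
      rw [← integral_const_mul, ← integral_neg, ← integral_add i2 (il mh fhΩ), ← integral_neg,
        ← integral_const_mul]
      refine integral_congr_ae ?_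
      filter_upwards [e2] with x hx
      rw [hx]
      simp only [hh]
      ring
    rw [e1, e4]
    positivity
  have t4 : Tendsto (fun k : ℕ => ∫ p, Q p ∂(hvol n (1 / ((k : ℝ) + 1)))) atTop
      (𝓝 (∫ p, Q p ∂(hvol n 0))) := by
    have := (aecover_hvol (n := n)).integral_tendsto_of_countably_generated hint
    refine this.congr fun k => ?_
    rw [hvol_restrict_gt (by positivity)]
  have hk0 : Tendsto (fun k : ℕ => 1 / ((k : ℝ) + 1)) atTop (𝓝[>] 0) :=
    tendsto_nhdsWithin_iff.2 ⟨tendsto_one_div_add_atTop_nhds_zero_nat,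
      Eventually.of_forall fun k => by simp only [Set.mem_Ioi]; positivity⟩
  exact hlim.trans (le_of_tendsto_of_tendsto' (t3.comp hk0) t4 fun k => step1 _ (by positivity))

/-! ### Radial deformations of the half-space -/

/-- The dilation factor of the radial deformation. -/
noncomputable def dil (r t : ℝ) (p : Space n × ℝ) : ℝ := 1 + t * cut r p

/-- The radial deformation, a compactly supported perturbation of the identity. -/
noncomputable def radial (r t : ℝ) (p : Space n × ℝ) : Space n × ℝ := dil r t p • p

/-- The rank one part of the derivative of the radial deformation is `slope • rdot p`. -/
noncomputable def slope (r t : ℝ) (p : Space n × ℝ) : ℝ := t * (zetaD (rsq p / r ^ 2) * (2 / r ^ 2))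

/-- The derivative of the radial deformation. -/
noncomputable def radialD (r t : ℝ) (p : Space n × ℝ) : Space n × ℝ →L[ℝ] Space n × ℝ :=
  dil r t p • ContinuousLinearMap.id ℝ _ + (slope r t p • rdot p).smulRight p

lemma hasFDerivAt_cut_smul (r : ℝ) (p : Space n × ℝ) :
    HasFDerivAt (fun p => cut r p • p)
      (cut r p • ContinuousLinearMap.id ℝ _ + (cutD r p).smulRight p) p :=
  (hasFDerivAt_cut r p).smul (hasFDerivAt_id p)

lemma radial_eq (r t : ℝ) (p : Space n × ℝ) : radial r t p = p + t • (cut r p • p) := by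
  rw [radial, dil, add_smul, one_smul, smul_smul]

lemma hasFDerivAt_radial (r t : ℝ) (p : Space n × ℝ) :
    HasFDerivAt (radial r t) (radialD r t p) p := by
  have := (hasFDerivAt_id p).add ((hasFDerivAt_cut_smul r p).const_smul t)
  refine (this.congr_of_eventuallyEq (Eventually.of_forall fun q => ?_)).congr_fderiv ?_
  · simpa using radial_eq r t q
  · apply ContinuousLinearMap.ext
    intro h
    simp only [radialD, dil, slope, cutD, add_apply, smul_apply, ContinuousLinearMap.smulRight_apply,
      ContinuousLinearMap.id_apply, smul_eq_mul]
    module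

lemma norm_le_sqrt_rsq (p : Space n × ℝ) : ‖p‖ ≤ √(rsq p) := by
  rw [Prod.norm_def]
  exact max_le (Real.le_sqrt_of_sq_le (norm_sq_le_rsq p)) (Real.abs_le_sqrt (sq_le_rsq p))

/-- The constant is 1 from cut · id plus 8 from the rank one part, since |∇cut| ≤ 8/r where |p| ≤ r.
-/
lemma lipschitzWith_cut_smul {r : ℝ} (hr : 0 < r) :
    LipschitzWith 9 fun p : Space n × ℝ => cut r p • p := by
  refine lipschitzWith_of_nnnorm_fderiv_le (fun p => (hasFDerivAt_cut_smul r p).differentiableAt)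
    fun p => ?_
  rw [(hasFDerivAt_cut_smul r p).fderiv, ← NNReal.coe_le_coe, coe_nnnorm]
  have h1 : ‖cut r p • ContinuousLinearMap.id ℝ (Space n × ℝ)‖ ≤ 1 := by
    rw [norm_smul, Real.norm_of_nonneg (cut_nonneg r p)]
    exact mul_le_one₀ (cut_le_one r p) (norm_nonneg _) ContinuousLinearMap.norm_id_le
  have h2 : ‖(cutD r p).smulRight p‖ ≤ 8 := by
    rw [ContinuousLinearMap.norm_smulRight_apply]
    rcases le_or_gt (r ^ 2) (rsq p) with h | h
    · rw [cutD_eq_zero hr h]; simp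
    · have h3 : ‖p‖ ≤ r := (norm_le_sqrt_rsq p).trans (Real.sqrt_le_iff.2 ⟨hr.le, h.le⟩)
      calc _ ≤ 8 / r * r := by gcongr; exact norm_cutD_le' hr p
        _ = 8 := by field_simp
  refine (norm_add_le _ _).trans ((add_le_add h1 h2).trans (le_of_eq ?_))
  norm_num

/-- The bound 1/18 on t makes 9|t| ≤ 1/2, so the deformation is the identity up to a contraction.
Bijectivity and the two Lipschitz bounds with constant 2 follow. -/
lemma approximatesLinearOn_radial {r : ℝ} (hr : 0 < r) {t : ℝ} (ht : |t| ≤ 1 / 18) :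
    ApproximatesLinearOn (radial r t)
      ((ContinuousLinearEquiv.refl ℝ (Space n × ℝ) : Space n × ℝ →L[ℝ] Space n × ℝ))
      Set.univ (1 / 2) := by
  intro p _ q _
  have h := (lipschitzWith_cut_smul (n := n) hr).dist_le_mul p q
  rw [dist_eq_norm, dist_eq_norm] at h
  rw [radial_eq, radial_eq]
  have e : p + t • (cut r p • p) - (q + t • (cut r q • q)) -
      ((ContinuousLinearEquiv.refl ℝ (Space n × ℝ) : Space n × ℝ →L[ℝ] Space n × ℝ)) (p - q) =
      t • (cut r p • p - cut r q • q) := by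
    simp only [ContinuousLinearEquiv.coe_refl, ContinuousLinearMap.id_apply]
    module
  rw [e, norm_smul, Real.norm_eq_abs]
  calc _ ≤ 1 / 18 * (9 * ‖p - q‖) := by gcongr; exact h
    _ = _ := by push_cast; ring

lemma norm_refl_symm_lt : (1 / 2 : NNReal) <
    ‖((ContinuousLinearEquiv.refl ℝ (Space n × ℝ)).symm : Space n × ℝ →L[ℝ] Space n × ℝ)‖₊⁻¹ := by
  have : ‖((ContinuousLinearEquiv.refl ℝ (Space n × ℝ)).symm :
      Space n × ℝ →L[ℝ] Space n × ℝ)‖₊ = 1 := by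
    rw [ContinuousLinearEquiv.refl_symm, ContinuousLinearEquiv.coe_refl, ← NNReal.coe_inj, coe_nnnorm]
    exact ContinuousLinearMap.norm_id
  rw [this, inv_one]
  exact NNReal.half_lt_self one_ne_zero

lemma bijective_radial {r : ℝ} (hr : 0 < r) {t : ℝ} (ht : |t| ≤ 1 / 18) :
    Function.Bijective (radial r t : Space n × ℝ → Space n × ℝ) :=
  ⟨fun _ _ h => ((approximatesLinearOn_radial hr ht).injOn (Or.inr norm_refl_symm_lt))
      (Set.mem_univ _) (Set.mem_univ _) h,
    (approximatesLinearOn_radial hr ht).surjective (Or.inr norm_refl_symm_lt)⟩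

lemma dist_le_radial {r : ℝ} (hr : 0 < r) {t : ℝ} (ht : |t| ≤ 1 / 18) (p q : Space n × ℝ) :
    ‖p - q‖ ≤ 2 * ‖radial r t p - radial r t q‖ := by
  have h := approximatesLinearOn_radial hr ht p (Set.mem_univ _) q (Set.mem_univ _)
  simp only [ContinuousLinearEquiv.coe_refl, ContinuousLinearMap.id_apply] at h
  have h2 := norm_sub_norm_le (p - q) (radial r t p - radial r t q)
  rw [norm_sub_rev (p - q)] at h2
  push_cast at h
  linarith

lemma radial_dist_le {r : ℝ} (hr : 0 < r) {t : ℝ} (ht : |t| ≤ 1 / 18) (p q : Space n × ℝ) :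
    ‖radial r t p - radial r t q‖ ≤ 2 * ‖p - q‖ := by
  have h := approximatesLinearOn_radial hr ht p (Set.mem_univ _) q (Set.mem_univ _)
  simp only [ContinuousLinearEquiv.coe_refl, ContinuousLinearMap.id_apply] at h
  have h2 := norm_sub_norm_le (radial r t p - radial r t q) (p - q)
  have h3 := norm_nonneg (p - q)
  push_cast at h
  linarith

lemma abs_mul_cut_le (r : ℝ) {t : ℝ} (ht : |t| ≤ 1 / 18) (p : Space n × ℝ) :
    |t * cut r p| ≤ 1 / 18 := by
  rw [abs_mul, abs_of_nonneg (cut_nonneg r p)]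
  exact (mul_le_of_le_one_right (abs_nonneg t) (cut_le_one r p)).trans ht

lemma half_le_dil (r : ℝ) {t : ℝ} (ht : |t| ≤ 1 / 18) (p : Space n × ℝ) : 1 / 2 ≤ dil r t p := by
  have := abs_le.1 (abs_mul_cut_le r ht p)
  unfold dil
  linarith

lemma dil_pos (r : ℝ) {t : ℝ} (ht : |t| ≤ 1 / 18) (p : Space n × ℝ) : 0 < dil r t p := by
  have := half_le_dil r ht p
  linarith

lemma dil_le_two (r : ℝ) {t : ℝ} (ht : |t| ≤ 1 / 18) (p : Space n × ℝ) : dil r t p ≤ 2 := by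
  have := abs_le.1 (abs_mul_cut_le r ht p)
  unfold dil
  linarith

lemma abs_slope_mul_le {r : ℝ} (hr : 0 < r) {t : ℝ} (ht : |t| ≤ 1 / 18) (p : Space n × ℝ) :
    |slope r t p * rsq p| ≤ 1 / 4 := by
  rcases le_or_gt (r ^ 2) (rsq p) with h | h
  · rw [slope, zetaD_eq_zero ((one_le_div (by positivity)).2 h)]; norm_num
  · have h1 := abs_zetaD_le (div_nonneg (rsq_nonneg p) (sq_nonneg r))
    have h2 : rsq p / r ^ 2 ≤ 1 := (div_le_one (by positivity)).2 h.le
    have e : slope r t p * rsq p = 2 * (t * (zetaD (rsq p / r ^ 2) * (rsq p / r ^ 2))) := by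
      rw [slope]; field_simp
    rw [e, abs_mul, abs_mul, abs_mul, abs_of_nonneg (div_nonneg (rsq_nonneg p) (sq_nonneg r))]
    have h3 := div_nonneg (rsq_nonneg p) (sq_nonneg r)
    calc _ ≤ |(2 : ℝ)| * (1 / 18 * (2 * 1)) := by gcongr
      _ ≤ _ := by norm_num

lemma dil_add_slope_pos {r : ℝ} (hr : 0 < r) {t : ℝ} (ht : |t| ≤ 1 / 18) (p : Space n × ℝ) :
    1 / 4 ≤ dil r t p + slope r t p * rsq p := by
  have h1 := half_le_dil r ht p
  have h2 := abs_le.1 (abs_slope_mul_le hr ht p)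
  linarith

lemma dil_eq_one {r : ℝ} (hr : 0 < r) (t : ℝ) {p : Space n × ℝ} (h : r ^ 2 ≤ rsq p) :
    dil r t p = 1 := by
  rw [dil, cut_eq_zero hr h]; ring

lemma slope_eq_zero {r : ℝ} (hr : 0 < r) (t : ℝ) {p : Space n × ℝ} (h : r ^ 2 ≤ rsq p) :
    slope r t p = 0 := by
  rw [slope, zetaD_eq_zero ((one_le_div (by positivity)).2 h)]; ring

lemma radial_eq_self {r : ℝ} (hr : 0 < r) (t : ℝ) {p : Space n × ℝ} (h : r ^ 2 ≤ rsq p) :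
    radial r t p = p := by
  rw [radial, dil_eq_one hr t h, one_smul]

lemma radialD_eq_id {r : ℝ} (hr : 0 < r) (t : ℝ) {p : Space n × ℝ} (h : r ^ 2 ≤ rsq p) :
    radialD r t p = ContinuousLinearMap.id ℝ _ := by
  rw [radialD, dil_eq_one hr t h, slope_eq_zero hr t h, one_smul, zero_smul]
  ext <;> simp

/-- The derivative is a multiple of a transvection, hence of determinant θ^(n+1) (1 + σ|p|²/θ), with
θ the dilation factor and σ the slope. -/
lemma det_radialD (r : ℝ) {t : ℝ} (ht : |t| ≤ 1 / 18) (p : Space n × ℝ) :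
    (radialD r t p).det = dil r t p ^ n * (dil r t p + slope r t p * rsq p) := by
  have hθ := (dil_pos r ht p).ne'
  have e : (radialD r t p : Space n × ℝ →ₗ[ℝ] Space n × ℝ) = dil r t p •
      LinearMap.transvection (((dil r t p)⁻¹ * slope r t p) •
        (rdot p : Space n × ℝ →ₗ[ℝ] ℝ)) p := by
    apply LinearMap.ext
    intro h
    simp only [radialD, LinearMap.smul_apply, LinearMap.transvection.apply,
      ContinuousLinearMap.coe_coe, add_apply, smul_apply, ContinuousLinearMap.smulRight_apply,
      ContinuousLinearMap.id_apply, smul_eq_mul, smul_add, smul_smul]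
    congr 2
    field_simp
  rw [ContinuousLinearMap.det, e, LinearMap.det_smul, LinearMap.transvection.det]
  have hd : Module.finrank ℝ (Space n × ℝ) = n + 1 := by simp
  rw [hd]
  simp only [LinearMap.smul_apply, ContinuousLinearMap.coe_coe, smul_eq_mul, rdot_self]
  field_simp
  ring

lemma radial_snd (r t : ℝ) (p : Space n × ℝ) : (radial r t p).2 = dil r t p * p.2 := rfl

lemma radial_mem_upper {r t : ℝ} (ht : |t| ≤ 1 / 18) {p : Space n × ℝ} :
    radial r t p ∈ upper n ↔ p ∈ upper n := by
  simp only [upper, Set.mem_ofPred_eq, radial_snd]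
  exact mul_pos_iff_of_pos_left (dil_pos r ht p)

/-- The deformation is the identity outside the ball, so by injectivity no point of the ball can
leave it. -/
lemma rsq_radial_lt {r : ℝ} (hr : 0 < r) {t : ℝ} (ht : |t| ≤ 1 / 18) {p : Space n × ℝ} :
    rsq (radial r t p) < r ^ 2 ↔ rsq p < r ^ 2 := by
  rw [← not_le, ← not_le, not_iff_not]
  constructor
  · intro h
    have := (bijective_radial hr ht).1 (radial_eq_self hr t h)
    rwa [this] at h
  · intro h
    rwa [radial_eq_self hr t h]

/-- The open upper half ball. -/
def halfBall (n : ℕ) (r : ℝ) : Set (Space n × ℝ) := {p | 0 < p.2 ∧ rsq p < r ^ 2}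

lemma isOpen_halfBall (r : ℝ) : IsOpen (halfBall n r) :=
  (isOpen_lt continuous_const continuous_snd).inter (isOpen_lt continuous_rsq continuous_const)

lemma image_radial_halfBall {r : ℝ} (hr : 0 < r) {t : ℝ} (ht : |t| ≤ 1 / 18) :
    radial r t '' halfBall n r = halfBall n r := by
  ext p
  constructor
  · rintro ⟨q, hq, rfl⟩
    exact ⟨(radial_mem_upper ht).2 hq.1, (rsq_radial_lt hr ht).2 hq.2⟩
  · intro hp
    obtain ⟨q, rfl⟩ := (bijective_radial hr ht).2 p
    exact ⟨q, ⟨(radial_mem_upper ht).1 hp.1, (rsq_radial_lt hr ht).1 hp.2⟩, rfl⟩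

lemma norm_radialD_le {r : ℝ} (hr : 0 < r) {t : ℝ} (ht : |t| ≤ 1 / 18) (p : Space n × ℝ) :
    ‖radialD r t p‖ ≤ 2 := by
  have : LipschitzWith 2 (radial r t : Space n × ℝ → Space n × ℝ) :=
    LipschitzWith.of_dist_le_mul fun p q => by
      rw [dist_eq_norm, dist_eq_norm]; exact radial_dist_le hr ht p q
  have h := norm_fderiv_le_of_lipschitz ℝ this (x₀ := p)
  rw [(hasFDerivAt_radial r t p).fderiv] at h
  exact h

/-- The pullback under the radial deformation of a linear form. -/
lemma gdot_comp_radialD (r t : ℝ) (p : Space n × ℝ) (L : Space n × ℝ →L[ℝ] ℝ) :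
    gdot (L.comp (radialD r t p)) (L.comp (radialD r t p)) = dil r t p ^ 2 * gdot L L +
      (2 * dil r t p * slope r t p + slope r t p ^ 2 * rsq p) * (L p) ^ 2 := by
  have e : L.comp (radialD r t p) = dil r t p • L + (slope r t p * L p) • rdot p := by
    apply ContinuousLinearMap.ext
    intro h
    simp only [radialD, ContinuousLinearMap.comp_apply, add_apply, smul_apply, map_add, map_smul,
      ContinuousLinearMap.smulRight_apply, ContinuousLinearMap.id_apply, smul_eq_mul]
    ring
  rw [e, gdot_add_left, gdot_add_right, gdot_add_right]
  simp only [gdot_smul_left, gdot_smul_right, gdot_rdot, gdot_comm L (rdot p), rdot_self]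
  ring

/-- The trace of the radial deformation on the boundary of the half space. -/
noncomputable def base (r t : ℝ) (x : Space n) : Space n := dil r t (x, (0 : ℝ)) • x

lemma radial_zero (r t : ℝ) (x : Space n) : radial r t (x, 0) = (base r t x, 0) := by
  simp [radial, base]

lemma dist_le_base {r : ℝ} (hr : 0 < r) {t : ℝ} (ht : |t| ≤ 1 / 18) (x y : Space n) :
    ‖x - y‖ ≤ 2 * ‖base r t x - base r t y‖ := by
  have := dist_le_radial hr ht (x, (0 : ℝ)) (y, 0)
  simpa [radial_zero, Prod.norm_def] using this

lemma base_dist_le {r : ℝ} (hr : 0 < r) {t : ℝ} (ht : |t| ≤ 1 / 18) (x y : Space n) :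
    ‖base r t x - base r t y‖ ≤ 2 * ‖x - y‖ := by
  have := radial_dist_le hr ht (x, (0 : ℝ)) (y, 0)
  simpa [radial_zero, Prod.norm_def] using this

lemma base_eq_self {r ρ : ℝ} (hr : 0 < r) (hrρ : r ≤ ρ) (t : ℝ) {x : Space n}
    (hx : x ∉ ball (0 : Space n) ρ) : base r t x = x := by
  rw [mem_ball_zero_iff, not_lt] at hx
  have : r ^ 2 ≤ rsq (x, (0 : ℝ)) := by
    simp only [rsq]
    have := pow_le_pow_left₀ hr.le (hrρ.trans hx) 2
    simpa using this
  rw [base, dil_eq_one hr t this, one_smul]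

lemma base_mem_ball {r ρ : ℝ} (hr : 0 < r) (hrρ : r ≤ ρ) {t : ℝ} (ht : |t| ≤ 1 / 18)
    {x : Space n} (h : x ∈ ball (0 : Space n) ρ) : base r t x ∈ ball (0 : Space n) ρ := by
  by_contra h'
  have h1 := base_eq_self hr hrρ t h'
  have h2 := dist_le_base hr ht (base r t x) x
  rw [h1, sub_self, norm_zero, mul_zero, norm_le_zero_iff, sub_eq_zero] at h2
  rw [h2] at h'
  exact h' h

lemma continuous_base {r : ℝ} (hr : 0 < r) {t : ℝ} (ht : |t| ≤ 1 / 18) :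
    Continuous (base r t : Space n → Space n) :=
  (LipschitzWith.of_dist_le_mul (K := 2) fun p q => by
    rw [dist_eq_norm, dist_eq_norm]; exact base_dist_le hr ht p q).continuous

/-- Lebesgue measure is a multiple of n-dimensional Hausdorff measure, and preimages under a map
with ‖x - y‖ ≤ 2 ‖f x - f y‖ grow by a factor of at most 2^n. No Jacobian of the boundary map is
needed. -/
lemma volume_preimage_base_le {r : ℝ} (hr : 0 < r) {t : ℝ} (ht : |t| ≤ 1 / 18)
    (A : Set (Space n)) : volume (base r t ⁻¹' A) ≤ 2 ^ n * volume A := by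
  have h1 : (volume : Measure (Space n)) =
      Measure.addHaarScalarFactor volume (μH[n] : Measure (Space n)) • μH[n] := by
    have : (μH[n] : Measure (Space n)).IsAddHaarMeasure := by
      have := isAddHaarMeasure_hausdorffMeasure (E := Space n)
      rwa [finrank_euclideanSpace_fin] at this
    exact Measure.isAddLeftInvariant_eq_smul _ _
  have h2 : AntilipschitzWith 2 (base r t : Space n → Space n) :=
    AntilipschitzWith.of_le_mul_dist fun p q => by
      rw [dist_eq_norm, dist_eq_norm]; exact dist_le_base hr ht p q
  have h3 := h2.hausdorffMeasure_preimage_le (d := n) (Nat.cast_nonneg n) A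
  rw [h1, Measure.smul_apply, Measure.smul_apply, mul_smul_comm]
  gcongr
  simpa using h3

lemma map_base_le {r : ℝ} (hr : 0 < r) {t : ℝ} (ht : |t| ≤ 1 / 18) :
    Measure.map (base r t) (volume : Measure (Space n)) ≤ (2 : ℝ≥0∞) ^ n • volume := by
  refine Measure.le_iff.2 fun A hA => ?_
  rw [Measure.map_apply (continuous_base hr ht).measurable hA]
  exact volume_preimage_base_le hr ht A

lemma quasiMeasurePreserving_base {r : ℝ} (hr : 0 < r) {t : ℝ} (ht : |t| ≤ 1 / 18) :
    Measure.QuasiMeasurePreserving (base r t : Space n → Space n) volume volume :=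
  ⟨(continuous_base hr ht).measurable,
    (map_base_le hr ht).absolutelyContinuous.trans Measure.smul_absolutelyContinuous⟩

lemma map_restrict_base_le {r ρ : ℝ} (hr : 0 < r) (hrρ : r ≤ ρ) {t : ℝ} (ht : |t| ≤ 1 / 18) :
    Measure.map (base r t) (volume.restrict (ball (0 : Space n) ρ)) ≤
      (2 : ℝ≥0∞) ^ n • volume.restrict (ball (0 : Space n) ρ) := by
  refine Measure.le_iff.2 fun A hA => ?_
  have hm := (continuous_base (n := n) hr ht).measurable
  rw [Measure.map_apply hm hA, Measure.restrict_apply (hm hA), Measure.smul_apply,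
    Measure.restrict_apply hA]
  refine (measure_mono ?_).trans (volume_preimage_base_le hr ht _)
  exact fun x hx => ⟨hx.1, base_mem_ball hr hrρ ht hx.2⟩

lemma kern_le_kern_base (hs : 0 < s) {r : ℝ} (hr : 0 < r) {t : ℝ} (ht : |t| ≤ 1 / 18)
    (x y : Space n) : kern s (x - y) ≤ 2 ^ ((n : ℝ) + s) * kern s (base r t x - base r t y) := by
  have hns : 0 < (n : ℝ) + s := by positivity
  rcases eq_or_ne x y with rfl | h
  -- On the diagonal both kernels take the default value `1 / 0 = 0`.
  · simp [kern, Real.zero_rpow hns.ne']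
  · have h1 : 0 < ‖x - y‖ := norm_pos_iff.2 (sub_ne_zero.2 h)
    have h2 : 0 < ‖base r t x - base r t y‖ := by linarith [dist_le_base hr ht x y]
    rw [kern, kern, mul_one_div, div_le_div_iff₀ (by positivity) (by positivity), one_mul,
      ← Real.mul_rpow (by norm_num) h1.le]
    exact Real.rpow_le_rpow h2.le (base_dist_le hr ht x y) hns.le

lemma chi_preimage {E : Set (Space n)} (f : Space n → Space n) (x : Space n) :
    chi (f ⁻¹' E) x = chi E (f x) := rfl

/-- The competitor has finite energy: the kernel changes by a bounded factor and the pushforward of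
Lebesgue measure is at most 2^n times itself. -/
lemma finiteOn_preimage_base (hs : 0 < s) {r ρ : ℝ} (hr : 0 < r) (hrρ : r ≤ ρ) {t : ℝ}
    (ht : |t| ≤ 1 / 18) {E : Set (Space n)} (hE : NullMeasurableSet E volume)
    (hf : FiniteOn s (ball 0 ρ) (chi E)) : FiniteOn s (ball 0 ρ) (chi (base r t ⁻¹' E)) := by
  have hb := (continuous_base (n := n) hr ht).measurable
  have hEF : NullMeasurableSet (base r t ⁻¹' E) volume :=
    hE.preimage (quasiMeasurePreserving_base hr ht)
  have h1 : Measure.map (Prod.map (base r t) (base r t))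
      ((volume.restrict (ball (0 : Space n) ρ)).prod (volume : Measure (Space n))) ≤
      ((2 : ℝ≥0∞) ^ n • volume.restrict (ball (0 : Space n) ρ)).prod ((2 : ℝ≥0∞) ^ n • volume) := by
    rw [← Measure.map_prod_map _ _ hb hb]
    exact Measure.prod_mono (map_restrict_base_le hr hrρ ht) (map_base_le hr ht)
  have h2 : Integrable (fun p : Space n × Space n => |chi E p.1 - chi E p.2| * kern s (p.1 - p.2))
      (((2 : ℝ≥0∞) ^ n • volume.restrict (ball (0 : Space n) ρ)).prod
        ((2 : ℝ≥0∞) ^ n • volume)) := by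
    rw [Measure.prod_smul_left, Measure.prod_smul_right]
    exact (Integrable.smul_measure (Integrable.smul_measure hf (by simp)) (by simp))
  have h3 := (h2.mono_measure h1).comp_measurable (hb.prodMap hb)
  refine (h3.const_mul (2 ^ ((n : ℝ) + s))).mono' ?_ (ae_of_all _ fun p => ?_)
  · exact aestronglyMeasurable_diff_kern (aestronglyMeasurable_chi hEF)
      Measure.restrict_le_self.absolutelyContinuous Measure.AbsolutelyContinuous.rfl
  · rw [Real.norm_of_nonneg (mul_nonneg (abs_nonneg _) (kern_nonneg _)), chi_preimage, chi_preimage]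
    have := mul_le_mul_of_nonneg_left (kern_le_kern_base hs hr ht p.1 p.2)
      (abs_nonneg (chi E (base r t p.1) - chi E (base r t p.2)))
    simp only [Function.comp, Prod.map_fst, Prod.map_snd]
    linarith

/-! ### Inner variations of the extension -/

/-- The derivative of the deformed extension. -/
noncomputable def pullD (s : ℝ) (g : Space n → ℝ) (r t : ℝ) (p : Space n × ℝ) :
    Space n × ℝ →L[ℝ] ℝ := (extD s g (radial r t p)).comp (radialD r t p)

lemma hasFDerivAt_ext_radial (hs : 0 < s) {g : Space n → ℝ} (hg : AEStronglyMeasurable g) {M : ℝ}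
    (hb : ∀ x, |g x| ≤ M) (r : ℝ) {t : ℝ} (ht : |t| ≤ 1 / 18) {p : Space n × ℝ}
    (hp : p ∈ upper n) :
    HasFDerivAt (fun p => ext s g (radial r t p) - ext s g p) (pullD s g r t p - extD s g p) p :=
  ((hasFDerivAt_ext hs hg hb ((radial_mem_upper ht).2 hp)).comp p
    (hasFDerivAt_radial r t p)).sub (hasFDerivAt_ext hs hg hb hp)

lemma isTest_ext_radial (hs : 0 < s) {g : Space n → ℝ} (hg : AEStronglyMeasurable g) {M : ℝ}
    (hb : ∀ x, |g x| ≤ M) {r : ℝ} (hr : 0 < r) {t : ℝ} (ht : |t| ≤ 1 / 18) {ε : ℝ} (hε : 0 < ε) :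
    IsTest ε fun p => ext s g (radial r t p) - ext s g p where
  diff p hp := (hasFDerivAt_ext_radial hs hg hb r ht hp).differentiableAt
  supp := ⟨r ^ 2, fun p _ hpR => by rw [radial_eq_self hr t hpR.le, sub_self]⟩
  bound := ⟨M * kappa n s + M * kappa n s, fun p hp => by
    have hp' : p ∈ upper n := hε.trans_le hp
    exact (abs_sub _ _).trans (add_le_add (abs_ext_le hs hb ((radial_mem_upper ht).2 hp'))
      (abs_ext_le hs hb hp'))⟩
  bound_fderiv := by
    have hM : 0 ≤ M := (abs_nonneg _).trans (hb 0)
    have hk := (kappa_pos (n := n) hs).le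
    set A := M * (s + 2 * (n + s)) * kappa n s with hA
    have hA0 : 0 ≤ A := by positivity
    refine ⟨A / (ε / 2) * 2 + A / ε, fun p hp => ?_⟩
    have hp' : p ∈ upper n := hε.trans_le hp
    have hq : ε / 2 ≤ (radial r t p).2 := by
      rw [radial_snd]
      have := half_le_dil r ht p
      nlinarith
    rw [(hasFDerivAt_ext_radial hs hg hb r ht hp').fderiv]
    refine (norm_sub_le _ _).trans (add_le_add ?_ ?_)
    · refine (ContinuousLinearMap.opNorm_comp_le _ _).trans ?_
      gcongr
      · refine (norm_extD_le hs hb ((radial_mem_upper ht).2 hp')).trans ?_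
        gcongr
      · exact norm_radialD_le hr ht p
    · refine (norm_extD_le hs hb hp').trans ?_
      gcongr

/-- The deformation sends (x, ε) to height θε ≥ ε/2, within 2ε ≤ 4θε of `base r t x`. The approach
to that point is therefore nontangential, and almost every x is mapped to a good point. -/
lemma ae_tendsto_ext_radial (hs : 0 < s) {g : Space n → ℝ} (hg : AEStronglyMeasurable g) {M : ℝ}
    (hb : ∀ x, |g x| ≤ M) {r : ℝ} (hr : 0 < r) {t : ℝ} (ht : |t| ≤ 1 / 18) :
    ∀ᵐ x : Space n, Tendsto (fun ε => ext s g (radial r t (x, ε)) - ext s g (x, ε)) (𝓝[>] 0)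
      (𝓝 (kappa n s * (g (base r t x) - g x))) := by
  have h1 := ae_tendsto_ext hs hg hb
  filter_upwards [h1, (quasiMeasurePreserving_base hr ht).ae h1] with x hx hx'
  rw [mul_sub]
  refine Tendsto.sub ?_ (hx (fun _ => x) (fun ε => ε) 0 tendsto_id
    (Eventually.of_forall fun ε => by simp))
  have hpos : ∀ᶠ ε in 𝓝[>] (0 : ℝ), 0 < ε := self_mem_nhdsWithin
  refine hx' (fun ε => dil r t (x, ε) • x) (fun ε => dil r t (x, ε) * ε) 4 ?_ ?_
  · refine tendsto_nhdsWithin_iff.2 ⟨?_, ?_⟩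
    · have : Tendsto (fun ε : ℝ => 2 * ε) (𝓝[>] 0) (𝓝 0) := by
        have := (by fun_prop : Continuous fun ε : ℝ => 2 * ε).tendsto 0
        rw [mul_zero] at this
        exact this.mono_left nhdsWithin_le_nhds
      refine squeeze_zero' ?_ ?_ this
      · filter_upwards [hpos] with ε hε
        exact mul_nonneg (dil_pos r ht _).le hε.le
      · filter_upwards [hpos] with ε hε
        exact mul_le_mul_of_nonneg_right (dil_le_two r ht _) hε.le
    · filter_upwards [hpos] with ε hε
      exact mul_pos (dil_pos r ht _) hε
  · filter_upwards [hpos] with ε hε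
    have h2 := radial_dist_le hr ht (x, ε) (x, 0)
    rw [radial_zero] at h2
    have h3 : ‖((x, ε) : Space n × ℝ) - (x, 0)‖ = ε := by
      simp [Prod.norm_def, abs_of_pos hε, hε.le]
    have h4 : ‖dil r t (x, ε) • x - base r t x‖ ≤ ‖radial r t (x, ε) - (base r t x, 0)‖ :=
      norm_fst_le (radial r t (x, ε) - (base r t x, 0))
    have h5 := half_le_dil r ht (x, ε)
    rw [h3] at h2
    nlinarith

lemma gdot_pullD_sub (g : Space n → ℝ) (r t : ℝ) (p : Space n × ℝ) :
    2 * gdot (extD s g p) (pullD s g r t p - extD s g p) +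
      gdot (pullD s g r t p - extD s g p) (pullD s g r t p - extD s g p) =
    gdot (pullD s g r t p) (pullD s g r t p) - gdot (extD s g p) (extD s g p) := by
  rw [gdot_sub_left, gdot_sub_right, gdot_sub_right, gdot_comm (extD s g p) (pullD s g r t p)]
  ring

/-- Inner variations do not decrease the energy of the extension of a minimizer. -/
lemma integral_radial_variation_nonneg (hn : 0 < n) (hs : 0 < s) (hs1 : s < 1) {E : Set (Space n)}
    {ρ : ℝ} (hE : IsMinimizer s (ball 0 ρ) E) (hfin : energy s (ball 0 ρ) E ≠ ∞)
    {r : ℝ} (hr : 0 < r) (hrρ : r ≤ ρ) {t : ℝ} (ht : |t| ≤ 1 / 18)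
    (hint : Integrable (fun p => p.2 ^ (1 - s) * (gdot (pullD s (chi E) r t p)
      (pullD s (chi E) r t p) - gdot (extD s (chi E) p) (extD s (chi E) p))) (hvol n 0)) :
    0 ≤ ∫ p, p.2 ^ (1 - s) * (gdot (pullD s (chi E) r t p)
      (pullD s (chi E) r t p) - gdot (extD s (chi E) p) (extD s (chi E) p)) ∂(hvol n 0) := by
  have hEm := hE.nullMeasurableSet
  have hg := aestronglyMeasurable_chi hEm
  have hb := abs_chi_le E
  have hk := (kappa_pos (n := n) hs).le
  have hF : NullMeasurableSet (base r t ⁻¹' E) volume :=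
    hEm.preimage (quasiMeasurePreserving_base hr ht)
  have hfE := (finiteOn_chi_iff hEm measurableSet_ball).2 hfin
  have hfF := finiteOn_preimage_base hs hr hrρ ht hEm hfE
  have hcong : (fun p => p.2 ^ (1 - s) * (2 * gdot (extD s (chi E) p)
      (fderiv ℝ (fun p => ext s (chi E) (radial r t p) - ext s (chi E) p) p) +
      gdot (fderiv ℝ (fun p => ext s (chi E) (radial r t p) - ext s (chi E) p) p)
        (fderiv ℝ (fun p => ext s (chi E) (radial r t p) - ext s (chi E) p) p))) =ᵐ[hvol n 0]
      fun p => p.2 ^ (1 - s) * (gdot (pullD s (chi E) r t p)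
      (pullD s (chi E) r t p) - gdot (extD s (chi E) p) (extD s (chi E) p)) := by
    filter_upwards [ae_hvol] with p hp
    rw [(hasFDerivAt_ext_radial hs hg hb r ht hp).fderiv, gdot_pullD_sub]
  rw [← integral_congr_ae hcong]
  -- The competitor is the preimage of E under the boundary map, whose characteristic function is
  -- the trace of the deformed extension up to the factor κ.
  refine integral_perturbation_nonneg hn hs hs1 (F := base r t ⁻¹' E) (hr.trans_le hrρ) hEm hF
    hfE hfF (fun x hx => ?_) (hE.energy_le _ hF ?_)
    (fun ε hε => isTest_ext_radial hs hg hb hr ht hε) (M := 1 * kappa n s + 1 * kappa n s)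
    (fun p hp => ?_) (fun p hp hpρ => ?_) (ae_tendsto_ext_radial hs hg hb hr ht)
    (hint.congr hcong.symm)
  · rw [chi_preimage, base_eq_self hr hrρ t hx]
  · ext x
    simp only [Set.mem_inter_iff, Set.mem_preimage, Set.mem_compl_iff, and_congr_left_iff]
    intro hx
    rw [base_eq_self hr hrρ t hx]
  · exact (abs_sub _ _).trans (add_le_add (abs_ext_le hs hb ((radial_mem_upper ht).2 hp))
      (abs_ext_le hs hb hp))
  · have : r ^ 2 ≤ rsq p := by
      rw [mem_ball_zero_iff, not_lt] at hpρ
      exact (pow_le_pow_left₀ hr.le (hrρ.trans hpρ) 2).trans (norm_sq_le_rsq p)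
    rw [radial_eq_self hr t this, sub_self]

/-! ### The first variation of the energy -/

/-- The slope of the radial deformation per unit of time. -/
noncomputable def rate (r : ℝ) (p : Space n × ℝ) : ℝ := zetaD (rsq p / r ^ 2) * (2 / r ^ 2)

lemma slope_eq (r t : ℝ) (p : Space n × ℝ) : slope r t p = t * rate r p := rfl

lemma continuous_rate (r : ℝ) : Continuous (rate r : Space n × ℝ → ℝ) :=
  (continuous_zetaD.comp (continuous_rsq.div_const _)).mul continuous_const

/-- The rate of change of the coefficient of `|∇u|²` under the radial deformation. -/
noncomputable def coefA (s r t : ℝ) (p : Space n × ℝ) : ℝ :=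
  (cut r p * dslope (fun x : ℝ => x ^ (s + 1 - n)) 1 (dil r t p) - (cut r p + rate r p * rsq p)) /
    (dil r t p + slope r t p * rsq p)

/-- The rate of change of the coefficient of the radial part under the radial deformation. -/
noncomputable def coefB (s r t : ℝ) (p : Space n × ℝ) : ℝ :=
  dil r t p ^ (s - n - 3) * (rate r p * (2 * dil r t p + slope r t p * rsq p)) /
    (dil r t p + slope r t p * rsq p)

/-- The new coefficient of |∇u|² is θ² from the pullback, times θ^(s-1) from the weight, divided by
the Jacobian θ^n (θ + σ|p|²). As θ - 1 = t cut, `dslope` divides its increment by t without a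
singularity at t = 0. -/
lemma mul_coefA {r : ℝ} (hr : 0 < r) {t : ℝ} (ht : |t| ≤ 1 / 18) (p : Space n × ℝ) :
    1 + t * coefA s r t p = dil r t p ^ (s + 1 - n) / (dil r t p + slope r t p * rsq p) := by
  have h := dil_add_slope_pos hr ht p
  have h1 := sub_smul_dslope (fun x : ℝ => x ^ (s + 1 - n)) 1 (dil r t p)
  simp only [smul_eq_mul, Real.one_rpow] at h1
  have h2 : dil r t p - 1 = t * cut r p := by rw [dil]; ring
  rw [h2] at h1
  rw [coefA, eq_div_iff (by linarith), add_mul, mul_assoc t, div_mul_cancel₀ _ (by linarith),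
    slope_eq, dil] at *
  linarith

/-- The coefficient of (X·∇u)² taken at the image point. That derivative is θ times the one in
direction p, which adds θ^(-2) to the factors of weight and Jacobian. -/
lemma mul_coefB (r t : ℝ) (p : Space n × ℝ) :
    t * coefB s r t p = dil r t p ^ (s - n - 3) *
      (2 * dil r t p * slope r t p + slope r t p ^ 2 * rsq p) /
      (dil r t p + slope r t p * rsq p) := by
  rw [coefB, slope_eq]
  ring

lemma coefA_zero (s r : ℝ) (p : Space n × ℝ) :
    coefA s r 0 p = (s - n) * cut r p - rate r p * rsq p := by
  have h : deriv (fun x : ℝ => x ^ (s + 1 - n)) 1 = s + 1 - n := by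
    rw [Real.deriv_rpow_const, Real.one_rpow, mul_one]
  simp only [coefA, dil, slope, zero_mul, add_zero, div_one, dslope_same, h]
  ring

lemma coefB_zero (s r : ℝ) (p : Space n × ℝ) : coefB s r 0 p = 2 * rate r p := by
  simp only [coefB, dil, slope, zero_mul, add_zero, div_one, Real.one_rpow]
  ring

lemma continuous_dil (r : ℝ) : Continuous fun x : ℝ × (Space n × ℝ) => dil r x.1 x.2 :=
  continuous_const.add (continuous_fst.mul ((continuous_cut r).comp continuous_snd))

lemma continuous_slope (r : ℝ) : Continuous fun x : ℝ × (Space n × ℝ) => slope r x.1 x.2 :=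
  continuous_fst.mul ((continuous_rate r).comp continuous_snd)

lemma continuousOn_coefA {r : ℝ} (hr : 0 < r) : ContinuousOn
    (fun x : ℝ × (Space n × ℝ) => coefA s r x.1 x.2) {x | |x.1| ≤ 1 / 18} := by
  have hc := (continuous_cut (n := n) r).comp continuous_snd (X := ℝ × (Space n × ℝ))
  have hl := (continuous_rate (n := n) r).comp continuous_snd (X := ℝ × (Space n × ℝ))
  have hq := (continuous_rsq (n := n)).comp continuous_snd (X := ℝ × (Space n × ℝ))
  have hd : ContinuousOn (dslope (fun x : ℝ => x ^ (s + 1 - n)) 1) (Set.Ioi 0) := by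
    rw [continuousOn_dslope (Ioi_mem_nhds one_pos)]
    exact ⟨fun x hx => (Real.continuousAt_rpow_const x _ (Or.inl (ne_of_gt hx))).continuousWithinAt,
      (Real.hasDerivAt_rpow_const (Or.inl one_ne_zero)).differentiableAt⟩
  refine ContinuousOn.div ((hc.continuousOn.mul (hd.comp (continuous_dil r).continuousOn
    fun x hx => dil_pos r hx x.2)).sub (hc.add (hl.mul hq)).continuousOn)
    ((continuous_dil r).add ((continuous_slope r).mul hq)).continuousOn fun x hx => ?_
  have := dil_add_slope_pos hr hx x.2
  exact ne_of_gt (lt_of_lt_of_le (by norm_num) this)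

lemma continuousOn_coefB {r : ℝ} (hr : 0 < r) : ContinuousOn
    (fun x : ℝ × (Space n × ℝ) => coefB s r x.1 x.2) {x | |x.1| ≤ 1 / 18} := by
  have hl := (continuous_rate (n := n) r).comp continuous_snd (X := ℝ × (Space n × ℝ))
  have hq := (continuous_rsq (n := n)).comp continuous_snd (X := ℝ × (Space n × ℝ))
  refine ContinuousOn.div (((continuous_dil r).continuousOn.rpow_const fun x hx =>
    Or.inl (dil_pos r hx x.2).ne').mul (hl.mul ((continuous_const.mul (continuous_dil r)).add
      ((continuous_slope r).mul hq))).continuousOn)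
    ((continuous_dil r).add ((continuous_slope r).mul hq)).continuousOn fun x hx => ?_
  have := dil_add_slope_pos hr hx x.2
  exact ne_of_gt (lt_of_lt_of_le (by norm_num) this)

/-- Both coefficients are continuous in (t, p) on a compact set. The uniform bound dominates the
first variation as t → 0. -/
lemma exists_coef_bound {r : ℝ} (hr : 0 < r) : ∃ K : ℝ, 0 ≤ K ∧ ∀ t : ℝ, |t| ≤ 1 / 18 →
    ∀ p : Space n × ℝ, rsq p ≤ r ^ 2 → |coefA s r t p| ≤ K ∧ |coefB s r t p| ≤ K := by
  have hcp : IsCompact {p : Space n × ℝ | rsq p ≤ r ^ 2} := by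
    refine (isCompact_closedBall (0 : Space n × ℝ) r).of_isClosed_subset
      (isClosed_le continuous_rsq continuous_const) fun p hp => ?_
    rw [mem_closedBall_zero_iff]
    exact (norm_le_sqrt_rsq p).trans (Real.sqrt_le_iff.2 ⟨hr.le, hp⟩)
  have hK := (isCompact_Icc (a := -(1 / 18 : ℝ)) (b := 1 / 18)).prod hcp
  have hsub : Set.Icc (-(1 / 18 : ℝ)) (1 / 18) ×ˢ {p : Space n × ℝ | rsq p ≤ r ^ 2} ⊆
      {x | |x.1| ≤ 1 / 18} := fun x hx => abs_le.2 hx.1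
  obtain ⟨A, hA⟩ := hK.exists_bound_of_continuousOn ((continuousOn_coefA (s := s) hr).mono hsub)
  obtain ⟨B, hB⟩ := hK.exists_bound_of_continuousOn ((continuousOn_coefB (s := s) hr).mono hsub)
  refine ⟨max 0 (max A B), le_max_left _ _, fun t ht p hp => ?_⟩
  have hm : (t, p) ∈ Set.Icc (-(1 / 18 : ℝ)) (1 / 18) ×ˢ {p : Space n × ℝ | rsq p ≤ r ^ 2} :=
    ⟨abs_le.1 ht, hp⟩
  exact ⟨(hA _ hm).trans ((le_max_left _ _).trans (le_max_right _ _)),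
    (hB _ hm).trans ((le_max_right _ _).trans (le_max_right _ _))⟩

/-- The inverse of the radial deformation. -/
noncomputable def radialInv (r t : ℝ) : Space n × ℝ → Space n × ℝ := Function.invFun (radial r t)

lemma radial_radialInv {r : ℝ} (hr : 0 < r) {t : ℝ} (ht : |t| ≤ 1 / 18) (p : Space n × ℝ) :
    radial r t (radialInv r t p) = p :=
  Function.rightInverse_invFun (bijective_radial hr ht).2 p

lemma radialInv_radial {r : ℝ} (hr : 0 < r) {t : ℝ} (ht : |t| ≤ 1 / 18) (p : Space n × ℝ) :
    radialInv r t (radial r t p) = p :=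
  Function.leftInverse_invFun (bijective_radial hr ht).1 p

lemma continuous_radialInv {r : ℝ} (hr : 0 < r) {t : ℝ} (ht : |t| ≤ 1 / 18) :
    Continuous (radialInv r t : Space n × ℝ → Space n × ℝ) :=
  (LipschitzWith.of_dist_le_mul (K := 2) fun p q => by
    have := dist_le_radial hr ht (radialInv r t p) (radialInv r t q)
    rw [radial_radialInv hr ht, radial_radialInv hr ht] at this
    rw [dist_eq_norm, dist_eq_norm]; exact this).continuous

lemma rsq_radialInv_lt {r : ℝ} (hr : 0 < r) {t : ℝ} (ht : |t| ≤ 1 / 18) {p : Space n × ℝ}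
    (hp : rsq p < r ^ 2) : rsq (radialInv r t p) < r ^ 2 := by
  rw [← rsq_radial_lt hr ht, radial_radialInv hr ht]
  exact hp

lemma eventually_abs_le : ∀ᶠ t : ℝ in 𝓝 0, |t| ≤ 1 / 18 := by
  have : Tendsto (fun t : ℝ => |t|) (𝓝 0) (𝓝 0) := by
    simpa using (continuous_abs (G := ℝ)).tendsto 0
  exact this.eventually (ge_mem_nhds (by norm_num))

lemma radial_zero_time (r : ℝ) (p : Space n × ℝ) : radial r 0 p = p := by simp [radial, dil]

lemma radialInv_zero_time {r : ℝ} (hr : 0 < r) (p : Space n × ℝ) : radialInv r 0 p = p := by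
  have := radialInv_radial hr (t := 0) (by norm_num) p
  rwa [radial_zero_time] at this

lemma tendsto_radialInv {r : ℝ} (hr : 0 < r) (p : Space n × ℝ) :
    Tendsto (fun t => radialInv r t p) (𝓝 0) (𝓝 p) := by
  rw [tendsto_iff_norm_sub_tendsto_zero]
  have h : Tendsto (fun t : ℝ => 2 * ‖t • (cut r p • p)‖) (𝓝 0) (𝓝 0) := by
    have := (by fun_prop : Continuous fun t : ℝ => 2 * ‖t • (cut r p • p)‖).tendsto 0
    simpa using this
  refine squeeze_zero' (Eventually.of_forall fun _ => norm_nonneg _) ?_ h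
  filter_upwards [eventually_abs_le] with t ht
  have := dist_le_radial hr ht (radialInv r t p) p
  rw [radial_radialInv hr ht, radial_eq] at this
  refine this.trans (le_of_eq ?_)
  rw [sub_add_cancel_left, norm_neg]

/-- The radial part of the energy density of the extension. -/
noncomputable def rdens (s : ℝ) (g : Space n → ℝ) (p : Space n × ℝ) : ℝ :=
  p.2 ^ (1 - s) * (extD s g p p) ^ 2

lemma rdens_nonneg {g : Space n → ℝ} {p : Space n × ℝ} (hp : p ∈ upper n) : 0 ≤ rdens s g p :=
  mul_nonneg (Real.rpow_nonneg (le_of_lt hp) _) (sq_nonneg _)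

lemma rdens_le {g : Space n → ℝ} {p : Space n × ℝ} (hp : p ∈ upper n) :
    rdens s g p ≤ rsq p * dens s g p := by
  have := mul_le_mul_of_nonneg_left (sq_apply_le p (extD s g p))
    (Real.rpow_nonneg (le_of_lt hp) (1 - s))
  rw [rdens, dens]
  linarith

lemma continuousOn_rdens (hs : 0 < s) {g : Space n → ℝ} (hg : AEStronglyMeasurable g) {M : ℝ}
    (hb : ∀ x, |g x| ≤ M) : ContinuousOn (rdens s g) (upper n) :=
  (continuousOn_weight _).mul (((continuousOn_extD hs hg hb).clm_apply continuousOn_id).pow 2)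

/-- The integrand of the first variation at time `t`. -/
noncomputable def varTerm (s : ℝ) (g : Space n → ℝ) (r t : ℝ) (p : Space n × ℝ) : ℝ :=
  coefA s r t (radialInv r t p) * dens s g p + coefB s r t (radialInv r t p) * rdens s g p

lemma halfBall_subset_upper (r : ℝ) : halfBall n r ⊆ upper n := fun _ hp => hp.1

lemma continuousOn_varTerm (hs : 0 < s) {g : Space n → ℝ} (hg : AEStronglyMeasurable g) {M : ℝ}
    (hb : ∀ x, |g x| ≤ M) {r : ℝ} (hr : 0 < r) {t : ℝ} (ht : |t| ≤ 1 / 18) :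
    ContinuousOn (varTerm s g r t) (halfBall n r) := by
  have h1 : Continuous fun p : Space n × ℝ => (t, radialInv r t p) :=
    continuous_const.prodMk (continuous_radialInv hr ht)
  have hA := (continuousOn_coefA (s := s) hr).comp h1.continuousOn
    (fun p (_ : p ∈ halfBall n r) => ht)
  have hB := (continuousOn_coefB (s := s) hr).comp h1.continuousOn
    (fun p (_ : p ∈ halfBall n r) => ht)
  exact (hA.mul ((continuousOn_dens hs hg hb).mono (halfBall_subset_upper r))).add
    (hB.mul ((continuousOn_rdens hs hg hb).mono (halfBall_subset_upper r)))

lemma abs_varTerm_le {g : Space n → ℝ} {r K : ℝ} (hr : 0 < r) (hK0 : 0 ≤ K)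
    (hK : ∀ t : ℝ, |t| ≤ 1 / 18 → ∀ p : Space n × ℝ, rsq p ≤ r ^ 2 →
      |coefA s r t p| ≤ K ∧ |coefB s r t p| ≤ K) {t : ℝ} (ht : |t| ≤ 1 / 18)
    {p : Space n × ℝ} (hp : p ∈ halfBall n r) :
    |varTerm s g r t p| ≤ K * (1 + r ^ 2) * dens s g p := by
  obtain ⟨hA, hB⟩ := hK t ht _ (rsq_radialInv_lt hr ht hp.2).le
  have h1 : 0 ≤ dens s g p := dens_nonneg hp.1
  have h2 : 0 ≤ rdens s g p := rdens_nonneg hp.1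
  have h3 : rdens s g p ≤ r ^ 2 * dens s g p :=
    (rdens_le hp.1).trans (mul_le_mul_of_nonneg_right hp.2.le h1)
  refine (abs_add_le _ _).trans ?_
  rw [abs_mul, abs_mul, abs_of_nonneg h1, abs_of_nonneg h2]
  have h4 := mul_le_mul_of_nonneg_right hA h1
  have h5 := mul_le_mul hB h3 h2 hK0
  linarith

lemma integrableOn_varTerm (hs : 0 < s) {g : Space n → ℝ} (hg : AEStronglyMeasurable g) {M : ℝ}
    (hb : ∀ x, |g x| ≤ M) {r : ℝ} (hr : 0 < r) {t : ℝ} (ht : |t| ≤ 1 / 18)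
    (hd : IntegrableOn (dens s g) (halfBall n r)) :
    IntegrableOn (varTerm s g r t) (halfBall n r) := by
  obtain ⟨K, hK0, hK⟩ := exists_coef_bound (n := n) (s := s) hr
  have mB := (isOpen_halfBall (n := n) r).measurableSet
  refine (Integrable.const_mul hd (K * (1 + r ^ 2))).mono'
    ((continuousOn_varTerm hs hg hb hr ht).aestronglyMeasurable mB) ?_
  filter_upwards [ae_restrict_mem mB] with p hp
  exact abs_varTerm_le hr hK0 hK ht hp

/-- The pointwise form of the change of variables: Jacobian, weight and pullback combine, and the
powers of θ add up to 2 and to 0. -/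
lemma det_mul_varTerm (g : Space n → ℝ) {r : ℝ} (hr : 0 < r) {t : ℝ} (ht : |t| ≤ 1 / 18)
    {p : Space n × ℝ} (hp : p ∈ halfBall n r) :
    |(radialD r t p).det| • (dens s g (radial r t p) + t * varTerm s g r t (radial r t p)) =
      p.2 ^ (1 - s) * gdot (pullD s g r t p) (pullD s g r t p) := by
  have hθ := dil_pos r ht p
  have hw := dil_add_slope_pos hr ht p
  have hz : 0 < p.2 := hp.1
  have hdet : 0 ≤ (radialD r t p).det := by
    rw [det_radialD r ht]
    exact mul_nonneg (pow_nonneg hθ.le _) (by linarith)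
  have e1 : dens s g (radial r t p) + t * varTerm s g r t (radial r t p) =
      (1 + t * coefA s r t p) * dens s g (radial r t p) +
        (t * coefB s r t p) * rdens s g (radial r t p) := by
    rw [varTerm, radialInv_radial hr ht]; ring
  rw [abs_of_nonneg hdet, e1, mul_coefA hr ht, mul_coefB, det_radialD r ht, pullD,
    gdot_comp_radialD, dens, rdens, radial_snd, Real.mul_rpow hθ.le hz.le, smul_eq_mul]
  set L := extD s g (radial r t p)
  have e2 : L (radial r t p) = dil r t p * L p := by rw [radial, map_smul, smul_eq_mul]
  rw [e2]
  have r1 : dil r t p ^ n * dil r t p ^ (1 - s) * dil r t p ^ (s + 1 - n) = dil r t p ^ 2 := by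
    rw [← Real.rpow_natCast, ← Real.rpow_natCast, ← Real.rpow_add hθ, ← Real.rpow_add hθ]
    congr 1
    push_cast
    ring
  have r2 : dil r t p ^ n * dil r t p ^ (1 - s) * dil r t p ^ (s - n - 3) * dil r t p ^ 2 = 1 := by
    rw [← Real.rpow_natCast, ← Real.rpow_natCast, ← Real.rpow_add hθ, ← Real.rpow_add hθ,
      ← Real.rpow_add hθ]
    rw [show (n : ℝ) + (1 - s) + (s - n - 3) + ((2 : ℕ) : ℝ) = 0 by push_cast; ring,
      Real.rpow_zero]
  set θ := dil r t p
  set σ := slope r t p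
  set q := rsq p
  have hw' : θ + σ * q ≠ 0 := by linarith
  calc _ = (θ ^ n * θ ^ (1 - s) * θ ^ (s + 1 - n)) * (p.2 ^ (1 - s) * gdot L L) +
        (θ ^ n * θ ^ (1 - s) * θ ^ (s - n - 3) * θ ^ 2) * (p.2 ^ (1 - s) *
          ((2 * θ * σ + σ ^ 2 * q) * (L p) ^ 2)) := by
        field_simp
    _ = _ := by rw [r1, r2]; ring

lemma pullD_eq_of_le {g : Space n → ℝ} {r : ℝ} (hr : 0 < r) (t : ℝ) {p : Space n × ℝ}
    (h : r ^ 2 ≤ rsq p) : pullD s g r t p = extD s g p := by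
  rw [pullD, radial_eq_self hr t h, radialD_eq_id hr t h, ContinuousLinearMap.comp_id]

lemma hvol_restrict_halfBall (r : ℝ) :
    (hvol n 0).restrict (halfBall n r) = volume.restrict (halfBall n r) := by
  rw [hvol, Measure.restrict_restrict (isOpen_halfBall r).measurableSet]
  congr 1
  exact Set.inter_eq_left.2 fun p hp => hp.1

/-- Change of variables in the inner variation. -/
lemma integral_radial_variation (hs : 0 < s) {g : Space n → ℝ} (hg : AEStronglyMeasurable g)
    {M : ℝ} (hb : ∀ x, |g x| ≤ M) {r : ℝ} (hr : 0 < r) {t : ℝ} (ht : |t| ≤ 1 / 18)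
    (hd : IntegrableOn (dens s g) (halfBall n r)) :
    Integrable (fun p => p.2 ^ (1 - s) * (gdot (pullD s g r t p) (pullD s g r t p) -
      gdot (extD s g p) (extD s g p))) (hvol n 0) ∧
    ∫ p, p.2 ^ (1 - s) * (gdot (pullD s g r t p) (pullD s g r t p) -
      gdot (extD s g p) (extD s g p)) ∂(hvol n 0) = t * ∫ p in halfBall n r, varTerm s g r t p := by
  have mB := (isOpen_halfBall (n := n) r).measurableSet
  have hv := integrableOn_varTerm hs hg hb hr ht hd
  have h1 : IntegrableOn (fun p => dens s g p + t * varTerm s g r t p) (halfBall n r) :=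
    Integrable.add hd (Integrable.const_mul hv t)
  have hD : ∀ p ∈ halfBall n r, HasFDerivWithinAt (radial r t) (radialD r t p) (halfBall n r) p :=
    fun p _ => (hasFDerivAt_radial r t p).hasFDerivWithinAt
  have hinj : Set.InjOn (radial r t) (halfBall n r) := (bijective_radial hr ht).1.injOn
  have hcongr : ∀ p ∈ halfBall n r, |(radialD r t p).det| • (dens s g (radial r t p) +
      t * varTerm s g r t (radial r t p)) =
      p.2 ^ (1 - s) * gdot (pullD s g r t p) (pullD s g r t p) :=
    fun p hp => det_mul_varTerm g hr ht hp
  have i1 := (integrableOn_image_iff_integrableOn_abs_det_fderiv_smul volume mB hD hinj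
    fun p => dens s g p + t * varTerm s g r t p).1 (by rwa [image_radial_halfBall hr ht])
  have i2 : IntegrableOn (fun p => p.2 ^ (1 - s) * gdot (pullD s g r t p) (pullD s g r t p))
      (halfBall n r) := i1.congr_fun hcongr mB
  have e1 := integral_image_eq_integral_abs_det_fderiv_smul volume mB hD hinj
    fun p => dens s g p + t * varTerm s g r t p
  rw [image_radial_halfBall hr ht, setIntegral_congr_fun mB hcongr,
    integral_add hd (Integrable.const_mul hv t), integral_const_mul] at e1
  have i3 : IntegrableOn (fun p => p.2 ^ (1 - s) * (gdot (pullD s g r t p) (pullD s g r t p) -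
      gdot (extD s g p) (extD s g p))) (halfBall n r) := by
    refine (Integrable.sub i2 hd).congr (ae_of_all _ fun p => ?_)
    simp only [Pi.sub_apply, dens]; ring
  have hz : ∀ p, p ∉ halfBall n r → 0 < p.2 → p.2 ^ (1 - s) *
      (gdot (pullD s g r t p) (pullD s g r t p) - gdot (extD s g p) (extD s g p)) = 0 := by
    intro p hp hp2
    have : r ^ 2 ≤ rsq p := not_lt.1 fun h => hp ⟨hp2, h⟩
    rw [pullD_eq_of_le hr t this, sub_self, mul_zero]
  have hind : (halfBall n r).indicator (fun p => p.2 ^ (1 - s) *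
      (gdot (pullD s g r t p) (pullD s g r t p) - gdot (extD s g p) (extD s g p))) =ᵐ[hvol n 0]
      fun p => p.2 ^ (1 - s) *
      (gdot (pullD s g r t p) (pullD s g r t p) - gdot (extD s g p) (extD s g p)) := by
    filter_upwards [ae_hvol] with p hp
    by_cases h : p ∈ halfBall n r
    · rw [Set.indicator_of_mem h]
    · rw [Set.indicator_of_notMem h, hz p h hp]
  constructor
  · refine ((integrable_indicator_iff mB).2 ?_).congr hind
    rw [IntegrableOn, hvol_restrict_halfBall]
    exact i3
  · rw [← integral_congr_ae hind, integral_indicator mB, hvol_restrict_halfBall]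
    have : ∫ p in halfBall n r, p.2 ^ (1 - s) * (gdot (pullD s g r t p) (pullD s g r t p) -
        gdot (extD s g p) (extD s g p)) =
        (∫ p in halfBall n r, p.2 ^ (1 - s) * gdot (pullD s g r t p) (pullD s g r t p)) -
        ∫ p in halfBall n r, dens s g p := by
      rw [← integral_sub i2 hd]
      congr 1
      ext p
      simp only [dens]; ring
    rw [this]
    linarith

/-- The cutoff of the larger radius is bounded below by (1 - r²/ρ²)² on the smaller half ball, so
Caccioppoli's inequality applies. -/
lemma integrableOn_dens (hs : 0 < s) (hs1 : s < 1) {g : Space n → ℝ}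
    (hg : AEStronglyMeasurable g) {M : ℝ} (hb : ∀ x, |g x| ≤ M) {r ρ : ℝ} (hr : 0 < r) (hrρ : r < ρ)
    (hfin : FiniteOn s (ball 0 ρ) g) : IntegrableOn (dens s g) (halfBall n r) := by
  have mB := (isOpen_halfBall (n := n) r).measurableSet
  have hρ := hr.trans hrρ
  have h1 := integrable_dens_mul_cut hs hs1 hg hb hρ hfin
  have h2 : IntegrableOn (fun p => dens s g p * cut ρ p) (halfBall n r) := by
    have := h1.integrableOn (s := halfBall n r)
    rwa [IntegrableOn, hvol_restrict_halfBall] at this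
  have hc : 0 < 1 - r ^ 2 / ρ ^ 2 := by
    rw [sub_pos, div_lt_one (by positivity)]
    exact pow_lt_pow_left₀ hrρ hr.le two_ne_zero
  refine (Integrable.const_mul h2 (((1 - r ^ 2 / ρ ^ 2) ^ 2)⁻¹)).mono'
    (((continuousOn_dens hs hg hb).mono (halfBall_subset_upper r)).aestronglyMeasurable mB) ?_
  filter_upwards [ae_restrict_mem mB] with p hp
  have h3 : 0 ≤ dens s g p := dens_nonneg hp.1
  have h4 : (1 - r ^ 2 / ρ ^ 2) ^ 2 ≤ cut ρ p := by
    rw [cut, zeta]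
    refine pow_le_pow_left₀ hc.le (le_max_of_le_right ?_) 2
    have := hp.2.le
    gcongr
  rw [Real.norm_of_nonneg h3, inv_mul_eq_div, le_div_iff₀ (by positivity)]
  exact mul_le_mul_of_nonneg_left h4 h3

lemma tendsto_integral_varTerm (hs : 0 < s) {g : Space n → ℝ} (hg : AEStronglyMeasurable g)
    {M : ℝ} (hb : ∀ x, |g x| ≤ M) {r : ℝ} (hr : 0 < r)
    (hd : IntegrableOn (dens s g) (halfBall n r)) :
    Tendsto (fun t => ∫ p in halfBall n r, varTerm s g r t p) (𝓝 0)
      (𝓝 (∫ p in halfBall n r, varTerm s g r 0 p)) := by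
  obtain ⟨K, hK0, hK⟩ := exists_coef_bound (n := n) (s := s) hr
  have mB := (isOpen_halfBall (n := n) r).measurableSet
  refine tendsto_integral_filter_of_dominated_convergence
    (fun p => K * (1 + r ^ 2) * dens s g p) ?_ ?_ (Integrable.const_mul hd _) ?_
  · filter_upwards [eventually_abs_le] with t ht
    exact (continuousOn_varTerm hs hg hb hr ht).aestronglyMeasurable mB
  · filter_upwards [eventually_abs_le] with t ht
    filter_upwards [ae_restrict_mem mB] with p hp
    exact abs_varTerm_le hr hK0 hK ht hp
  · refine ae_of_all _ fun p => ?_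
    have h0 : ((0 : ℝ), p) ∈ {x : ℝ × (Space n × ℝ) | |x.1| ≤ 1 / 18} := by simp
    have h1 : Tendsto (fun t => (t, radialInv r t p)) (𝓝 0)
        (𝓝[{x : ℝ × (Space n × ℝ) | |x.1| ≤ 1 / 18}] (0, p)) :=
      tendsto_nhdsWithin_iff.2 ⟨tendsto_id.prodMk_nhds (tendsto_radialInv hr p), eventually_abs_le⟩
    unfold varTerm
    rw [radialInv_zero_time hr]
    exact ((((continuousOn_coefA (s := s) hr) _ h0).tendsto.comp h1).mul_const _).add
      ((((continuousOn_coefB (s := s) hr) _ h0).tendsto.comp h1).mul_const _)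

/-- The extension of a minimizer is stationary under radial inner variations. -/
lemma IsMinimizer.stationary (hn : 0 < n) (hs : 0 < s) (hs1 : s < 1) {E : Set (Space n)}
    {ρ : ℝ} (hE : IsMinimizer s (ball 0 ρ) E) (hfin : energy s (ball 0 ρ) E ≠ ∞)
    {r : ℝ} (hr : 0 < r) (hrρ : r < ρ) :
    ∫ p in halfBall n r, (((n - s) * cut r p + rate r p * rsq p) * dens s (chi E) p -
      2 * rate r p * rdens s (chi E) p) = 0 := by
  have hEm := hE.nullMeasurableSet
  have hg := aestronglyMeasurable_chi hEm
  have hb := abs_chi_le E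
  have hd := integrableOn_dens hs hs1 hg hb hr hrρ ((finiteOn_chi_iff hEm measurableSet_ball).2 hfin)
  -- Minimality gives this for both signs of t; dividing by t and letting t → 0 from either side
  -- yields opposite inequalities.
  have hnn : ∀ t : ℝ, |t| ≤ 1 / 18 → 0 ≤ t * ∫ p in halfBall n r, varTerm s (chi E) r t p := by
    intro t ht
    obtain ⟨h1, h2⟩ := integral_radial_variation hs hg hb hr ht hd
    rw [← h2]
    exact integral_radial_variation_nonneg hn hs hs1 hE hfin hr hrρ.le ht h1
  have ht := tendsto_integral_varTerm hs hg hb hr hd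
  have hge : 0 ≤ ∫ p in halfBall n r, varTerm s (chi E) r 0 p := by
    refine ge_of_tendsto (ht.mono_left (nhdsWithin_le_nhds (s := Set.Ioi 0))) ?_
    filter_upwards [nhdsWithin_le_nhds eventually_abs_le, self_mem_nhdsWithin] with t h1 h2
    exact nonneg_of_mul_nonneg_right (hnn t h1) h2
  have hle : ∫ p in halfBall n r, varTerm s (chi E) r 0 p ≤ 0 := by
    refine le_of_tendsto (ht.mono_left (nhdsWithin_le_nhds (s := Set.Iio 0))) ?_
    filter_upwards [nhdsWithin_le_nhds eventually_abs_le, self_mem_nhdsWithin] with t h1 h2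
    exact nonpos_of_mul_nonneg_right (hnn t h1) h2
  have e : ∫ p in halfBall n r, (((n - s) * cut r p + rate r p * rsq p) * dens s (chi E) p -
      2 * rate r p * rdens s (chi E) p) = -∫ p in halfBall n r, varTerm s (chi E) r 0 p := by
    rw [← integral_neg]
    congr 1
    ext p
    rw [varTerm, radialInv_zero_time hr, coefA_zero, coefB_zero]
    ring
  rw [e, le_antisymm hle hge, neg_zero]

/-! ### The monotonicity formula -/

lemma rate_nonpos (r : ℝ) (p : Space n × ℝ) : rate r p ≤ 0 :=
  mul_nonpos_of_nonpos_of_nonneg (zetaD_nonpos _) (by positivity)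

lemma rate_eq_zero {r : ℝ} (hr : 0 < r) {p : Space n × ℝ} (h : r ^ 2 ≤ rsq p) : rate r p = 0 := by
  rw [rate, zetaD_eq_zero ((one_le_div (by positivity)).2 h), zero_mul]

lemma abs_rate_mul_le {r : ℝ} (hr : 0 < r) (p : Space n × ℝ) : |rate r p * rsq p| ≤ 4 := by
  rcases le_or_gt (r ^ 2) (rsq p) with h | h
  · rw [rate_eq_zero hr h]; norm_num
  · have h1 := abs_zetaD_le (div_nonneg (rsq_nonneg p) (sq_nonneg r))
    have h2 : rsq p / r ^ 2 ≤ 1 := (div_le_one (by positivity)).2 h.le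
    have h3 := div_nonneg (rsq_nonneg p) (sq_nonneg r)
    have e : rate r p * rsq p = 2 * (zetaD (rsq p / r ^ 2) * (rsq p / r ^ 2)) := by
      rw [rate]; field_simp
    rw [e, abs_mul, abs_mul, abs_of_nonneg h3]
    calc _ ≤ |(2 : ℝ)| * (2 * 1) := by gcongr
      _ = _ := by norm_num

/-- Here |p|²/r² ≤ 1/4, hence -rate = 4(1 - |p|²/r²)/r² ≥ 4 · (3/4) / (16a²). -/
lemma le_neg_rate {a r : ℝ} (ha : 0 < a) (h1 : 2 * a ≤ r) (h2 : r ≤ 4 * a) {p : Space n × ℝ}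
    (hp : rsq p < a ^ 2) : 3 / (16 * a ^ 2) ≤ -rate r p := by
  have hr : 0 < r := by linarith
  have hq : rsq p / r ^ 2 ≤ 1 / 4 := by
    rw [div_le_div_iff₀ (by positivity) (by norm_num)]
    nlinarith
  have h3 : 1 / (16 * a ^ 2) ≤ 1 / r ^ 2 := by
    apply one_div_le_one_div_of_le (by positivity)
    nlinarith
  have h4 : 3 / 4 ≤ max 0 (1 - rsq p / r ^ 2) := le_max_of_le_right (by linarith)
  have h5 : -rate r p = 4 * max 0 (1 - rsq p / r ^ 2) * (1 / r ^ 2) := by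
    rw [rate, zetaD]; ring
  rw [h5]
  calc 3 / (16 * a ^ 2) = 4 * (3 / 4) * (1 / (16 * a ^ 2)) := by ring
    _ ≤ _ := by gcongr

lemma hasDerivAt_cut_radius {r : ℝ} (hr : 0 < r) (p : Space n × ℝ) :
    HasDerivAt (fun r => cut r p) (-(rate r p * rsq p / r)) r := by
  have h1 : HasDerivAt (fun r : ℝ => rsq p / r ^ 2) (-(2 * rsq p / r ^ 3)) r := by
    have := ((hasDerivAt_pow 2 r).inv (by positivity)).const_mul (rsq p)
    refine (this.congr_of_eventuallyEq (Eventually.of_forall fun x => ?_)).congr_deriv ?_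
    · simp [div_eq_mul_inv]
    · field_simp
      norm_num
      ring
  refine ((hasDerivAt_zeta _).comp r h1).congr_deriv ?_
  rw [rate]
  field_simp

/-- The energy of the extension in half balls, smoothly cut off. -/
noncomputable def profile (s : ℝ) (g : Space n → ℝ) (σ r : ℝ) : ℝ :=
  ∫ p in halfBall n σ, cut r p * dens s g p

/-- The domain is fixed and r enters only through the cutoff, so the derivative in the radius is
taken under the integral and no integrals over spheres occur. -/
lemma hasDerivAt_profile (hs : 0 < s) {g : Space n → ℝ} (hg : AEStronglyMeasurable g) {M : ℝ}
    (hb : ∀ x, |g x| ≤ M) {σ r : ℝ} (hr : 0 < r) (hd : IntegrableOn (dens s g) (halfBall n σ)) :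
    HasDerivAt (profile s g σ) (-((∫ p in halfBall n σ, rate r p * rsq p * dens s g p) / r)) r := by
  have mB := (isOpen_halfBall (n := n) σ).measurableSet
  have md := ((continuousOn_dens hs hg hb).mono (halfBall_subset_upper σ)).aestronglyMeasurable mB
    (μ := volume)
  have h := hasDerivAt_integral_of_dominated_loc_of_deriv_le (μ := volume.restrict (halfBall n σ))
    (F := fun r p => cut r p * dens s g p) (x₀ := r) (s := Set.Ioi (r / 2))
    (F' := fun r p => -(rate r p * rsq p / r) * dens s g p) (bound := fun p => 8 / r * dens s g p)
    (Ioi_mem_nhds (by linarith)) (Eventually.of_forall fun x =>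
      (continuous_cut x).aestronglyMeasurable.mul md) ?_ ?_ ?_ (Integrable.const_mul hd _) ?_
  · refine h.2.congr_deriv ?_
    rw [← integral_div, ← integral_neg]
    congr 1
    ext p
    ring
  · refine Integrable.mono' hd ((continuous_cut r).aestronglyMeasurable.mul md) ?_
    filter_upwards [ae_restrict_mem mB] with p hp
    have h1 : 0 ≤ dens s g p := dens_nonneg hp.1
    rw [norm_mul, Real.norm_of_nonneg h1, Real.norm_of_nonneg (cut_nonneg r p)]
    exact mul_le_of_le_one_left h1 (cut_le_one r p)
  · exact ((((continuous_rate r).mul continuous_rsq).div_const r).neg).aestronglyMeasurable.mul md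
  · filter_upwards [ae_restrict_mem mB] with p hp x hx
    have h1 : 0 ≤ dens s g p := dens_nonneg hp.1
    have hx' : r / 2 < x := hx
    have hx0 : 0 < x := by linarith
    rw [norm_mul, Real.norm_of_nonneg h1, norm_neg, norm_div, Real.norm_eq_abs, Real.norm_eq_abs,
      abs_of_pos hx0]
    refine mul_le_mul_of_nonneg_right ?_ h1
    calc _ ≤ 4 / (r / 2) := by gcongr; exact abs_rate_mul_le hx0 p
      _ = 8 / r := by ring
  · refine ae_of_all _ fun p x hx => ?_
    have hx' : r / 2 < x := hx
    exact (hasDerivAt_cut_radius (by linarith) p).mul_const _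

lemma integrableOn_rdens (hs : 0 < s) {g : Space n → ℝ} (hg : AEStronglyMeasurable g) {M : ℝ}
    (hb : ∀ x, |g x| ≤ M) {σ : ℝ} (hd : IntegrableOn (dens s g) (halfBall n σ)) :
    IntegrableOn (rdens s g) (halfBall n σ) := by
  have mB := (isOpen_halfBall (n := n) σ).measurableSet
  refine Integrable.mono' (Integrable.const_mul hd (σ ^ 2))
    (((continuousOn_rdens hs hg hb).mono (halfBall_subset_upper σ)).aestronglyMeasurable mB) ?_
  filter_upwards [ae_restrict_mem mB] with p hp
  rw [Real.norm_of_nonneg (rdens_nonneg hp.1)]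
  exact (rdens_le hp.1).trans (mul_le_mul_of_nonneg_right hp.2.le (dens_nonneg hp.1))

lemma integrableOn_rate_mul_rdens (hs : 0 < s) {g : Space n → ℝ} (hg : AEStronglyMeasurable g)
    {M : ℝ} (hb : ∀ x, |g x| ≤ M) {σ r : ℝ} (hr : 0 < r)
    (hd : IntegrableOn (dens s g) (halfBall n σ)) :
    IntegrableOn (fun p => -rate r p * rdens s g p) (halfBall n σ) := by
  have mB := (isOpen_halfBall (n := n) σ).measurableSet
  have mr := ((continuousOn_rdens hs hg hb).mono (halfBall_subset_upper σ)).aestronglyMeasurable mB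
    (μ := volume)
  refine Integrable.mono' (Integrable.const_mul hd 4)
    ((continuous_rate r).neg.aestronglyMeasurable.mul mr) ?_
  filter_upwards [ae_restrict_mem mB] with p hp
  have h1 : 0 ≤ dens s g p := dens_nonneg hp.1
  have h2 : 0 ≤ rdens s g p := rdens_nonneg hp.1
  have h3 := neg_nonneg.2 (rate_nonpos r p)
  rw [norm_mul, Real.norm_of_nonneg h2, Real.norm_of_nonneg h3]
  have h4 := mul_le_mul_of_nonneg_left (rdens_le (s := s) (g := g) hp.1) h3
  have h5 := mul_le_mul_of_nonneg_right ((abs_le.1 (abs_rate_mul_le hr p)).1) h1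
  linarith

/-- Monotonicity formula for the extension of a minimizer. -/
lemma IsMinimizer.hasDerivAt_profile (hn : 0 < n) (hs : 0 < s) (hs1 : s < 1) {E : Set (Space n)}
    {ρ : ℝ} (hE : IsMinimizer s (ball 0 ρ) E) (hfin : energy s (ball 0 ρ) E ≠ ∞) {σ r : ℝ}
    (hr : 0 < r) (hrσ : r < σ) (hσ : σ < ρ) :
    HasDerivAt (fun r => r ^ (s - n) * profile s (chi E) σ r)
      (2 * r ^ (s - n - 1) * ∫ p in halfBall n σ, -rate r p * rdens s (chi E) p) r := by
  have hEm := hE.nullMeasurableSet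
  have hg := aestronglyMeasurable_chi hEm
  have hb := abs_chi_le E
  have mB := (isOpen_halfBall (n := n) σ).measurableSet
  have hd := integrableOn_dens hs hs1 hg hb (hr.trans hrσ) hσ
    ((finiteOn_chi_iff hEm measurableSet_ball).2 hfin)
  have md := ((continuousOn_dens hs hg hb).mono (halfBall_subset_upper σ)).aestronglyMeasurable mB
    (μ := volume)
  have h1 := (Real.hasDerivAt_rpow_const (p := s - n) (Or.inl hr.ne')).mul
    (NonlocalMinimal.hasDerivAt_profile hs hg hb hr hd)
  refine h1.congr_deriv ?_
  -- Stationarity reads (n - s)P + A + 2B = 0 in the notation set below. It eliminates A from the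
  -- derivative r^(s-n-1) ((s - n)P - A) and leaves the radial term 2B.
  have st := hE.stationary hn hs hs1 hfin hr (hrσ.trans hσ)
  have hsub : halfBall n r ⊆ halfBall n σ := fun p hp =>
    ⟨hp.1, hp.2.trans (pow_lt_pow_left₀ hrσ hr.le two_ne_zero)⟩
  rw [← setIntegral_eq_of_subset_of_forall_sdiff_eq_zero mB hsub] at st
  swap
  · intro p hp
    have : r ^ 2 ≤ rsq p := not_lt.1 fun h => hp.2 ⟨hp.1.1, h⟩
    rw [rate_eq_zero hr this, cut_eq_zero hr this]
    ring
  have i1 : IntegrableOn (fun p => cut r p * dens s (chi E) p) (halfBall n σ) := by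
    refine Integrable.mono' hd ((continuous_cut r).aestronglyMeasurable.mul md) ?_
    filter_upwards [ae_restrict_mem mB] with p hp
    have h1 : 0 ≤ dens s (chi E) p := dens_nonneg hp.1
    rw [norm_mul, Real.norm_of_nonneg h1, Real.norm_of_nonneg (cut_nonneg r p)]
    exact mul_le_of_le_one_left h1 (cut_le_one r p)
  have i2 : IntegrableOn (fun p => rate r p * rsq p * dens s (chi E) p) (halfBall n σ) := by
    refine Integrable.mono' (Integrable.const_mul hd 4)
      (((continuous_rate r).mul continuous_rsq).aestronglyMeasurable.mul md) ?_
    filter_upwards [ae_restrict_mem mB] with p hp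
    have h1 : 0 ≤ dens s (chi E) p := dens_nonneg hp.1
    rw [norm_mul, Real.norm_of_nonneg h1]
    exact mul_le_mul_of_nonneg_right (abs_rate_mul_le hr p) h1
  have i3 := integrableOn_rate_mul_rdens hs hg hb hr hd
  have i12 : IntegrableOn (fun p => (n - s) * (cut r p * dens s (chi E) p) +
      rate r p * rsq p * dens s (chi E) p) (halfBall n σ) := (Integrable.const_mul i1 _).add i2
  have e : ∫ p in halfBall n σ, (((n - s) * cut r p + rate r p * rsq p) * dens s (chi E) p -
      2 * rate r p * rdens s (chi E) p) = (n - s) * profile s (chi E) σ r +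
      (∫ p in halfBall n σ, rate r p * rsq p * dens s (chi E) p) +
      2 * ∫ p in halfBall n σ, -rate r p * rdens s (chi E) p := by
    rw [profile, ← integral_const_mul, ← integral_const_mul,
      ← integral_add (Integrable.const_mul i1 _) i2, ← integral_add i12 (Integrable.const_mul i3 _)]
    congr 1
    ext p
    ring
  rw [e] at st
  have hp : r ^ (s - n) = r ^ (s - n - 1) * r := by
    rw [Real.rpow_sub_one hr.ne']; field_simp
  rw [hp]
  have hr' := hr.ne'
  set A := ∫ p in halfBall n σ, rate r p * rsq p * dens s (chi E) p
  set B := ∫ p in halfBall n σ, -rate r p * rdens s (chi E) p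
  set P := profile s (chi E) σ r
  have hA : A = -((n - s) * P) - 2 * B := by linarith
  rw [hA]
  field_simp
  ring

/-- The scale invariant radial energy of the extension of a minimizer vanishes in the limit. -/
lemma IsMinimizer.tendsto_rdens (hn : 0 < n) (hs : 0 < s) (hs1 : s < 1) {E : Set (Space n)}
    {ρ : ℝ} (hρ : 0 < ρ) (hE : IsMinimizer s (ball 0 ρ) E) (hfin : energy s (ball 0 ρ) E ≠ ∞) :
    Tendsto (fun a => a ^ (s - n - 2) * ∫ p in halfBall n a, rdens s (chi E) p) (𝓝[>] 0)
      (𝓝 0) := by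
  have hEm := hE.nullMeasurableSet
  have hg := aestronglyMeasurable_chi hEm
  have hb := abs_chi_le E
  set σ := ρ / 2 with hσ
  have hσ0 : 0 < σ := by positivity
  have hσρ : σ < ρ := by linarith
  have mB := (isOpen_halfBall (n := n) σ).measurableSet
  have hd := integrableOn_dens hs hs1 hg hb hσ0 hσρ
    ((finiteOn_chi_iff hEm measurableSet_ball).2 hfin)
  set Φ : ℝ → ℝ := fun r => r ^ (s - n) * profile s (chi E) σ r with hΦ
  have hder : ∀ r ∈ Set.Ioo 0 σ, HasDerivAt Φ
      (2 * r ^ (s - n - 1) * ∫ p in halfBall n σ, -rate r p * rdens s (chi E) p) r :=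
    fun r hr => hE.hasDerivAt_profile hn hs hs1 hfin hr.1 hr.2 hσρ
  have hnn : ∀ r, 0 ≤ ∫ p in halfBall n σ, -rate r p * rdens s (chi E) p := fun r =>
    setIntegral_nonneg mB fun p hp =>
      mul_nonneg (neg_nonneg.2 (rate_nonpos r p)) (rdens_nonneg hp.1)
  have hmono : MonotoneOn Φ (Set.Ioo 0 σ) := by
    refine monotoneOn_of_deriv_nonneg (convex_Ioo 0 σ)
      (fun r hr => (hder r hr).continuousAt.continuousWithinAt) ?_ ?_
    · rw [interior_Ioo]
      exact fun r hr => (hder r hr).differentiableAt.differentiableWithinAt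
    · rw [interior_Ioo]
      intro r hr
      rw [(hder r hr).deriv]
      have := hnn r
      have := Real.rpow_nonneg hr.1.le (s - n - 1)
      positivity
  -- Φ is nondecreasing and nonnegative, so it converges at 0 and Φ(4a) - Φ(2a) → 0.
  have hlim := MonotoneOn.tendsto_nhdsWithin_Ioo_right (Set.nonempty_Ioo.2 hσ0) hmono ⟨0, by
    rintro _ ⟨r, hr, rfl⟩
    exact mul_nonneg (Real.rpow_nonneg hr.1.le _) (setIntegral_nonneg mB fun p hp =>
      mul_nonneg (cut_nonneg r p) (dens_nonneg hp.1))⟩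
  have hscale : ∀ c : ℝ, 0 < c → Tendsto (fun a : ℝ => c * a) (𝓝[>] 0) (𝓝[>] 0) := by
    intro c hc
    refine tendsto_nhdsWithin_iff.2 ⟨?_, ?_⟩
    · have := (by fun_prop : Continuous fun a : ℝ => c * a).tendsto 0
      rw [mul_zero] at this
      exact this.mono_left nhdsWithin_le_nhds
    · filter_upwards [self_mem_nhdsWithin] with a ha
      exact mul_pos hc ha
  have hdiff := (hlim.comp (hscale 4 (by norm_num))).sub (hlim.comp (hscale 2 (by norm_num)))
  rw [sub_self] at hdiff
  -- The constant collects 2 · (4a)^(s-n-1) · 3/(16a²) · 2a = (3/4) 4^(s-n-1) a^(s-n-2), the lower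
  -- bound for the increment of Φ over [2a, 4a] per unit of radial energy.
  have hdiff' := hdiff.const_mul ((3 / 4 * (4 : ℝ) ^ (s - n - 1))⁻¹)
  rw [mul_zero] at hdiff'
  have hev : ∀ᶠ a in 𝓝[>] (0 : ℝ), a ∈ Set.Ioo 0 (σ / 4) := Ioo_mem_nhdsGT (by positivity)
  refine squeeze_zero' ?_ ?_ hdiff'
  · filter_upwards [self_mem_nhdsWithin] with a ha
    exact mul_nonneg (Real.rpow_nonneg (le_of_lt ha) _) (setIntegral_nonneg
      (isOpen_halfBall (n := n) a).measurableSet fun p hp => rdens_nonneg hp.1)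
  · filter_upwards [hev] with a ha
    have ha0 : 0 < a := ha.1
    have haσ : 4 * a < σ := by linarith [ha.2]
    set D := ∫ p in halfBall n a, rdens s (chi E) p with hD
    have hD0 : 0 ≤ D := setIntegral_nonneg (isOpen_halfBall (n := n) a).measurableSet
      fun p hp => rdens_nonneg hp.1
    have hIcc : Set.Icc (2 * a) (4 * a) ⊆ Set.Ioo 0 σ := fun r hr =>
      ⟨by linarith [hr.1], by linarith [hr.2]⟩
    have hsub : halfBall n a ⊆ halfBall n σ := fun p hp =>
      ⟨hp.1, hp.2.trans (pow_lt_pow_left₀ (by linarith) ha0.le two_ne_zero)⟩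
    -- By the mean value theorem the increment is 2a times a derivative at some ξ in (2a, 4a), where
    -- -rate is bounded below on the half ball of radius a.
    obtain ⟨ξ, hξ, hξ'⟩ := exists_hasDerivAt_eq_slope Φ _ (by linarith : 2 * a < 4 * a)
      (fun r hr => (hder r (hIcc hr)).continuousAt.continuousWithinAt)
      (fun r hr => hder r (hIcc (Set.Ioo_subset_Icc_self hr)))
    have hξ0 : 0 < ξ := by linarith [hξ.1]
    have i3 := integrableOn_rate_mul_rdens hs hg hb hξ0 hd
    have hlow : 3 / (16 * a ^ 2) * D ≤ ∫ p in halfBall n σ, -rate ξ p * rdens s (chi E) p := by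
      calc 3 / (16 * a ^ 2) * D ≤ ∫ p in halfBall n a, -rate ξ p * rdens s (chi E) p := by
            rw [hD, ← integral_const_mul]
            refine setIntegral_mono_on ?_ (i3.mono_set hsub)
              (isOpen_halfBall (n := n) a).measurableSet fun p hp => ?_
            · exact Integrable.const_mul (integrableOn_rdens hs hg hb (hd.mono_set hsub)) _
            · exact mul_le_mul_of_nonneg_right (le_neg_rate ha0 hξ.1.le hξ.2.le hp.2)
                (rdens_nonneg hp.1)
        _ ≤ _ := by
            refine setIntegral_mono_set i3 ?_ hsub.eventuallyLE
            filter_upwards [ae_restrict_mem mB] with p hp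
            exact mul_nonneg (neg_nonneg.2 (rate_nonpos ξ p)) (rdens_nonneg hp.1)
    have hpow : (4 * a) ^ (s - n - 1) ≤ ξ ^ (s - n - 1) := by
      refine Real.rpow_le_rpow_of_nonpos hξ0 hξ.2.le ?_
      have : (0 : ℝ) ≤ n := Nat.cast_nonneg n
      linarith
    rw [eq_div_iff (by linarith)] at hξ'
    have hpos : (0 : ℝ) < 4 ^ (s - n - 1) := by positivity
    rw [inv_mul_eq_div, le_div_iff₀ (by positivity)]
    have key : 2 * (4 * a) ^ (s - n - 1) * (3 / (16 * a ^ 2) * D) * (4 * a - 2 * a) ≤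
        Φ (4 * a) - Φ (2 * a) := by
      rw [← hξ']
      have : 0 ≤ 4 * a - 2 * a := by linarith
      gcongr
    refine le_trans (le_of_eq ?_) key
    rw [Real.mul_rpow (by norm_num) ha0.le,
      show a ^ (s - n - 1) = a ^ (s - n - 2) * a by
        rw [← Real.rpow_add_one ha0.ne']; congr 1; ring]
    field_simp
    ring

/-! ### Convergence and scaling of extensions -/

lemma TendstoL1Loc.tendsto_setLIntegral {E : ℕ → Set (Space n)} {C : Set (Space n)}
    (h : TendstoL1Loc E C) {f : Space n → ℝ≥0∞} (hf : ∫⁻ x, f x ≠ ∞) :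
    Tendsto (fun k => ∫⁻ x in symmDiff (E k) C, f x) atTop (𝓝 0) := by
  -- Local convergence says nothing near infinity; there the tail of f is small. On a fixed ball,
  -- absolute continuity of the integral is used.
  have hc : Tendsto (fun N : ℕ => ∫⁻ x in (closedBall (0 : Space n) N)ᶜ, f x) atTop (𝓝 0) := by
    have hm : ∀ N : ℕ, MeasurableSet (closedBall (0 : Space n) N)ᶜ :=
      fun N => measurableSet_closedBall.compl
    have h1 := tendsto_measure_iInter_atTop (μ := volume.withDensity f)
      (s := fun N : ℕ => (closedBall (0 : Space n) N)ᶜ) (fun N => (hm N).nullMeasurableSet)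
      (fun N N' hN => Set.compl_subset_compl.2 (closedBall_subset_closedBall (by exact_mod_cast hN)))
      ⟨0, by
        rw [withDensity_apply _ (hm 0)]
        exact ne_top_of_le_ne_top hf (setLIntegral_le_lintegral _ _)⟩
    have h2 : ⋂ N : ℕ, (closedBall (0 : Space n) N)ᶜ = ∅ := by
      rw [← Set.compl_iUnion, iUnion_closedBall_nat, Set.compl_univ]
    rw [h2, measure_empty] at h1
    exact h1.congr fun N => withDensity_apply _ (hm N)
  rw [ENNReal.tendsto_nhds_zero] at hc ⊢
  intro ε hε
  have hε2 : 0 < ε / 2 := ENNReal.half_pos hε.ne'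
  obtain ⟨N, hN⟩ := (hc (ε / 2) hε2).exists
  have h3 := tendsto_setLIntegral_zero hf (h (closedBall 0 N) (isCompact_closedBall _ _))
  rw [ENNReal.tendsto_nhds_zero] at h3
  filter_upwards [h3 (ε / 2) hε2] with k hk
  calc ∫⁻ x in symmDiff (E k) C, f x
      = (∫⁻ x in symmDiff (E k) C ∩ closedBall 0 N, f x) +
        ∫⁻ x in symmDiff (E k) C \ closedBall 0 N, f x :=
        (lintegral_inter_add_sdiff f _ measurableSet_closedBall).symm
    _ ≤ ε / 2 + ε / 2 := add_le_add hk ((lintegral_mono_set fun x hx => hx.2).trans hN)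
    _ = ε := ENNReal.add_halves ε

lemma enorm_chi_sub_mul (E F : Set (Space n)) (K : Space n → ℝ) (x : Space n) :
    ‖chi E x * K x - chi F x * K x‖ₑ = (symmDiff E F).indicator (fun x => ‖K x‖ₑ) x := by
  by_cases h1 : x ∈ E <;> by_cases h2 : x ∈ F <;>
    simp [h1, h2, chi_of_mem, chi_of_notMem, Set.mem_symmDiff]

lemma TendstoL1Loc.tendsto_integral_chi_mul {E : ℕ → Set (Space n)} {C : Set (Space n)}
    (h : TendstoL1Loc E C) (hE : ∀ k, NullMeasurableSet (E k) volume)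
    (hC : NullMeasurableSet C volume) {K : Space n → ℝ} (hK : Integrable K) :
    Tendsto (fun k => ∫ x, chi (E k) x * K x) atTop (𝓝 (∫ x, chi C x * K x)) := by
  have hi : ∀ {F : Set (Space n)}, NullMeasurableSet F volume →
      Integrable (fun x => chi F x * K x) := fun {F} hF =>
    hK.bdd_mul (c := 1) (aestronglyMeasurable_chi hF) (ae_of_all _ fun x => abs_chi_le F x)
  rw [tendsto_iff_edist_tendsto_0]
  refine tendsto_of_tendsto_of_tendsto_of_le_of_le tendsto_const_nhds
    (h.tendsto_setLIntegral hK.hasFiniteIntegral.ne) (fun _ => zero_le) fun k => ?_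
  dsimp only
  rw [edist_eq_enorm_sub, ← integral_sub (hi (hE k)) (hi hC)]
  refine (enorm_integral_le_lintegral_enorm _).trans ?_
  simp_rw [enorm_chi_sub_mul]
  exact lintegral_indicator_le _ _

lemma rsq_smul (c : ℝ) (p : Space n × ℝ) : rsq (c • p) = c ^ 2 * rsq p := by
  simp only [rsq, Prod.smul_fst, Prod.smul_snd, norm_smul, mul_pow, Real.norm_eq_abs, sq_abs,
    smul_eq_mul]
  ring

/-- The Poisson kernel is homogeneous of degree -n. -/
lemma pkerD_smul_smul {c : ℝ} (hc : 0 < c) {p : Space n × ℝ} (hp : 0 < p.2) (h : Space n × ℝ) :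
    pkerD s (c • p) (c • h) = (c ^ n)⁻¹ * pkerD s p h := by
  have hq := rsq_nonneg p
  have e1 : ∀ t : ℝ, (c ^ 2 * rsq p) ^ t = c ^ (2 * t) * rsq p ^ t := fun t => by
    rw [Real.mul_rpow (by positivity) hq, ← Real.rpow_natCast, ← Real.rpow_mul hc.le]
    norm_num
  have e2 : rdot (c • p) (c • h) = c ^ 2 * rdot p h := by
    simp only [rdot_apply, Prod.smul_fst, Prod.smul_snd, inner_smul_left, inner_smul_right,
      smul_eq_mul, conj_trivial]
    ring
  have e3 : (c ^ n)⁻¹ = c ^ (-(n : ℝ)) := by rw [Real.rpow_neg hc.le, Real.rpow_natCast]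
  simp only [pkerD, rker, sub_apply, smul_apply, smul_eq_mul, ContinuousLinearMap.coe_snd',
    rsq_smul, e1, e2, Prod.smul_snd, Real.mul_rpow hc.le hp.le]
  have r1 : c ^ (s - 1) * c ^ (2 * (-((n : ℝ) + s) / 2)) * c = c ^ (-(n : ℝ)) := by
    rw [← Real.rpow_add hc, ← Real.rpow_add_one hc.ne']
    congr 1
    ring
  have r2 : c ^ s * c ^ (2 * (-((n : ℝ) + s) / 2 - 1)) * c ^ 2 = c ^ (-(n : ℝ)) := by
    rw [← Real.rpow_natCast c 2, ← Real.rpow_add hc, ← Real.rpow_add hc]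
    congr 1
    push_cast
    ring
  rw [e3]
  generalize rsq p ^ (-((n : ℝ) + s) / 2 - 1) = A at *
  generalize rsq p ^ (-((n : ℝ) + s) / 2) = B at *
  generalize c ^ (2 * (-((n : ℝ) + s) / 2 - 1)) = A' at *
  generalize c ^ (2 * (-((n : ℝ) + s) / 2)) = B' at *
  linear_combination (s * p.2 ^ (s - 1) * B * h.2) * r1 - ((n + s) * p.2 ^ s * A * rdot p h) * r2

/-- The extension commutes with dilations, so X·∇u is invariant under scaling. -/
lemma extD_smul_chi (hs : 0 < s) {E : Set (Space n)} (hE : NullMeasurableSet E volume) {c : ℝ}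
    (hc : 0 < c) {p : Space n × ℝ} (hp : 0 < p.2) :
    extD s (chi (c • E)) (c • p) (c • p) = extD s (chi E) p p := by
  have hp' : 0 < (c • p).2 := mul_pos hc hp
  rw [extD_apply hs (aestronglyMeasurable_chi (Measure.NullMeasurableSet.const_smul hE c)) (abs_chi_le _) hp',
    extD_apply hs (aestronglyMeasurable_chi hE) (abs_chi_le _) hp]
  have h1 := Measure.integral_comp_smul (volume : Measure (Space n))
    (fun y => chi (c • E) y * pkerD s (shift y (c • p)) (c • p)) c
  rw [finrank_euclideanSpace_fin, abs_of_pos (by positivity), smul_eq_mul] at h1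
  have h2 : ∀ y, chi (c • E) (c • y) * pkerD s (shift (c • y) (c • p)) (c • p) =
      (c ^ n)⁻¹ * (chi E y * pkerD s (shift y p) p) := fun y => by
    have e1 : chi (c • E) (c • y) = chi E y := by
      by_cases h : y ∈ E
      · rw [chi_of_mem h, chi_of_mem (Set.smul_mem_smul_set h)]
      · rw [chi_of_notMem h, chi_of_notMem fun h' => h ((Set.smul_mem_smul_set_iff₀ hc.ne' _ _).1 h')]
    have e2 : shift (c • y) (c • p) = c • shift y p := by
      ext
      · simp [shift, smul_sub]
      · simp [shift]
    rw [e1, e2, pkerD_smul_smul hc (p := shift y p) hp]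
    ring
  simp_rw [h2] at h1
  rw [integral_const_mul] at h1
  exact (mul_left_cancel₀ (by positivity) h1).symm

lemma rdens_smul_chi (hs : 0 < s) {E : Set (Space n)} (hE : NullMeasurableSet E volume) {c : ℝ}
    (hc : 0 < c) {p : Space n × ℝ} (hp : 0 < p.2) :
    rdens s (chi (c • E)) (c • p) = c ^ (1 - s) * rdens s (chi E) p := by
  rw [rdens, rdens, extD_smul_chi hs hE hc hp, Prod.smul_snd, smul_eq_mul,
    Real.mul_rpow hc.le hp.le, mul_assoc]

lemma smul_mem_halfBall {c a : ℝ} (hc : 0 < c) {p : Space n × ℝ} :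
    c • p ∈ halfBall n (c * a) ↔ p ∈ halfBall n a := by
  simp only [halfBall, Set.mem_ofPred_eq, Prod.smul_snd, smul_eq_mul, rsq_smul, mul_pow]
  rw [mul_pos_iff_of_pos_left hc, mul_lt_mul_iff_right₀ (by positivity)]

/-- The exponent is 1 - s from the weight plus n + 1 from the volume. It matches the normalisation
a^(s-n-2) under which the radial energy tends to 0. -/
lemma rdens_scaling (hs : 0 < s) {E : Set (Space n)} (hE : NullMeasurableSet E volume) {c a : ℝ}
    (hc : 0 < c) (hi : IntegrableOn (rdens s (chi E)) (halfBall n a)) :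
    IntegrableOn (rdens s (chi (c • E))) (halfBall n (c * a)) ∧
    ∫ p in halfBall n (c * a), rdens s (chi (c • E)) p =
      c ^ ((n : ℝ) + 2 - s) * ∫ p in halfBall n a, rdens s (chi E) p := by
  have mB : ∀ a, MeasurableSet (halfBall n a) := fun a => (isOpen_halfBall a).measurableSet
  have e : (fun p => (halfBall n (c * a)).indicator (rdens s (chi (c • E))) (c • p)) =
      (halfBall n a).indicator fun p => c ^ (1 - s) * rdens s (chi E) p := by
    ext p
    by_cases h : p ∈ halfBall n a
    · rw [Set.indicator_of_mem h, Set.indicator_of_mem ((smul_mem_halfBall hc).2 h),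
        rdens_smul_chi hs hE hc h.1]
    · rw [Set.indicator_of_notMem h,
        Set.indicator_of_notMem fun h' => h ((smul_mem_halfBall hc).1 h')]
  have hd : Module.finrank ℝ (Space n × ℝ) = n + 1 := by simp
  constructor
  · rw [← integrable_indicator_iff (mB _), ← integrable_comp_smul_iff volume _ hc.ne', e,
      integrable_indicator_iff (mB _)]
    exact Integrable.const_mul hi _
  · have h1 := Measure.integral_comp_smul (volume : Measure (Space n × ℝ))
      ((halfBall n (c * a)).indicator (rdens s (chi (c • E)))) c
    rw [e, integral_indicator (mB _), integral_indicator (mB _), integral_const_mul, hd,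
      abs_of_pos (by positivity), smul_eq_mul, inv_mul_eq_div, eq_div_iff (by positivity)] at h1
    rw [← h1]
    have : c ^ ((n : ℝ) + 2 - s) = c ^ (1 - s) * c ^ (n + 1) := by
      rw [← Real.rpow_natCast, ← Real.rpow_add hc]
      congr 1
      push_cast
      ring
    rw [this]
    ring

/-! ### The blow-up limit is a cone -/

/-- Blow-up limits of minimizers have radially constant extensions. -/
lemma extD_apply_self_eq_zero (hn : 0 < n) (hs : 0 < s) (hs1 : s < 1) {E C : Set (Space n)}
    {ρ : ℝ} (hρ : 0 < ρ) (hE : IsMinimizer s (ball 0 ρ) E) (hfin : energy s (ball 0 ρ) E ≠ ∞)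
    (hC : NullMeasurableSet C volume) {l : ℕ → ℝ} (hl0 : ∀ k, 0 < l k) (hl : Tendsto l atTop atTop)
    (hlim : TendstoL1Loc (fun k => l k • E) C) {p : Space n × ℝ} (hp : p ∈ upper n) :
    extD s (chi C) p p = 0 := by
  have hEm := hE.nullMeasurableSet
  set R : ℝ := √(rsq p) + 1 with hR
  have hR0 : 0 < R := by positivity
  have hpR : p ∈ halfBall n R := ⟨hp, by
    have h1 := Real.sq_sqrt (rsq_nonneg p)
    have h2 := Real.sqrt_nonneg (rsq p)
    nlinarith⟩
  have mB := (isOpen_halfBall (n := n) R).measurableSet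
  have hEk : ∀ k, NullMeasurableSet (l k • E) volume := fun k => Measure.NullMeasurableSet.const_smul hEm _
  have hcont : ∀ {F : Set (Space n)}, NullMeasurableSet F volume →
      ContinuousOn (rdens s (chi F)) (halfBall n R) := fun {F} hF =>
    (continuousOn_rdens hs (aestronglyMeasurable_chi hF) (abs_chi_le F)).mono
      (halfBall_subset_upper R)
  have ha : Tendsto (fun k => R / l k) atTop (𝓝[>] 0) :=
    tendsto_nhdsWithin_iff.2 ⟨tendsto_const_nhds.div_atTop hl,
      Eventually.of_forall fun k => div_pos hR0 (hl0 k)⟩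
  have h1 := ((hE.tendsto_rdens hn hs hs1 hρ hfin).comp ha).const_mul (R ^ ((n : ℝ) + 2 - s))
  rw [mul_zero] at h1
  have h2 : ∀ᶠ k in atTop, ENNReal.ofReal (R ^ ((n : ℝ) + 2 - s) * ((R / l k) ^ (s - n - 2) *
      ∫ p in halfBall n (R / l k), rdens s (chi E) p)) =
      ∫⁻ p in halfBall n R, ENNReal.ofReal (rdens s (chi (l k • E)) p) := by
    filter_upwards [(ha.mono_right nhdsWithin_le_nhds).eventually (gt_mem_nhds hρ)] with k hk
    have hd := integrableOn_dens hs hs1 (aestronglyMeasurable_chi hEm) (abs_chi_le E)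
      (div_pos hR0 (hl0 k)) hk ((finiteOn_chi_iff hEm measurableSet_ball).2 hfin)
    obtain ⟨h3, h4⟩ := rdens_scaling hs hEm (hl0 k)
      (integrableOn_rdens hs (aestronglyMeasurable_chi hEm) (abs_chi_le E) hd)
    rw [mul_div_cancel₀ R (hl0 k).ne'] at h3 h4
    rw [← ofReal_integral_eq_lintegral_ofReal h3 ((ae_restrict_mem mB).mono
      fun p hp => rdens_nonneg hp.1), h4, ← mul_assoc]
    congr 2
    rw [Real.div_rpow hR0.le (hl0 k).le, ← mul_div_assoc, ← Real.rpow_add hR0,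
      show (n : ℝ) + 2 - s + (s - n - 2) = 0 by ring, Real.rpow_zero, one_div,
      ← Real.rpow_neg (hl0 k).le]
    congr 1
    ring
  have h3 : Tendsto (fun k => ∫⁻ p in halfBall n R, ENNReal.ofReal (rdens s (chi (l k • E)) p))
      atTop (𝓝 0) := by
    have := ENNReal.tendsto_ofReal h1
    rw [ENNReal.ofReal_zero] at this
    exact this.congr' h2
  have h4 : ∀ q ∈ halfBall n R, Tendsto (fun k => ENNReal.ofReal (rdens s (chi (l k • E)) q)) atTop
      (𝓝 (ENNReal.ofReal (rdens s (chi C) q))) := by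
    intro q hq
    refine ENNReal.tendsto_ofReal ((Tendsto.pow ?_ 2).const_mul _)
    rw [extD_apply hs (aestronglyMeasurable_chi hC) (abs_chi_le C) hq.1]
    refine (hlim.tendsto_integral_chi_mul hEk hC (K := fun y => pkerD s (shift y q) q)
      ((integrable_pkerD_shift hs hq.1).apply_continuousLinearMap q)).congr fun k => ?_
    rw [extD_apply hs (aestronglyMeasurable_chi (hEk k)) (abs_chi_le _) hq.1]
  -- Fatou's lemma: the radial densities converge pointwise and their integrals tend to 0.
  have h5 : ∫⁻ q in halfBall n R, ENNReal.ofReal (rdens s (chi C) q) = 0 := by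
    refine le_antisymm ?_ zero_le
    calc ∫⁻ q in halfBall n R, ENNReal.ofReal (rdens s (chi C) q)
        = ∫⁻ q in halfBall n R, liminf (fun k => ENNReal.ofReal (rdens s (chi (l k • E)) q)) atTop :=
          setLIntegral_congr_fun mB fun q hq => (h4 q hq).liminf_eq.symm
      _ ≤ _ := lintegral_liminf_le' fun k =>
          ((hcont (hEk k)).aestronglyMeasurable mB).aemeasurable.ennreal_ofReal
      _ = 0 := h3.liminf_eq
  rw [lintegral_eq_zero_iff' ((hcont hC).aestronglyMeasurable mB).aemeasurable.ennreal_ofReal] at h5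
  have h6 : rdens s (chi C) =ᵐ[volume.restrict (halfBall n R)] fun _ => 0 := by
    filter_upwards [h5, ae_restrict_mem mB] with q hq hq'
    exact le_antisymm (ENNReal.ofReal_eq_zero.1 hq) (rdens_nonneg hq'.1)
  -- Continuity upgrades vanishing almost everywhere to vanishing at the given point.
  have h7 := Measure.eqOn_open_of_ae_eq h6 (isOpen_halfBall R) (hcont hC) continuousOn_const hpR
  rw [rdens] at h7
  exact pow_eq_zero_iff two_ne_zero |>.1
    ((mul_eq_zero.1 h7).resolve_left (Real.rpow_pos_of_pos hp _).ne')

/-- A set whose extension is radially constant is a cone. -/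
lemma chi_smul_ae_eq (hs : 0 < s) {C : Set (Space n)} (hC : NullMeasurableSet C volume)
    (h : ∀ p ∈ upper n, extD s (chi C) p p = 0) {t : ℝ} (ht : 0 < t) :
    ∀ᵐ x : Space n, chi C (t • x) = chi C x := by
  have mC := aestronglyMeasurable_chi hC
  have bC := abs_chi_le C
  -- The derivative of τ ↦ u(τp) is τ⁻¹ times the radial derivative at τp, hence zero.
  have hconst : ∀ p ∈ upper n, ext s (chi C) (t • p) = ext s (chi C) p := by
    intro p hp
    have hd : ∀ τ ∈ Set.Ioi (0 : ℝ), HasDerivAt (fun τ : ℝ => ext s (chi C) (τ • p)) 0 τ := by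
      intro τ hτ
      have hτp : τ • p ∈ upper n := mul_pos (a := τ) (b := p.2) hτ hp
      have h1 := (hasFDerivAt_ext hs mC bC hτp).comp_hasDerivAt τ
        ((hasDerivAt_id τ).smul_const p)
      refine h1.congr_deriv ?_
      have h2 := h _ hτp
      rw [map_smul, smul_eq_mul] at h2
      rw [one_smul]
      exact (mul_eq_zero.1 h2).resolve_left (ne_of_gt hτ)
    have := (convex_Ioi (0 : ℝ)).is_const_of_fderivWithin_eq_zero (𝕜 := ℝ)
      (f := fun τ : ℝ => ext s (chi C) (τ • p))
      (fun τ hτ => (hd τ hτ).differentiableAt.differentiableWithinAt) (fun τ hτ => by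
        rw [fderivWithin_of_isOpen isOpen_Ioi hτ, (hd τ hτ).hasFDerivAt.fderiv]
        ext
        simp) (Set.mem_Ioi.2 ht) (Set.mem_Ioi.2 one_pos)
    simpa using this
  have htr := ae_tendsto_ext hs mC bC
  have htr' : ∀ᵐ x : Space n, ∀ (w : ℝ → Space n) (δ : ℝ → ℝ) (K : ℝ),
      Tendsto δ (𝓝[>] 0) (𝓝[>] 0) → (∀ᶠ ε in 𝓝[>] (0 : ℝ), ‖w ε - t • x‖ ≤ K * δ ε) →
      Tendsto (fun ε => ext s (chi C) (w ε, δ ε)) (𝓝[>] 0) (𝓝 (kappa n s * chi C (t • x))) :=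
    (Measure.quasiMeasurePreserving_smul volume ht.ne').ae htr
  filter_upwards [htr, htr'] with x hx hx'
  have h1 := hx (fun _ => x) (fun ε => ε) 0 tendsto_id (Eventually.of_forall fun ε => by simp)
  -- The vertical approaches to x and to tx correspond under the dilation, so the two boundary
  -- values agree.
  have h2 := hx' (fun _ => t • x) (fun ε => t * ε) 0 (tendsto_nhdsWithin_iff.2 ⟨by
      have := (by fun_prop : Continuous fun a : ℝ => t * a).tendsto 0
      rw [mul_zero] at this
      exact this.mono_left nhdsWithin_le_nhds, by
      filter_upwards [self_mem_nhdsWithin] with a ha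
      exact mul_pos ht ha⟩) (Eventually.of_forall fun ε => by simp)
  have h3 : Tendsto (fun ε => ext s (chi C) (t • x, t * ε)) (𝓝[>] 0)
      (𝓝 (kappa n s * chi C x)) := by
    refine h1.congr' ?_
    filter_upwards [self_mem_nhdsWithin] with ε hε
    exact (hconst (x, ε) hε).symm
  exact mul_left_cancel₀ (kappa_pos hs).ne' (tendsto_nhds_unique h2 h3)

/-! ### Finiteness of the energy of minimizers -/

/-- Where |x - y| ≥ d one has |x - y|² + d² ≤ 2|x - y|². The known mass d^(-s) κ of the radial
kernel at height d then bounds the tail of the interaction kernel. -/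
lemma kern_le_rker (hs : 0 < s) {x y : Space n} {d : ℝ} (hd : 0 < d) (h : d ≤ ‖x - y‖) :
    kern s (x - y) ≤ 2 ^ (((n : ℝ) + s) / 2) * rker s (shift y (x, d)) := by
  have hw : 0 < ‖x - y‖ := hd.trans_le h
  have hns : 0 < (n : ℝ) + s := by positivity
  have e1 : kern s (x - y) = 2 ^ (((n : ℝ) + s) / 2) * (2 * ‖x - y‖ ^ 2) ^ (-((n : ℝ) + s) / 2) := by
    rw [Real.mul_rpow (by norm_num) (by positivity), ← mul_assoc,
      ← Real.rpow_add (by norm_num : (0 : ℝ) < 2), ← Real.rpow_natCast, ← Real.rpow_mul hw.le, kern,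
      one_div, ← Real.rpow_neg hw.le]
    rw [show ((n : ℝ) + s) / 2 + -((n : ℝ) + s) / 2 = 0 by ring, Real.rpow_zero, one_mul]
    congr 1
    push_cast
    ring
  rw [e1]
  refine mul_le_mul_of_nonneg_left ?_ (by positivity)
  refine Real.rpow_le_rpow_of_nonpos (rsq_pos hd) ?_ (by linarith)
  simp only [rsq, shift_fst, shift_snd]
  have := pow_le_pow_left₀ hd.le h 2
  linarith

lemma lintegral_kern_le (hs : 0 < s) {x : Space n} {d : ℝ} (hd : 0 < d) {A : Set (Space n)}
    (hA : MeasurableSet A) (h : ∀ y ∈ A, d ≤ ‖x - y‖) :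
    ∫⁻ y in A, ENNReal.ofReal (kern s (x - y)) ≤
      ENNReal.ofReal (2 ^ (((n : ℝ) + s) / 2) * kappa n s * d ^ (-s)) := by
  have hi := (integrable_rker_shift (s := s) hs (p := (x, d)) hd).const_mul (2 ^ (((n : ℝ) + s) / 2))
  calc ∫⁻ y in A, ENNReal.ofReal (kern s (x - y))
      ≤ ∫⁻ y in A, ENNReal.ofReal (2 ^ (((n : ℝ) + s) / 2) * rker s (shift y (x, d))) :=
        setLIntegral_mono' hA fun y hy => ENNReal.ofReal_le_ofReal (kern_le_rker hs hd (h y hy))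
    _ ≤ ∫⁻ y, ENNReal.ofReal (2 ^ (((n : ℝ) + s) / 2) * rker s (shift y (x, d))) :=
        setLIntegral_le_lintegral _ _
    _ = _ := by
        rw [← ofReal_integral_eq_lintegral_ofReal hi (ae_of_all _ fun y =>
          mul_nonneg (by positivity) (rker_nonneg _)), integral_const_mul,
          integral_rker_shift (p := (x, d)) hd]
        congr 1
        ring

/-- Balls have finite nonlocal perimeter. -/
lemma interaction_ball_compl_ne_top (hn : 0 < n) (hs : 0 < s) (hs1 : s < 1) {R : ℝ} (hR : 0 < R) :
    interaction s (ball (0 : Space n) R) (ball 0 R)ᶜ ≠ ∞ := by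
  have : Nonempty (Fin n) := ⟨⟨0, hn⟩⟩
  -- Each x in the ball is at distance at least R - ‖x‖ from the complement, which costs (R -
  -- ‖x‖)^(-s). Polar coordinates reduce this to one dimension, where s < 1 gives integrability.
  have hi : IntegrableOn (fun x : Space n => (R - ‖x‖) ^ (-s)) (ball 0 R) := by
    rw [integrableOn_fun_norm_addHaar volume (f := fun y => (R - y) ^ (-s))]
    have h1 : IntegrableOn (fun y : ℝ => (R - y) ^ (-s)) (Set.Ioo 0 R) := by
      have h2 := intervalIntegral.intervalIntegrable_rpow' (a := 0) (b := R) (r := -s) (by linarith)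
      have h3 := (h2.comp_sub_left R)
      rw [sub_zero, sub_self] at h3
      exact ((intervalIntegrable_iff_integrableOn_Ioo_of_le hR.le).1 h3.symm)
    refine (Integrable.const_mul h1 (R ^ (n - 1))).mono' ?_ ?_
    · exact (by fun_prop : Continuous fun y : ℝ => y ^ (Module.finrank ℝ (Space n) - 1)
        ).aestronglyMeasurable.smul h1.aestronglyMeasurable
    · filter_upwards [ae_restrict_mem measurableSet_Ioo] with y hy
      have h4 : 0 ≤ (R - y) ^ (-s) := Real.rpow_nonneg (by linarith [hy.2]) _
      rw [norm_smul, Real.norm_of_nonneg h4, norm_pow, Real.norm_of_nonneg hy.1.le,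
        finrank_euclideanSpace_fin]
      exact mul_le_mul_of_nonneg_right (pow_le_pow_left₀ hy.1.le hy.2.le _) h4
  have hi' := (Integrable.const_mul hi (2 ^ (((n : ℝ) + s) / 2) * kappa n s)).lintegral_lt_top
  refine (lt_of_le_of_lt ?_ hi').ne
  rw [interaction_eq]
  refine setLIntegral_mono' measurableSet_ball fun x hx => ?_
  rw [mem_ball_zero_iff] at hx
  refine lintegral_kern_le hs (by linarith) measurableSet_ball.compl fun y hy => ?_
  rw [Set.mem_compl_iff, mem_ball_zero_iff, not_lt] at hy
  have := norm_sub_norm_le y x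
  rw [norm_sub_rev] at this
  linarith

/-- Comparison with E \ Ω, whose energy is at most the interaction of Ω with its complement. -/
lemma energy_ne_top_of_isMinimizer {Ω E : Set (Space n)} (hΩ : MeasurableSet Ω)
    (hfin : interaction s Ω Ωᶜ ≠ ∞) (hE : IsMinimizer s Ω E) : energy s Ω E ≠ ∞ := by
  have h1 := hE.energy_le (E \ Ω) (hE.nullMeasurableSet.diff hΩ.nullMeasurableSet) (by
    ext x; simp only [Set.mem_inter_iff, Set.mem_sdiff, Set.mem_compl_iff]; tauto)
  refine ne_top_of_le_ne_top hfin (h1.trans ?_)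
  have h2 : (E \ Ω) ∩ Ω = ∅ := by ext x; simp
  rw [energy, h2, interaction_comm Ω]
  have h3 : interaction s (∅ : Set (Space n)) (E \ Ω)ᶜ = 0 := by simp [interaction]
  rw [h3, zero_add]
  exact interaction_mono (fun x hx => hx.1.2) fun x hx => hx.2

/-! ### Restriction and dilation of minimizers -/

/-- Twice the energy is the integral of the variation over the pairs which meet `Ω`. -/
lemma two_mul_energy_eq {E Ω : Set (Space n)} (hE : NullMeasurableSet E volume)
    (hΩ : MeasurableSet Ω) : 2 * energy s Ω E =
    ∫⁻ p in (Ωᶜ ×ˢ Ωᶜ)ᶜ, ‖|chi E p.1 - chi E p.2| * kern s (p.1 - p.2)‖ₑ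
      ∂((volume : Measure (Space n)).prod volume) := by
  have h1 : (Ωᶜ ×ˢ Ωᶜ)ᶜ = (Ω ×ˢ Ω ∪ Ω ×ˢ Ωᶜ) ∪ Ωᶜ ×ˢ Ω := by
    ext p
    simp only [Set.mem_compl_iff, Set.mem_prod, Set.mem_union]
    tauto
  have d1 : Disjoint (Ω ×ˢ Ω ∪ Ω ×ˢ Ωᶜ) (Ωᶜ ×ˢ Ω) := by
    rw [Set.disjoint_left]
    rintro p (hp | hp) hp'
    · exact hp'.1 hp.1
    · exact hp'.1 hp.1
  have d2 : Disjoint (Ω ×ˢ Ω) (Ω ×ˢ Ωᶜ) := by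
    rw [Set.disjoint_left]
    exact fun p hp hp' => hp'.2 hp.2
  have h2 : variation s E Ωᶜ Ω = variation s E Ω Ωᶜ := by
    rw [variation_eq hE _ _ hΩ.compl hΩ, variation_eq hE _ _ hΩ hΩ.compl,
      interaction_comm (Ωᶜ ∩ E), interaction_comm (Ωᶜ \ E), add_comm]
  rw [h1, lintegral_union (hΩ.compl.prod hΩ) d1, lintegral_union (hΩ.prod hΩ.compl) d2,
    ← Measure.prod_restrict, ← Measure.prod_restrict, ← Measure.prod_restrict,
    lintegral_diff_kern hE, lintegral_diff_kern hE, lintegral_diff_kern hE, h2,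
    two_mul_energy hE hΩ]
  ring

/-- Pairs with both points off Ω contribute equally to E and to F. Their contribution is finite by
`hfin`, so it cancels from the inequality in Ω'. -/
lemma IsMinimizer.mono {Ω Ω' E : Set (Space n)} (hΩ : MeasurableSet Ω) (hΩ' : MeasurableSet Ω')
    (hsub : Ω ⊆ Ω') (hE : IsMinimizer s Ω' E) (hfin : energy s Ω' E ≠ ∞) : IsMinimizer s Ω E := by
  refine ⟨hE.nullMeasurableSet, fun F hF hFE => ?_⟩
  have hmem : ∀ x, x ∉ Ω → (x ∈ F ↔ x ∈ E) := fun x hx => by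
    have := congrArg (x ∈ ·) hFE
    simpa [hx] using this
  have h1 := hE.energy_le F hF (by
    ext x
    simp only [Set.mem_inter_iff, Set.mem_compl_iff, and_congr_left_iff]
    exact fun hx => hmem x fun hx' => hx (hsub hx'))
  have mQ : MeasurableSet (Ωᶜ ×ˢ Ωᶜ)ᶜ := (hΩ.compl.prod hΩ.compl).compl
  have hQ : (Ωᶜ ×ˢ Ωᶜ)ᶜ ⊆ (Ω'ᶜ ×ˢ Ω'ᶜ)ᶜ := Set.compl_subset_compl.2
    (Set.prod_mono (Set.compl_subset_compl.2 hsub) (Set.compl_subset_compl.2 hsub))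
  have hsplit : ∀ {G : Set (Space n)}, NullMeasurableSet G volume → 2 * energy s Ω' G =
      2 * energy s Ω G + ∫⁻ p in (Ω'ᶜ ×ˢ Ω'ᶜ)ᶜ \ (Ωᶜ ×ˢ Ωᶜ)ᶜ,
        ‖|chi G p.1 - chi G p.2| * kern s (p.1 - p.2)‖ₑ
        ∂((volume : Measure (Space n)).prod volume) := fun {G} hG => by
    rw [two_mul_energy_eq hG hΩ', two_mul_energy_eq hG hΩ,
      ← lintegral_inter_add_sdiff _ (Ω'ᶜ ×ˢ Ω'ᶜ)ᶜ mQ, Set.inter_eq_right.2 hQ]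
  have hrest : ∫⁻ p in (Ω'ᶜ ×ˢ Ω'ᶜ)ᶜ \ (Ωᶜ ×ˢ Ωᶜ)ᶜ,
        ‖|chi F p.1 - chi F p.2| * kern s (p.1 - p.2)‖ₑ
        ∂((volume : Measure (Space n)).prod volume) =
      ∫⁻ p in (Ω'ᶜ ×ˢ Ω'ᶜ)ᶜ \ (Ωᶜ ×ˢ Ωᶜ)ᶜ,
        ‖|chi E p.1 - chi E p.2| * kern s (p.1 - p.2)‖ₑ
        ∂((volume : Measure (Space n)).prod volume) := by
    have hchi : ∀ x, x ∉ Ω → chi F x = chi E x := fun x hx => by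
      by_cases h : x ∈ E
      · rw [chi_of_mem h, chi_of_mem ((hmem x hx).2 h)]
      · rw [chi_of_notMem h, chi_of_notMem fun h' => h ((hmem x hx).1 h')]
    refine setLIntegral_congr_fun ((hΩ'.compl.prod hΩ'.compl).compl.diff mQ) fun p hp => ?_
    have hp2 : p ∈ Ωᶜ ×ˢ Ωᶜ := not_not.1 hp.2
    simp only [hchi _ hp2.1, hchi _ hp2.2]
  have h2 := mul_le_mul_right h1 2
  rw [hsplit hE.nullMeasurableSet, hsplit hF, hrest] at h2
  have h3 : ∫⁻ p in (Ω'ᶜ ×ˢ Ω'ᶜ)ᶜ \ (Ωᶜ ×ˢ Ωᶜ)ᶜ,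
        ‖|chi E p.1 - chi E p.2| * kern s (p.1 - p.2)‖ₑ
        ∂((volume : Measure (Space n)).prod volume) ≠ ∞ := by
    refine ne_top_of_le_ne_top (ENNReal.mul_ne_top (ENNReal.ofNat_ne_top (n := 2)) hfin) ?_
    rw [hsplit hE.nullMeasurableSet]
    exact le_add_self
  exact (ENNReal.mul_le_mul_iff_right two_ne_zero (by norm_num)).1
    ((ENNReal.add_le_add_iff_right h3).1 h2)

lemma setLIntegral_smul {c : ℝ} (hc : 0 < c) (A : Set (Space n)) (f : Space n → ℝ≥0∞) :
    ∫⁻ x in c • A, f x = ENNReal.ofReal (c ^ n) * ∫⁻ x in A, f (c • x) := by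
  set e : Space n ≃ᵐ Space n := (Homeomorph.smulOfNeZero c hc.ne').toMeasurableEquiv with he
  have he' : ∀ x, e x = c • x := fun x => rfl
  have h1 : Measure.map e volume = ENNReal.ofReal ((c ^ n)⁻¹) • (volume : Measure (Space n)) := by
    have := Measure.map_addHaar_smul (volume : Measure (Space n)) hc.ne'
    rw [finrank_euclideanSpace_fin, abs_of_pos (by positivity)] at this
    exact this
  have h2 : e ⁻¹' (c • A) = A := by
    ext x
    simp only [Set.mem_preimage, he']
    exact Set.smul_mem_smul_set_iff₀ hc.ne' _ _
  have h3 : ∫⁻ x in A, f (c • x) = ENNReal.ofReal ((c ^ n)⁻¹) * ∫⁻ x in c • A, f x := by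
    have h4 : ∫⁻ x in A, f (c • x) = ∫⁻ x, f x ∂((Measure.map e volume).restrict (c • A)) := by
      rw [e.measurableEmbedding.restrict_map, lintegral_map_equiv, h2]
      rfl
    rw [h4, h1, Measure.restrict_smul, lintegral_smul_measure, smul_eq_mul]
  rw [h3, ← mul_assoc, ← ENNReal.ofReal_mul (by positivity), mul_inv_cancel₀ (by positivity),
    ENNReal.ofReal_one, one_mul]

lemma kern_smul {c : ℝ} (hc : 0 < c) (x : Space n) :
    kern s (c • x) = c ^ (-((n : ℝ) + s)) * kern s x := by
  rw [kern, kern, norm_smul, Real.norm_of_nonneg hc.le, Real.mul_rpow hc.le (norm_nonneg _),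
    Real.rpow_neg hc.le]
  simp only [one_div, mul_inv]

lemma interaction_smul {c : ℝ} (hc : 0 < c) (A B : Set (Space n)) :
    interaction s (c • A) (c • B) = ENNReal.ofReal (c ^ n) * (ENNReal.ofReal (c ^ n) *
      (ENNReal.ofReal (c ^ (-((n : ℝ) + s))) * interaction s A B)) := by
  simp only [interaction_eq]
  rw [setLIntegral_smul hc]
  simp_rw [setLIntegral_smul hc, ← smul_sub, kern_smul hc,
    ENNReal.ofReal_mul (Real.rpow_nonneg hc.le (-((n : ℝ) + s)))]
  simp_rw [lintegral_const_mul' _ _ ENNReal.ofReal_ne_top]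

/-- The factor amounts to c^(n-s). It is left as a product because only its independence of the sets
matters. -/
lemma energy_smul {c : ℝ} (hc : 0 < c) (Ω E : Set (Space n)) :
    energy s (c • Ω) (c • E) = ENNReal.ofReal (c ^ n) * (ENNReal.ofReal (c ^ n) *
      (ENNReal.ofReal (c ^ (-((n : ℝ) + s))) * energy s Ω E)) := by
  have h1 : (c • E)ᶜ = c • Eᶜ := by
    rw [Set.compl_eq_univ_sdiff, Set.compl_eq_univ_sdiff, Set.smul_set_sdiff₀ hc.ne',
      Set.smul_set_univ₀ hc.ne']
  rw [energy, h1, ← Set.smul_set_inter₀ hc.ne', ← Set.smul_set_inter₀ hc.ne',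
    ← Set.smul_set_sdiff₀ hc.ne', interaction_smul hc, interaction_smul hc, energy]
  ring

lemma IsMinimizer.smul {c : ℝ} (hc : 0 < c) {Ω E : Set (Space n)} (hE : IsMinimizer s Ω E) :
    IsMinimizer s (c • Ω) (c • E) := by
  refine ⟨Measure.NullMeasurableSet.const_smul hE.nullMeasurableSet c, fun F hF hFE => ?_⟩
  have h1 : c • c⁻¹ • F = F := smul_inv_smul₀ hc.ne' F
  rw [← h1, energy_smul hc, energy_smul hc]
  gcongr
  refine hE.energy_le _ (Measure.NullMeasurableSet.const_smul hF c⁻¹) ?_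
  have h2 := congrArg (c⁻¹ • ·) hFE
  have h3 : (c • Ω)ᶜ = c • Ωᶜ := by
    rw [Set.compl_eq_univ_sdiff, Set.compl_eq_univ_sdiff, Set.smul_set_sdiff₀ hc.ne',
      Set.smul_set_univ₀ hc.ne']
  simp only [h3, Set.smul_set_inter₀ (inv_ne_zero hc.ne'), inv_smul_smul₀ hc.ne'] at h2
  exact h2

/-! ### Limits of minimizers -/

lemma TendstoL1Loc.exists_seq_tendsto_ae {E : ℕ → Set (Space n)} {C : Set (Space n)}
    (h : TendstoL1Loc E C) :
    ∃ φ : ℕ → ℕ, StrictMono φ ∧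
      ∀ᵐ x : Space n, Tendsto (fun k => chi (E (φ k)) x) atTop (𝓝 (chi C x)) := by
  -- Weighting Lebesgue measure by a positive integrable density gives a finite measure with the
  -- same null sets. There L¹_loc convergence implies convergence in measure, hence almost
  -- everywhere along a subsequence.
  set f : Space n → ℝ := fun x => (1 + ‖x‖) ^ (-((n : ℝ) + 1)) with hf
  have hi : Integrable f := integrable_one_add_norm (by simp)
  have hfin := hi.lintegral_lt_top.ne
  have hpos : ∀ x, ENNReal.ofReal (f x) ≠ 0 := fun x => by
    rw [ENNReal.ofReal_ne_zero_iff]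
    exact Real.rpow_pos_of_pos (by positivity) _
  have hm : Measurable fun x => ENNReal.ofReal (f x) := by
    have : Measurable f := by fun_prop
    exact this.ennreal_ofReal
  set ν := (volume : Measure (Space n)).withDensity fun x => ENNReal.ofReal (f x) with hν
  have htm : TendstoInMeasure ν (fun k => chi (E k)) atTop (chi C) := by
    intro ε hε
    refine tendsto_of_tendsto_of_tendsto_of_le_of_le tendsto_const_nhds
      (h.tendsto_setLIntegral hfin) (fun _ => zero_le) fun k => ?_
    rw [← withDensity_apply']
    refine measure_mono fun x hx => ?_
    by_contra hx'
    have : chi (E k) x = chi C x := by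
      rw [Set.mem_symmDiff] at hx'
      by_cases h1 : x ∈ C
      · rw [chi_of_mem h1, chi_of_mem (by tauto)]
      · rw [chi_of_notMem h1, chi_of_notMem (by tauto)]
    simp only [Set.mem_ofPred_eq, this, edist_self] at hx
    exact absurd hε (not_lt.2 hx)
  obtain ⟨φ, hφ, hae⟩ := htm.exists_seq_tendsto_ae
  exact ⟨φ, hφ, (withDensity_absolutelyContinuous' hm.aemeasurable (ae_of_all _ hpos)).ae_le hae⟩

/-- Lower semicontinuity of the energy. -/
lemma two_mul_energy_le_liminf {E : ℕ → Set (Space n)} {C Ω : Set (Space n)}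
    (hE : ∀ k, NullMeasurableSet (E k) volume) (hC : NullMeasurableSet C volume)
    (hΩ : MeasurableSet Ω)
    (h : ∀ᵐ x : Space n, Tendsto (fun k => chi (E k) x) atTop (𝓝 (chi C x))) :
    2 * energy s Ω C ≤ liminf (fun k => 2 * energy s Ω (E k)) atTop := by
  simp_rw [two_mul_energy_eq (hE _) hΩ, two_mul_energy_eq hC hΩ]
  have hm : ∀ {F : Set (Space n)}, NullMeasurableSet F volume → AEMeasurable
      (fun p : Space n × Space n => ‖|chi F p.1 - chi F p.2| * kern s (p.1 - p.2)‖ₑ)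
      (((volume : Measure (Space n)).prod volume).restrict (Ωᶜ ×ˢ Ωᶜ)ᶜ) := fun {F} hF =>
    ((aestronglyMeasurable_diff_kern (s := s) (aestronglyMeasurable_chi hF)
      Measure.AbsolutelyContinuous.rfl Measure.AbsolutelyContinuous.rfl).mono_measure
      Measure.restrict_le_self).enorm
  refine le_trans (le_of_eq ?_) (lintegral_liminf_le' fun k => hm (hE k))
  refine lintegral_congr_ae (ae_restrict_of_ae ?_)
  filter_upwards [Measure.quasiMeasurePreserving_fst.ae h, Measure.quasiMeasurePreserving_snd.ae h]
    with p h1 h2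
  refine (Tendsto.liminf_eq ?_).symm
  exact (continuous_enorm.tendsto _).comp (((h1.sub h2).abs).mul_const _)

/-- The competitor which agrees with `F` in `Ω` and with `E` outside. -/
def glue (Ω F E : Set (Space n)) : Set (Space n) := F ∩ Ω ∪ E \ Ω

/-- Replacing C by E outside Ω affects only pairs with one point in Ω and the other in the symmetric
difference off Ω. Such pairs can enter either term of the energy, hence the factor 2. -/
lemma energy_glue_le {Ω F E C : Set (Space n)} (hFC : F ∩ Ωᶜ = C ∩ Ωᶜ) :
    energy s Ω (glue Ω F E) ≤ energy s Ω F + 2 * interaction s (symmDiff E C ∩ Ωᶜ) Ω := by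
  have hmem : ∀ x, x ∉ Ω → (x ∈ F ↔ x ∈ C) := fun x hx => by
    have := congrArg (x ∈ ·) hFC
    simpa [hx] using this
  set D := symmDiff E C ∩ Ωᶜ with hD
  have e1 : glue Ω F E ∩ Ω ⊆ F ∩ Ω := fun x hx => by
    simp only [glue, Set.mem_inter_iff, Set.mem_union, Set.mem_sdiff] at hx ⊢; tauto
  have e2 : (glue Ω F E)ᶜ ⊆ Fᶜ ∪ D := fun x hx => by
    have := hmem x
    simp only [glue, hD, Set.mem_compl_iff, Set.mem_inter_iff, Set.mem_union, Set.mem_sdiff,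
      Set.mem_symmDiff] at hx ⊢
    tauto
  have e3 : glue Ω F E \ Ω ⊆ (F \ Ω) ∪ D := fun x hx => by
    have := hmem x
    simp only [glue, hD, Set.mem_compl_iff, Set.mem_inter_iff, Set.mem_union, Set.mem_sdiff,
      Set.mem_symmDiff] at hx ⊢
    tauto
  have e4 : (glue Ω F E)ᶜ ∩ Ω ⊆ Fᶜ ∩ Ω := fun x hx => by
    simp only [glue, Set.mem_inter_iff, Set.mem_union, Set.mem_sdiff, Set.mem_compl_iff] at hx ⊢
    tauto
  have hu : ∀ A B B' : Set (Space n), interaction s (B ∪ B') A ≤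
      interaction s B A + interaction s B' A := fun A B B' => by
    simp only [interaction_eq]
    exact lintegral_union_le _ _ _
  calc energy s Ω (glue Ω F E)
      ≤ interaction s (F ∩ Ω) (Fᶜ ∪ D) + interaction s ((F \ Ω) ∪ D) (Fᶜ ∩ Ω) :=
        add_le_add (interaction_mono e1 e2) (interaction_mono e3 e4)
    _ ≤ (interaction s (F ∩ Ω) Fᶜ + interaction s D Ω) +
        (interaction s (F \ Ω) (Fᶜ ∩ Ω) + interaction s D Ω) := by
        refine add_le_add ?_ ?_
        · rw [interaction_comm, interaction_comm (F ∩ Ω)]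
          exact (hu _ _ _).trans
            (add_le_add le_rfl (interaction_mono subset_rfl Set.inter_subset_right))
        · exact (hu _ _ _).trans
            (add_le_add le_rfl (interaction_mono subset_rfl Set.inter_subset_right))
    _ = _ := by rw [energy]; ring

/-- Limits of minimizers are minimizers. -/
lemma isMinimizer_of_tendsto {E : ℕ → Set (Space n)} {C Ω : Set (Space n)}
    (hΩ : MeasurableSet Ω) (hfin : interaction s Ω Ωᶜ ≠ ∞) (hC : NullMeasurableSet C volume)
    (hE : ∀ k, IsMinimizer s Ω (E k)) (h : TendstoL1Loc E C) : IsMinimizer s Ω C := by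
  refine ⟨hC, fun F hF hFC => ?_⟩
  obtain ⟨φ, hφ, hae⟩ := h.exists_seq_tendsto_ae
  have hsub : TendstoL1Loc (fun k => E (φ k)) C := fun K hK => (h K hK).comp hφ.tendsto_atTop
  have hEm : ∀ k, NullMeasurableSet (E k) volume := fun k => (hE k).nullMeasurableSet
  -- The integral of f is the interaction of Ωᶜ with Ω, which is finite; hence the gluing error
  -- tends to 0 although the sets converge only locally.
  set f : Space n → ℝ≥0∞ := Ωᶜ.indicator fun x => ∫⁻ y in Ω, ENNReal.ofReal (kern s (x - y)) with hf
  have hf1 : ∫⁻ x, f x ≠ ∞ := by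
    rw [hf, lintegral_indicator hΩ.compl, ← interaction_eq, interaction_comm]
    exact hfin
  have herr : ∀ k, interaction s (symmDiff (E (φ k)) C ∩ Ωᶜ) Ω =
      ∫⁻ x in symmDiff (E (φ k)) C, f x := fun k => by
    rw [hf, setLIntegral_indicator hΩ.compl, interaction_eq, Set.inter_comm]
  have hlim : Tendsto (fun k => 2 * (energy s Ω F + 2 * ∫⁻ x in symmDiff (E (φ k)) C, f x)) atTop
      (𝓝 (2 * (energy s Ω F + 2 * 0))) :=
    ENNReal.Tendsto.const_mul (tendsto_const_nhds.add (ENNReal.Tendsto.const_mul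
      (hsub.tendsto_setLIntegral hf1) (Or.inr (by norm_num)))) (Or.inr (by norm_num))
  have hle : ∀ k, 2 * energy s Ω (E (φ k)) ≤
      2 * (energy s Ω F + 2 * ∫⁻ x in symmDiff (E (φ k)) C, f x) := fun k => by
    rw [← herr]
    gcongr
    refine ((hE (φ k)).energy_le (glue Ω F (E (φ k))) ?_ ?_).trans (energy_glue_le hFC)
    · exact (hF.inter hΩ.nullMeasurableSet).union ((hEm _).diff hΩ.nullMeasurableSet)
    · ext x
      simp only [glue, Set.mem_inter_iff, Set.mem_union, Set.mem_sdiff, Set.mem_compl_iff]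
      tauto
  have hkey : 2 * energy s Ω C ≤ 2 * (energy s Ω F + 2 * 0) :=
    calc 2 * energy s Ω C ≤ liminf (fun k => 2 * energy s Ω (E (φ k))) atTop :=
          two_mul_energy_le_liminf (fun k => hEm (φ k)) hC hΩ hae
      _ ≤ liminf (fun k => 2 * (energy s Ω F + 2 * ∫⁻ x in symmDiff (E (φ k)) C, f x)) atTop :=
          liminf_le_liminf (Eventually.of_forall hle)
      _ = _ := hlim.liminf_eq
  rw [mul_zero, add_zero] at hkey
  exact (ENNReal.mul_le_mul_iff_right two_ne_zero (by norm_num)).1 hkey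

/-! ### Interior and boundary in the measure sense -/

lemma volume_smul_eq_zero {t : ℝ} (A : Set (Space n)) (h : volume A = 0) :
    volume (t • A) = 0 := by
  rw [Measure.addHaar_smul, h, mul_zero]

/-- This makes the invariance exact: the interior does not see null sets. -/
lemma measureInterior_congr {A B : Set (Space n)} (h : A =ᵐ[volume] B) :
    measureInterior A = measureInterior B := by
  ext x
  have : ∀ r, volume (ball x r \ A) = volume (ball x r \ B) := fun r =>
    measure_congr (EventuallyEq.inter (EventuallyEq.refl _ (ball x r)) h.compl)
  simp only [measureInterior, Set.mem_ofPred_eq, this]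

lemma measureBoundary_eq (A : Set (Space n)) :
    measureBoundary A = (measureInterior A)ᶜ ∩ (measureInterior Aᶜ)ᶜ := by
  ext x
  simp only [measureBoundary, measureInterior, Set.mem_ofPred_eq, Set.mem_inter_iff,
    Set.mem_compl_iff, not_exists, not_and, Set.sdiff_eq, compl_compl, pos_iff_ne_zero]
  exact ⟨fun h => ⟨fun r hr => (h r hr).2, fun r hr => (h r hr).1⟩,
    fun h r hr => ⟨h.2 r hr, h.1 r hr⟩⟩

lemma smul_compl {t : ℝ} (ht : t ≠ 0) (A : Set (Space n)) : t • Aᶜ = (t • A)ᶜ := by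
  rw [Set.compl_eq_univ_sdiff, Set.compl_eq_univ_sdiff, Set.smul_set_sdiff₀ ht,
    Set.smul_set_univ₀ ht]

lemma smul_measureInterior_subset {t : ℝ} (ht : 0 < t) (A : Set (Space n)) :
    t • measureInterior A ⊆ measureInterior (t • A) := by
  rintro _ ⟨x, ⟨r, hr, h⟩, rfl⟩
  refine ⟨t * r, mul_pos ht hr, ?_⟩
  have : ball (t • x) (t * r) = t • ball x r := by
    rw [_root_.smul_ball ht.ne', Real.norm_of_nonneg ht.le]
  dsimp only
  rw [this, ← Set.smul_set_sdiff₀ ht.ne']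
  exact volume_smul_eq_zero _ h

lemma smul_measureInterior {t : ℝ} (ht : 0 < t) (A : Set (Space n)) :
    t • measureInterior A = measureInterior (t • A) := by
  refine (smul_measureInterior_subset ht A).antisymm fun x hx => ?_
  have := smul_measureInterior_subset (inv_pos.2 ht) (t • A) (Set.smul_mem_smul_set hx)
  rw [inv_smul_smul₀ ht.ne'] at this
  exact (Set.mem_smul_set_iff_inv_smul_mem₀ ht.ne' _ _).2 this

lemma smul_ae_eq_of_chi {C : Set (Space n)} {t : ℝ} (ht : 0 < t)
    (h : ∀ᵐ x : Space n, chi C (t⁻¹ • x) = chi C x) : t • C =ᵐ[volume] C := by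
  filter_upwards [h] with x hx
  refine propext ?_
  change x ∈ t • C ↔ x ∈ C
  rw [Set.mem_smul_set_iff_inv_smul_mem₀ ht.ne']
  by_cases h1 : x ∈ C <;> by_cases h2 : t⁻¹ • x ∈ C <;>
    simp [chi_of_mem, chi_of_notMem, h1, h2] at hx ⊢

end NonlocalMinimal

/-! ### Conclusion -/

theorem mainTheorem5 (n : ℕ) (s : ℝ) (hs0 : 0 < s) (hs1 : s < 1)
    (E : Set (EuclideanSpace ℝ (Fin n)))
    (hE : NonlocalMinimal.IsMinimizer s (ball 0 1) E)
    (h0 : (0 : EuclideanSpace ℝ (Fin n)) ∈ NonlocalMinimal.measureBoundary E)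
    (C : Set (EuclideanSpace ℝ (Fin n))) (hC : NullMeasurableSet C volume)
    (l : ℕ → ℝ) (hl : Tendsto l atTop atTop)
    (hlim : NonlocalMinimal.TendstoL1Loc (fun k => l k • E) C) :
    (∀ R : ℝ, 0 < R → NonlocalMinimal.IsMinimizer s (ball 0 R) C) ∧
    ∀ t : ℝ, 0 < t →
      t • C =ᵐ[volume] C ∧
      t • NonlocalMinimal.measureInterior C = NonlocalMinimal.measureInterior C ∧
      t • NonlocalMinimal.measureInterior Cᶜ = NonlocalMinimal.measureInterior Cᶜ ∧
      t • NonlocalMinimal.measureBoundary C = NonlocalMinimal.measureBoundary C := by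
  -- In dimension 0 the space is a point, which cannot meet both E and its complement; hence 0 would
  -- not lie in the boundary.
  have hn : 0 < n := by
    rcases Nat.eq_zero_or_pos n with rfl | h
    · obtain ⟨h1, h2⟩ := h0 1 one_pos
      obtain ⟨x, hx⟩ := nonempty_of_measure_ne_zero h1.ne'
      obtain ⟨y, hy⟩ := nonempty_of_measure_ne_zero h2.ne'
      rw [Subsingleton.elim x y] at hx
      exact absurd hx.2 hy.2
    · exact h
  have hball : ∀ R : ℝ, 0 < R → NonlocalMinimal.interaction s
      (ball (0 : EuclideanSpace ℝ (Fin n)) R) (ball 0 R)ᶜ ≠ ∞ :=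
    fun R hR => NonlocalMinimal.interaction_ball_compl_ne_top hn hs0 hs1 hR
  have hfin := NonlocalMinimal.energy_ne_top_of_isMinimizer measurableSet_ball (hball 1 one_pos) hE
  have hshift : ∀ N : ℕ, NonlocalMinimal.TendstoL1Loc (fun k => l (k + N) • E) C := fun N K hK =>
    (hlim K hK).comp (tendsto_add_atTop_nat N)
  refine ⟨fun R hR => ?_, fun t ht => ?_⟩
  -- From some index on, λ_kE is a minimizer in the ball of radius λ_k ≥ R, hence in the ball of
  -- radius R.
  · obtain ⟨N, hN⟩ := eventually_atTop.1 (hl.eventually_ge_atTop R)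
    refine NonlocalMinimal.isMinimizer_of_tendsto measurableSet_ball (hball R hR) hC (fun k => ?_)
      (hshift N)
    have hk : R ≤ l (k + N) := hN _ (Nat.le_add_left N k)
    have hk0 : 0 < l (k + N) := hR.trans_le hk
    have h1 := hE.smul hk0
    rw [smul_unitBall_of_pos hk0] at h1
    exact h1.mono measurableSet_ball measurableSet_ball (ball_subset_ball hk)
      (NonlocalMinimal.energy_ne_top_of_isMinimizer measurableSet_ball (hball _ hk0) h1)
  · obtain ⟨N, hN⟩ := eventually_atTop.1 (hl.eventually_gt_atTop 0)
    have hcone : ∀ t : ℝ, 0 < t → t • C =ᵐ[volume] C := fun t ht =>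
      NonlocalMinimal.smul_ae_eq_of_chi ht (NonlocalMinimal.chi_smul_ae_eq hs0 hC
        (fun p hp => NonlocalMinimal.extD_apply_self_eq_zero hn hs0 hs1 one_pos hE hfin hC
          (fun k => hN _ (Nat.le_add_left N k)) (hl.comp (tendsto_add_atTop_nat N)) (hshift N) hp)
        (inv_pos.2 ht))
    have h1 : t • NonlocalMinimal.measureInterior C = NonlocalMinimal.measureInterior C := by
      rw [NonlocalMinimal.smul_measureInterior ht,
        NonlocalMinimal.measureInterior_congr (hcone t ht)]
    have h2 : t • NonlocalMinimal.measureInterior Cᶜ = NonlocalMinimal.measureInterior Cᶜ := by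
      rw [NonlocalMinimal.smul_measureInterior ht, NonlocalMinimal.smul_compl ht.ne',
        NonlocalMinimal.measureInterior_congr (hcone t ht).compl]
    refine ⟨hcone t ht, h1, h2, ?_⟩
    rw [NonlocalMinimal.measureBoundary_eq, Set.smul_set_inter₀ ht.ne',
      NonlocalMinimal.smul_compl ht.ne', NonlocalMinimal.smul_compl ht.ne', h1, h2]
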